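/- Let $d\ge 1$. For a nonempty bounded measurable set $\Omega\subset\mathbb R^d$ let $L^p(\Omega)$, $0<p<\infty$, be the usual Lebesgue space of real functions, and let $L^\infty(\Omega)=C(\overline\Omega)$ with the uniform norm. For $r\in\mathbb N=\{1,2,\dots\}$ and $h\in\mathbb R^d$ put $\Omega_{r,h}=\{x: x,x+h,\dots,x+rh\in\Omega\}$ and $\triangle_h^rf(x)=\sum_{j=0}^r(-1)^{r+j}\binom rj f(x+jh)$. For a nonempty set $\mathcal E\subset\mathbb S^{d-1}=\{x\in\mathbb R^d:\|x\|=1\}$ of directions let $$\omega^r_{\mathcal E}(f;\Omega)_p=\sup_{\xi\in\mathcal E}\ \sup_{|u|\le \operatorname{diam}\Omega}\|\triangle^r_{u\xi}f\|_{L^p(\Omega_{r,u\xi})},$$ let $\Pi^d_{r-1}(\mathcal E)$ be the set of all continuous $Q:\mathbb R^d\to\mathbb R$ such that for all $x\in\mathbb R^d$ and $\xi\in\mathcal E$ the function $t\mapsto Q(x+t\xi)$ is an algebraic polynomial of degree $<r$, let $E_r(f;\mathcal E)_{L^p(\Omega)}=\inf_{Q\in\Pi^d_{r-1}(\mathcal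 E)}\|f-Q\|_{L^p(\Omega)}$, and define the directional Whitney constant $$w_r(\Omega;\mathcal E)_p=\sup\{E_r(f;\mathcal E)_{L^p(\Omega)}:\ f\in L^p(\Omega),\ \omega^r_{\mathcal E}(f;\Omega)_p\le 1\}\in[0,\infty].$$ A compact set $G\subset\mathbb R^d$ is a Lip-2 domain with parameter $L>1$ if there is $\delta>0$ such that $\operatorname{diam}G\le L\delta$ and every $x\in G$ lies in a closed ball of radius $\delta$ contained in $G$. A compact set $G\subset\mathbb R^d$ is a $C^2$-domain if every $x\in\partial G$ has an open neighbourhood $U$ and a $C^2$ function $\varphi:U\to\mathbb R$ with $\nabla\varphi(x)\ne0$ and $G\cap U=\{y\in U:\varphi(y)\le0\}$. **Theorem.** (a) For all $0<p\le\infty$, $r\in\mathbb N$, $L>1$ and $\varepsilon_0>0$ there is a finite constant $C=C(p,d,r,L,\varepsilon_0)$ such that $$w_r(G;\mathcal E)_p\le C$$ for every set $\mathcal E\subset\mathbb S^{d-1}$ of $d$ linearly independent directions with $\min_{x\in\mathbb S^{d-1}}\max_{\xi\in\mathcal E}|\xi\cdot x|\ge\varepsilon_0$ and every nonempty connected compact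 Lip-2 domain $G\subset\mathbb R^d$ with parameter $L$. (b) Every nonempty connected compact $C^2$-domain $G\subset\mathbb R^d$ is a Lip-2 domain with some parameter $L>1$; hence (a) applies to it. -/

import Mathlib

open scoped NNReal ENNReal

noncomputable section

namespace DirWhitney

variable {d : ℕ}

/-- Membership in `L^p(Ω)` for a real function: the usual Lebesgue space if `p < ∞`, and
`L^∞(Ω) = C(closure Ω)`. Only the values on `Ω` (on its closure if `p = ∞`) matter. -/
def MemL (p : ℝ≥0∞) (f : EuclideanSpace ℝ (Fin d) → ℝ)
    (Ω : Set (EuclideanSpace ℝ (Fin d))) : Prop :=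
  if p = ⊤ then ContinuousOn f (closure Ω)
  else MeasureTheory.MemLp f p (MeasureTheory.volume.restrict Ω)

/-- The `L^p(Ω)` (quasi-)norm: `(∫_Ω |f|^p)^(1/p)` if `p < ∞`, and the uniform norm
(a true supremum, not an essential one) if `p = ∞`. -/
def normL (p : ℝ≥0∞) (f : EuclideanSpace ℝ (Fin d) → ℝ)
    (Ω : Set (EuclideanSpace ℝ (Fin d))) : ℝ≥0∞ :=
  if p = ⊤ then ⨆ x ∈ Ω, ‖f x‖ₑ
  else MeasureTheory.eLpNorm f p (MeasureTheory.volume.restrict Ω)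

/-- The finite difference `Δ_h^r f (x) = ∑_{j=0}^r (-1)^(r+j) (r choose j) f (x + j h)`. -/
def finDiff (r : ℕ) (h : EuclideanSpace ℝ (Fin d)) (f : EuclideanSpace ℝ (Fin d) → ℝ)
    (x : EuclideanSpace ℝ (Fin d)) : ℝ :=
  ∑ j ∈ Finset.range (r + 1), (-1 : ℝ) ^ (r + j) * (r.choose j : ℝ) * f (x + (j : ℝ) • h)

/-- `Ω_{r,h} = {x ∈ Ω : x, x + h, …, x + r h ∈ Ω}`. -/
def diffSet (Ω : Set (EuclideanSpace ℝ (Fin d))) (r : ℕ) (h : EuclideanSpace ℝ (Fin d)) :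
    Set (EuclideanSpace ℝ (Fin d)) :=
  {x | ∀ j : ℕ, j ≤ r → x + (j : ℝ) • h ∈ Ω}

/-- The modulus of smoothness of order `r` in the direction `ξ`:
`sup_{|u| ≤ t} ‖Δ_{uξ}^r f‖_{L^p(Ω_{r,uξ})}`. -/
def dirModulus (r : ℕ) (p : ℝ≥0∞) (f : EuclideanSpace ℝ (Fin d) → ℝ)
    (Ω : Set (EuclideanSpace ℝ (Fin d))) (ξ : EuclideanSpace ℝ (Fin d)) (t : ℝ) : ℝ≥0∞ :=
  ⨆ (u : ℝ) (_ : |u| ≤ t), normL p (finDiff r (u • ξ) f) (diffSet Ω r (u • ξ))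

/-- `ω_E^r(f; Ω)_p`: the supremum over `ξ ∈ E` of the moduli at `t = diam Ω`. -/
def modulus (r : ℕ) (p : ℝ≥0∞) (f : EuclideanSpace ℝ (Fin d) → ℝ)
    (Ω E : Set (EuclideanSpace ℝ (Fin d))) : ℝ≥0∞ :=
  ⨆ ξ ∈ E, dirModulus r p f Ω ξ (Metric.diam Ω)

/-- `Π_{r-1}^d(E)`: the continuous functions on `ℝ^d` whose restriction to every line with a
direction in `E` is an algebraic polynomial of degree `< r`. -/
def polySpace (r : ℕ) (E : Set (EuclideanSpace ℝ (Fin d))) :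
    Set (EuclideanSpace ℝ (Fin d) → ℝ) :=
  {Q | Continuous Q ∧ ∀ x, ∀ ξ ∈ E, ∃ P : Polynomial ℝ, P.degree < (r : WithBot ℕ) ∧
    ∀ t : ℝ, Q (x + t • ξ) = P.eval t}

/-- The error `E_r(f; E)_{L^p(Ω)}` of best approximation from `Π_{r-1}^d(E)`. -/
def bestApprox (r : ℕ) (p : ℝ≥0∞) (f : EuclideanSpace ℝ (Fin d) → ℝ)
    (Ω E : Set (EuclideanSpace ℝ (Fin d))) : ℝ≥0∞ :=
  ⨅ Q ∈ polySpace r E, normL p (fun x => f x - Q x) Ω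

/-- The directional Whitney constant `w_r(Ω; E)_p`, an element of `[0, ∞]`. -/
def whitneyConst (r : ℕ) (p : ℝ≥0∞) (Ω E : Set (EuclideanSpace ℝ (Fin d))) : ℝ≥0∞ :=
  ⨆ (f : EuclideanSpace ℝ (Fin d) → ℝ) (_ : MemL p f Ω) (_ : modulus r p f Ω E ≤ 1),
    bestApprox r p f Ω E

/-- `G` is a (compact) Lip-2 domain with parameter `L > 1`. -/
def IsLip2Domain (L : ℝ) (G : Set (EuclideanSpace ℝ (Fin d))) : Prop :=
  1 < L ∧ IsCompact G ∧ ∃ δ : ℝ, 0 < δ ∧ Metric.diam G ≤ L * δ ∧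
    ∀ x ∈ G, ∃ c, x ∈ Metric.closedBall c δ ∧ Metric.closedBall c δ ⊆ G

/-- `G` is a compact `C^2`-domain: near each of its boundary points it is a sublevel set
`{φ ≤ 0}` of a `C^2` function `φ` whose gradient does not vanish at that point. -/
def IsC2Domain (G : Set (EuclideanSpace ℝ (Fin d))) : Prop :=
  IsCompact G ∧ ∀ x ∈ frontier G, ∃ U : Set (EuclideanSpace ℝ (Fin d)), IsOpen U ∧ x ∈ U ∧
    ∃ φ : EuclideanSpace ℝ (Fin d) → ℝ, ContDiffOn ℝ 2 φ U ∧ fderiv ℝ φ x ≠ 0 ∧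
      ∀ y ∈ U, y ∈ G ↔ φ y ≤ 0

end DirWhitney

end

/-!
The inequality rests on three facts, all with constants that depend only on `p`, `d`, `r`, `L` and
`ε₀`.

* *Bounds propagate along the directions.* If `x + uξ, …, x + r uξ` lie in a set `J` for all `x ∈ K`,
  then the norm of a function on `K` is bounded by its modulus of smoothness and its norm on `J`,
  because `f x` is a combination of the `r`-th difference and of these values. For every vector `y`
  some direction `ξ ∈ E` has `|ξ · y| ≥ ε₀ ‖y‖`, so every point slightly outside a ball is carried
  into it by such steps. Hence a ball controls larger concentric balls inside `G`
  (`exists_controls_closedBall_concentric`), translates of itself within a common ball in `G`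
  (`exists_controls_closedBall_move`), and, for the radius `δ`, other such balls in `G` that meet it
  or almost meet it (`exists_controls_closedBall_cross`). As `G` is connected and has
  diameter at most `L δ`, a chain of boundedly many balls joins any two of them, and a single small
  ball controls all of `G` (`exists_controls_of_isConnected`). The polynomial is not changed along
  the way, so that the global geometry of the space `Π(E)` plays no role.

* *A local estimate with a small loss.* On some ball of radius `τ δ` every `f` has a
  `Q ∈ Π(E)` with `‖f - Q‖ ≤ θ ‖f‖_{L^p(G)} + C ω(f)`, with `θ > 0` as small as desired
  (`exists_polySpace_local`). In the coordinates given by `E` this is a statement about the unit cube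
  (`exists_coordPoly_local`). It follows by compactness: a function is truncated where it exceeds a
  multiple of its norm, an averaged combination of shifts replaces it by a Lipschitz function up to
  differences, and by the Arzelà–Ascoli theorem a Lipschitz function with small differences is close
  to one with vanishing differences, which is a polynomial in each variable
  (`exists_coordPoly_near`, `exists_coordPoly_of_fdiff_eq_zero`). This covers `p < 1` as well,
  where no duality or convexity is available.

* *Self-improvement.* Adding an element of `Π(E)` does not change the modulus. Applying the first two
  facts to `f - Q`, for an arbitrary `Q ∈ Π(E)`, and taking the infimum over `Q` gives
  `E_r(f) ≤ K + E_r(f) / 2`, so `E_r(f) ≤ 2 K` (`bestApprox_le_of_correction`).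

A compact `C²` domain has inner balls of a fixed radius by Taylor's formula for the defining functions
and compactness (`IsC2Domain.isLip2Domain`).
-/

noncomputable section

open MeasureTheory ENNReal Metric

namespace DirWhitney

/-! ### The `L^p` quasi-norms -/

section PNorm

variable {α : Type*} [MeasureSpace α]

/-- The `L^p` (quasi-)norm of `f` on a set `K` of an arbitrary measure space; for `p = ∞` it is the
true supremum. On Euclidean space it is `normL`. -/
def pNorm (p : ℝ≥0∞) (f : α → ℝ) (K : Set α) : ℝ≥0∞ :=
  if p = ⊤ then ⨆ x ∈ K, ‖f x‖ₑ else eLpNorm f p (volume.restrict K)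

theorem pNorm_top (f : α → ℝ) (K : Set α) : pNorm ⊤ f K = ⨆ x ∈ K, ‖f x‖ₑ := if_pos rfl

theorem pNorm_of_ne_top {p : ℝ≥0∞} (hp : p ≠ ⊤) (f : α → ℝ) (K : Set α) :
    pNorm p f K = eLpNorm f p (volume.restrict K) := if_neg hp

theorem pNorm_top_le_iff {f : α → ℝ} {K : Set α} {C : ℝ≥0} :
    pNorm ⊤ f K ≤ C ↔ ∀ x ∈ K, |f x| ≤ C := by
  rw [pNorm_top, iSup₂_le_iff]
  refine forall₂_congr fun x _ => ?_
  rw [enorm_eq_nnnorm, ENNReal.coe_le_coe, ← NNReal.coe_le_coe, coe_nnnorm, Real.norm_eq_abs]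

/-- The constant in the quasi-triangle inequality of `L^p`. -/
def addConst (p : ℝ≥0∞) : ℝ≥0 := (LpAddConst p).toNNReal

theorem coe_addConst (p : ℝ≥0∞) : (addConst p : ℝ≥0∞) = LpAddConst p :=
  ENNReal.coe_toNNReal (LpAddConst_lt_top p).ne

theorem one_le_addConst (p : ℝ≥0∞) : 1 ≤ addConst p := by
  rw [← ENNReal.coe_le_coe, coe_addConst, LpAddConst, ENNReal.coe_one]
  split_ifs with h
  · apply ENNReal.one_le_rpow (by norm_num)
    rw [sub_pos, one_div]
    have h1 : 0 < p.toReal := ENNReal.toReal_pos h.1.ne' (h.2.trans ENNReal.one_lt_top).ne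
    have h2 : p.toReal < 1 := by
      simpa using (ENNReal.toReal_lt_toReal (h.2.trans ENNReal.one_lt_top).ne (by simp)).2 h.2
    exact (one_lt_inv₀ h1).2 h2
  · exact le_rfl

theorem pNorm_mono_set {p : ℝ≥0∞} (f : α → ℝ) {J K : Set α} (h : J ⊆ K) :
    pNorm p f J ≤ pNorm p f K := by
  unfold pNorm
  split_ifs
  · exact biSup_mono h
  · exact eLpNorm_mono_measure _ (Measure.restrict_mono h le_rfl)

theorem pNorm_congr {p : ℝ≥0∞} {f g : α → ℝ} {K : Set α} (hK : MeasurableSet K)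
    (h : ∀ x ∈ K, f x = g x) : pNorm p f K = pNorm p g K := by
  unfold pNorm
  split_ifs
  · exact iSup_congr fun x => iSup_congr fun hx => by rw [h x hx]
  · exact eLpNorm_congr_ae ((ae_restrict_iff' hK).2 (Filter.Eventually.of_forall h))

theorem pNorm_zero (p : ℝ≥0∞) (K : Set α) : pNorm p (fun _ => 0) K = 0 := by
  unfold pNorm
  split_ifs
  · simp
  · simp

theorem pNorm_const_mul (p : ℝ≥0∞) (c : ℝ) (f : α → ℝ) (K : Set α) :
    pNorm p (fun x => c * f x) K = ‖c‖ₑ * pNorm p f K := by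
  unfold pNorm
  split_ifs
  · simp only [enorm_mul, ENNReal.mul_iSup]
  · exact eLpNorm_const_smul c f p _

theorem pNorm_add_le (p : ℝ≥0∞) {f g : α → ℝ} (hf : Measurable f) (hg : Measurable g)
    (K : Set α) :
    pNorm p (fun x => f x + g x) K ≤ addConst p * (pNorm p f K + pNorm p g K) := by
  rw [coe_addConst]
  unfold pNorm
  split_ifs with hp
  · rw [hp, LpAddConst_of_one_le le_top, one_mul]
    refine iSup₂_le fun x hx => (enorm_add_le _ _).trans (add_le_add ?_ ?_)
    · exact le_iSup₂ (f := fun x (_ : x ∈ K) => ‖f x‖ₑ) x hx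
    · exact le_iSup₂ (f := fun x (_ : x ∈ K) => ‖g x‖ₑ) x hx
  · exact eLpNorm_add_le' hf.aestronglyMeasurable hg.aestronglyMeasurable p

theorem pNorm_sum_le (p : ℝ≥0∞) {ι : Type*} (s : Finset ι) (b : ι → ℝ) {f : ι → α → ℝ}
    (hf : ∀ i, Measurable (f i)) (K : Set α) {W : ℝ≥0∞} (h : ∀ i ∈ s, pNorm p (f i) K ≤ W) :
    pNorm p (fun x => ∑ i ∈ s, b i * f i x) K ≤
      (addConst p ^ s.card * ∑ i ∈ s, ‖b i‖₊ : ℝ≥0) * W := by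
  classical
  induction s using Finset.induction_on with
  | empty => simp [pNorm_zero]
  | insert a s ha ih =>
    simp only [Finset.sum_insert ha, Finset.card_insert_of_notMem ha]
    have h1 := ih fun i hi => h i (Finset.mem_insert_of_mem hi)
    have h2 : pNorm p (fun x => b a * f a x) K ≤
        (addConst p ^ s.card * ‖b a‖₊ : ℝ≥0) * W := by
      rw [pNorm_const_mul]
      refine mul_le_mul' ?_ (h a (Finset.mem_insert_self _ _))
      rw [enorm_eq_nnnorm, ENNReal.coe_le_coe]
      exact le_mul_of_one_le_left' (one_le_pow₀ (one_le_addConst p))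
    refine (pNorm_add_le p ((hf a).const_mul _)
      (Finset.measurable_fun_sum _ fun i _ => (hf i).const_mul _) K).trans ?_
    calc _ ≤ (addConst p : ℝ≥0∞) * ((addConst p ^ s.card * ‖b a‖₊ : ℝ≥0) * W +
          (addConst p ^ s.card * ∑ i ∈ s, ‖b i‖₊ : ℝ≥0) * W) := by gcongr
      _ = _ := by push_cast; ring

theorem pNorm_union_le {p : ℝ≥0∞} (hp0 : p ≠ 0) (f : α → ℝ) (J K : Set α) :
    pNorm p f (J ∪ K) ≤ addConst p * (pNorm p f J + pNorm p f K) := by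
  rw [coe_addConst]
  unfold pNorm
  split_ifs with hp
  · rw [hp, LpAddConst_of_one_le le_top, one_mul, iSup_union]
    exact sup_le le_self_add le_add_self
  · refine (eLpNorm_mono_measure _ (Measure.restrict_union_le J K)).trans ?_
    simp only [eLpNorm_eq_lintegral_rpow_enorm_toReal hp0 hp, lintegral_add_measure, one_div]
    exact ENNReal.rpow_add_le_mul_rpow_add_rpow'' _ _

theorem pNorm_biUnion_le {p : ℝ≥0∞} (hp0 : p ≠ 0) (f : α → ℝ) {ι : Type*} (s : Finset ι)
    (K : ι → Set α) :
    pNorm p f (⋃ i ∈ s, K i) ≤ (addConst p ^ s.card : ℝ≥0) * ∑ i ∈ s, pNorm p f (K i) := by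
  classical
  induction s using Finset.induction_on with
  | empty =>
    simp only [Finset.notMem_empty, Set.iUnion_of_empty, Set.iUnion_empty, Finset.sum_empty,
      mul_zero, nonpos_iff_eq_zero]
    unfold pNorm
    split_ifs <;> simp
  | insert a s ha ih =>
    rw [Finset.set_biUnion_insert, Finset.sum_insert ha, Finset.card_insert_of_notMem ha]
    have h1 : (1 : ℝ≥0∞) ≤ (addConst p ^ s.card : ℝ≥0) := by
      exact_mod_cast one_le_pow₀ (one_le_addConst p)
    calc _ ≤ (addConst p : ℝ≥0∞) * (pNorm p f (K a) + pNorm p f (⋃ i ∈ s, K i)) :=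
          pNorm_union_le hp0 f _ _
      _ ≤ (addConst p : ℝ≥0∞) * ((addConst p ^ s.card : ℝ≥0) * pNorm p f (K a) +
          (addConst p ^ s.card : ℝ≥0) * ∑ i ∈ s, pNorm p f (K i)) := by
        gcongr
        exact le_mul_of_one_le_left' h1
      _ = _ := by push_cast; ring

/-- Translating a function: if `K + h ⊆ J`, the norm of `f (· + h)` on `K` is at most that of `f`
on `J`. -/
theorem pNorm_comp_add_right_le {V : Type*} [AddCommGroup V] [MeasureSpace V] [MeasurableAdd V]
    [(volume : Measure V).IsAddRightInvariant] (p : ℝ≥0∞) {f : V → ℝ} (hf : Measurable f)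
    {K J : Set V} (hJ : MeasurableSet J) (h : V) (hKJ : ∀ x ∈ K, x + h ∈ J) :
    pNorm p (fun x => f (x + h)) K ≤ pNorm p f J := by
  unfold pNorm
  split_ifs
  · exact iSup₂_le fun x hx => le_iSup₂ (f := fun x (_ : x ∈ J) => ‖f x‖ₑ) (x + h) (hKJ x hx)
  · have hmp : MeasurePreserving (· + h) (volume.restrict ((· + h) ⁻¹' J)) (volume.restrict J) :=
      (measurePreserving_add_right volume h).restrict_preimage hJ
    calc _ ≤ eLpNorm (f ∘ (· + h)) p (volume.restrict ((· + h) ⁻¹' J)) :=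
          eLpNorm_mono_measure _ (Measure.restrict_mono (fun x hx => hKJ x hx) le_rfl)
      _ = _ := eLpNorm_comp_measurePreserving hf.aestronglyMeasurable hmp

end PNorm

theorem normL_eq_pNorm {d : ℕ} (p : ℝ≥0∞) (f : EuclideanSpace ℝ (Fin d) → ℝ)
    (K : Set (EuclideanSpace ℝ (Fin d))) : normL p f K = pNorm p f K := rfl

/-! ### Finite differences -/

section FDiff

variable {V W : Type*} [AddCommGroup V] [Module ℝ V] [AddCommGroup W] [Module ℝ W]

/-- The finite difference `finDiff` on an arbitrary real vector space. -/
def fdiff (r : ℕ) (h : V) (f : V → ℝ) (x : V) : ℝ :=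
  ∑ j ∈ Finset.range (r + 1), (-1 : ℝ) ^ (r + j) * (r.choose j : ℝ) * f (x + (j : ℝ) • h)

theorem finDiff_eq_fdiff {d : ℕ} (r : ℕ) (h : EuclideanSpace ℝ (Fin d))
    (f : EuclideanSpace ℝ (Fin d) → ℝ) : finDiff r h f = fdiff r h f := rfl

/-- The value `f x` from the difference and the values at `x + h, …, x + r h`. -/
theorem eq_fdiff_sub_sum (r : ℕ) (h : V) (f : V → ℝ) (x : V) :
    f x = (-1) ^ r * fdiff r h f x +
      ∑ j ∈ Finset.range r,
        (-(-1 : ℝ) ^ (j + 1) * (r.choose (j + 1) : ℝ)) * f (x + ((j + 1 : ℕ) : ℝ) • h) := by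
  have h1 : ((-1 : ℝ) ^ r) * (-1) ^ r = 1 := by rw [← mul_pow]; simp
  rw [fdiff, Finset.sum_range_succ', mul_add, Finset.mul_sum, add_right_comm,
    ← Finset.sum_add_distrib, Finset.sum_eq_zero]
  · simp [← mul_assoc, h1]
  · intro j _
    rw [pow_add]
    linear_combination (((-1 : ℝ) ^ (j + 1)) * (r.choose (j + 1) : ℝ) *
      f (x + ((j + 1 : ℕ) : ℝ) • h)) * h1

theorem fdiff_sub (r : ℕ) (h : V) (f g : V → ℝ) (x : V) :
    fdiff r h (fun y => f y - g y) x = fdiff r h f x - fdiff r h g x := by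
  simp only [fdiff, mul_sub, Finset.sum_sub_distrib]

theorem fdiff_const_mul (r : ℕ) (h : V) (c : ℝ) (f : V → ℝ) (x : V) :
    fdiff r h (fun y => c * f y) x = c * fdiff r h f x := by
  simp only [fdiff, Finset.mul_sum]
  exact Finset.sum_congr rfl fun j _ => by ring

theorem measurable_fdiff [MeasurableSpace V] [MeasurableAdd V] (r : ℕ) (h : V) {f : V → ℝ}
    (hf : Measurable f) : Measurable (fdiff r h f) :=
  Finset.measurable_fun_sum _ fun _ _ => (hf.comp (measurable_add_const _)).const_mul _

theorem sum_abs_choose (r : ℕ) :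
    ∑ j ∈ Finset.range (r + 1), |(-1 : ℝ) ^ (r + j) * (r.choose j : ℝ)| = 2 ^ r := by
  simp only [abs_mul, abs_pow, abs_neg, abs_one, one_pow, one_mul, Nat.abs_cast]
  exact_mod_cast Nat.sum_range_choose r

theorem abs_fdiff_le (r : ℕ) (h : V) {f : V → ℝ} {x : V} {M : ℝ}
    (hf : ∀ j ≤ r, |f (x + (j : ℝ) • h)| ≤ M) : |fdiff r h f x| ≤ 2 ^ r * M := by
  rw [fdiff, ← sum_abs_choose, Finset.sum_mul]
  refine (Finset.abs_sum_le_sum_abs _ _).trans (Finset.sum_le_sum fun j hj => ?_)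
  rw [abs_mul]
  exact mul_le_mul_of_nonneg_left (hf j (Finset.mem_range_succ_iff.1 hj)) (abs_nonneg _)

/-- A polynomial of degree `< r` has vanishing `r`-th differences. -/
theorem fdiff_eq_zero_of_polynomial {r : ℕ} (hr : 1 ≤ r) {h : V} {f : V → ℝ} {x : V}
    {P : Polynomial ℝ} {u : ℝ} (hP : P.degree < r)
    (hf : ∀ j ≤ r, f (x + (j : ℝ) • h) = P.eval ((j : ℝ) * u)) : fdiff r h f x = 0 := by
  have hn : (P.comp (Polynomial.C u * Polynomial.X)).natDegree < r := by
    refine Polynomial.natDegree_comp_le.trans_lt ?_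
    have h1 := (Polynomial.natDegree_C_mul_le u Polynomial.X).trans Polynomial.natDegree_X_le
    have h2 : P.natDegree < r := by
      rcases eq_or_ne P 0 with rfl | h0
      · simpa using Nat.lt_of_lt_of_le Nat.zero_lt_one hr
      · exact (Polynomial.natDegree_lt_iff_degree_lt h0).2 hP
    nlinarith
  have h0 := congrFun (Polynomial.fwdDiff_iter_eq_zero_of_degree_lt hn) 0
  rw [fwdDiff_iter_eq_sum_shift] at h0
  rw [fdiff, ← Pi.zero_apply (M := fun _ : ℝ => ℝ) 0, ← h0]
  refine Finset.sum_congr rfl fun j hj => ?_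
  have hj := Finset.mem_range_succ_iff.1 hj
  have h3 : (-1 : ℝ) ^ (r + j) = (-1) ^ (r - j) := by
    rw [← Nat.sub_add_cancel hj, add_assoc, pow_add, Nat.add_sub_cancel, ← two_mul, pow_mul]
    simp
  rw [hf j hj, h3, zsmul_eq_mul, Polynomial.eval_comp, Polynomial.eval_C_mul, Polynomial.eval_X,
    nsmul_one, zero_add, mul_comm (j : ℝ) u]
  push_cast
  rfl

end FDiff

/-! ### Propagation of bounds along the directions -/

section Controls

variable {d : ℕ}

/-- The norm of a function on `K` is bounded by its norm on `J` up to its directional modulus of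
smoothness on `G`. -/
def Controls (r : ℕ) (p : ℝ≥0∞) (E G : Set (EuclideanSpace ℝ (Fin d))) (A : ℝ≥0)
    (J K : Set (EuclideanSpace ℝ (Fin d))) : Prop :=
  ∀ g : EuclideanSpace ℝ (Fin d) → ℝ, Measurable g →
    normL p g K ≤ A * (modulus r p g G E + normL p g J)

variable {r : ℕ} {p : ℝ≥0∞} {E G J K M : Set (EuclideanSpace ℝ (Fin d))} {A B : ℝ≥0}

theorem Controls.of_subset (h : K ⊆ J) : Controls r p E G 1 J K := fun g _ => by
  rw [ENNReal.coe_one, one_mul]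
  exact (pNorm_mono_set g h).trans le_add_self

theorem Controls.mono_left (h : Controls r p E G A J K) (hM : J ⊆ M) :
    Controls r p E G A M K := fun g hg =>
  (h g hg).trans (mul_le_mul_right (add_le_add_right (pNorm_mono_set g hM) _) _)

theorem Controls.mono_const (h : Controls r p E G A J K) (hAB : A ≤ B) :
    Controls r p E G B J K := fun g hg =>
  (h g hg).trans (mul_le_mul_left (ENNReal.coe_le_coe.2 hAB) _)

theorem Controls.trans (h₁ : Controls r p E G A J K) (h₂ : Controls r p E G B K M) :
    Controls r p E G (B * (1 + A)) J M := fun g hg => by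
  calc _ ≤ (B : ℝ≥0∞) * (modulus r p g G E + normL p g K) := h₂ g hg
    _ ≤ (B : ℝ≥0∞) * ((modulus r p g G E + normL p g J) +
          A * (modulus r p g G E + normL p g J)) := by
        gcongr
        · exact le_self_add
        · exact h₁ g hg
    _ = _ := by push_cast; ring

theorem Controls.union (hp : p ≠ 0) (h₁ : Controls r p E G A J K)
    (h₂ : Controls r p E G B J M) :
    Controls r p E G (addConst p * (A + B)) J (K ∪ M) := fun g hg => by
  calc _ ≤ (addConst p : ℝ≥0∞) * (normL p g K + normL p g M) := pNorm_union_le hp g K M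
    _ ≤ (addConst p : ℝ≥0∞) * (A * (modulus r p g G E + normL p g J) +
          B * (modulus r p g G E + normL p g J)) := by
        gcongr
        · exact h₁ g hg
        · exact h₂ g hg
    _ = _ := by push_cast; ring

theorem normL_finDiff_le_modulus (r : ℕ) (p : ℝ≥0∞) (g : EuclideanSpace ℝ (Fin d) → ℝ)
    {ξ : EuclideanSpace ℝ (Fin d)} (hξ : ξ ∈ E) {u : ℝ} (hu : |u| ≤ Metric.diam G) :
    normL p (finDiff r (u • ξ) g) (diffSet G r (u • ξ)) ≤ modulus r p g G E :=
  le_trans (le_iSup₂ (f := fun (u : ℝ) (_ : |u| ≤ Metric.diam G) =>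
      normL p (finDiff r (u • ξ) g) (diffSet G r (u • ξ))) u hu)
    (le_iSup₂ (f := fun ξ (_ : ξ ∈ E) => dirModulus r p g G ξ (Metric.diam G)) ξ hξ)

/-- The constant of a single propagation step with one fixed difference step. -/
def stepConst (r : ℕ) (p : ℝ≥0∞) : ℝ≥0 :=
  addConst p * (1 + addConst p ^ (Finset.range r).card * ∑ j ∈ Finset.range r,
    ‖-(-1 : ℝ) ^ (j + 1) * (r.choose (j + 1) : ℝ)‖₊)

/-- If `x + h, …, x + r h ∈ J` for all `x ∈ K`, then `J` controls `K`. -/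
theorem controls_of_forall_add_mem (hJ : MeasurableSet J) (hJG : J ⊆ G)
    (hKG : K ⊆ G) {ξ : EuclideanSpace ℝ (Fin d)} (hξ : ξ ∈ E) {u : ℝ}
    (hu : |u| ≤ Metric.diam G)
    (h : ∀ x ∈ K, ∀ j < r, x + ((j + 1 : ℕ) : ℝ) • u • ξ ∈ J) :
    Controls r p E G (stepConst r p) J K := fun g hg => by
  have hΔ : normL p (fun x => (-1) ^ r * finDiff r (u • ξ) g x) K ≤ modulus r p g G E := by
    rw [normL_eq_pNorm, pNorm_const_mul]
    refine le_trans ?_ (normL_finDiff_le_modulus r p g hξ hu)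
    simp only [enorm_pow, enorm_neg, enorm_one, one_pow, one_mul]
    refine pNorm_mono_set _ fun x hx j hj => ?_
    rcases j with _ | j
    · simpa using hKG hx
    · exact hJG (h x hx j hj)
  have hsum := pNorm_sum_le p (Finset.range r)
    (fun j => -(-1 : ℝ) ^ (j + 1) * (r.choose (j + 1) : ℝ))
    (f := fun j x => g (x + ((j + 1 : ℕ) : ℝ) • u • ξ))
    (fun j => hg.comp (measurable_add_const _)) K (W := normL p g J)
    (fun j hj => pNorm_comp_add_right_le p hg hJ _ fun x hx => h x hx j (Finset.mem_range.1 hj))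
  have heq : g = fun x => (-1) ^ r * finDiff r (u • ξ) g x + ∑ j ∈ Finset.range r,
      (-(-1 : ℝ) ^ (j + 1) * (r.choose (j + 1) : ℝ)) * g (x + ((j + 1 : ℕ) : ℝ) • u • ξ) :=
    funext fun x => eq_fdiff_sub_sum r (u • ξ) g x
  have hm1 : Measurable fun x => (-1) ^ r * finDiff r (u • ξ) g x :=
    (measurable_fdiff r (u • ξ) hg).const_mul _
  have hm2 : Measurable fun x => ∑ j ∈ Finset.range r,
      (-(-1 : ℝ) ^ (j + 1) * (r.choose (j + 1) : ℝ)) * g (x + ((j + 1 : ℕ) : ℝ) • u • ξ) :=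
    Finset.measurable_fun_sum _ fun j _ => (hg.comp (measurable_add_const _)).const_mul _
  have h3 := pNorm_add_le p hm1 hm2 K
  rw [← heq] at h3
  refine h3.trans ?_
  set S : ℝ≥0 := addConst p ^ (Finset.range r).card * ∑ j ∈ Finset.range r,
    ‖-(-1 : ℝ) ^ (j + 1) * (r.choose (j + 1) : ℝ)‖₊ with hS
  calc _ ≤ (addConst p : ℝ≥0∞) * ((modulus r p g G E + normL p g J) +
        S * (modulus r p g G E + normL p g J)) := by
        gcongr
        · exact hΔ.trans le_self_add
        · exact hsum.trans (mul_le_mul_right le_add_self _)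
    _ = _ := by rw [stepConst, ← hS]; push_cast; ring

/-- The constant of a propagation step in which every point may choose among `d` directions and
two orientations. -/
def extConst (d r : ℕ) (p : ℝ≥0∞) : ℝ≥0 :=
  addConst p * (1 + addConst p ^ (2 * d) * ((2 * d : ℕ) * stepConst r p))

/-- If every point of `K` lies in `J` or is carried into `J` by the steps `u ξ, …, r u ξ` or
`-u ξ, …, -r u ξ` for some direction `ξ ∈ E`, then `J` controls `K`. -/
theorem controls_of_step (hp : p ≠ 0) (hE : E.ncard = d) (hd : 1 ≤ d)
    (hJ : MeasurableSet J)
    (hJG : J ⊆ G) (hKG : K ⊆ G) {u : ℝ} (hu : |u| ≤ Metric.diam G)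
    (h : ∀ x ∈ K, x ∈ J ∨ ∃ ξ ∈ E, ∃ σ : ℝ, (σ = 1 ∨ σ = -1) ∧
      ∀ j < r, x + ((j + 1 : ℕ) : ℝ) • (σ * u) • ξ ∈ J) :
    Controls r p E G (extConst d r p) J K := by
  classical
  have hfin : E.Finite := Set.finite_of_ncard_pos (by omega)
  set H : Finset (EuclideanSpace ℝ (Fin d) × ℝ) := hfin.toFinset ×ˢ {1, -1} with hH
  have hcard : H.card = 2 * d := by
    rw [hH, Finset.card_product, ← Set.ncard_eq_toFinset_card E hfin, hE, Finset.card_pair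
      (by norm_num), mul_comm]
  let KK : EuclideanSpace ℝ (Fin d) × ℝ → Set (EuclideanSpace ℝ (Fin d)) := fun h =>
    {x ∈ K | ∀ j < r, x + ((j + 1 : ℕ) : ℝ) • (h.2 * u) • h.1 ∈ J}
  have hKK : ∀ h ∈ H, Controls r p E G (stepConst r p) J (KK h) := by
    intro h hh
    rw [hH, Finset.mem_product, Set.Finite.mem_toFinset, Finset.mem_insert,
      Finset.mem_singleton] at hh
    refine controls_of_forall_add_mem hJ hJG (fun x hx => hKG hx.1) hh.1
      (u := h.2 * u) ?_ fun x hx => hx.2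
    rcases hh.2 with h2 | h2 <;> simpa [h2] using hu
  have hcov : K ⊆ J ∪ ⋃ h ∈ H, KK h := by
    intro x hx
    rcases h x hx with hxJ | ⟨ξ, hξ, σ, hσ, hj⟩
    · exact Or.inl hxJ
    · refine Or.inr (Set.mem_biUnion (x := (ξ, σ)) ?_ ⟨hx, hj⟩)
      simpa [hH, hξ] using hσ
  intro g hg
  have h1 := pNorm_biUnion_le hp g H KK
  have h2 : ∑ h ∈ H, pNorm p g (KK h) ≤
      ((2 * d : ℕ) * stepConst r p : ℝ≥0) * (modulus r p g G E + normL p g J) := by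
    refine (Finset.sum_le_card_nsmul H _ _ fun h hh => hKK h hh g hg).trans ?_
    rw [hcard, nsmul_eq_mul]
    push_cast
    simp only [mul_assoc, le_refl]
  rw [hcard] at h1
  calc _ ≤ normL p g (J ∪ ⋃ h ∈ H, KK h) := pNorm_mono_set g hcov
    _ ≤ (addConst p : ℝ≥0∞) * (normL p g J + normL p g (⋃ h ∈ H, KK h)) :=
      pNorm_union_le hp g _ _
    _ ≤ (addConst p : ℝ≥0∞) * ((modulus r p g G E + normL p g J) + (addConst p ^ (2 * d) : ℝ≥0) *
        (((2 * d : ℕ) * stepConst r p : ℝ≥0) * (modulus r p g G E + normL p g J))) := by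
        gcongr
        · exact le_add_self
        · exact h1.trans (mul_le_mul_right h2 _)
    _ = _ := by rw [extConst]; push_cast; ring

end Controls

/-! ### Propagation between balls -/

section Balls

variable {d : ℕ}

/-- The standing assumptions: `E` consists of `d` unit vectors one of which makes, for every
vector, an angle with cosine at least `ε` with it up to sign, and `G` is a set of diameter at least
`δ`. -/
structure IsSetting (ε δ : ℝ) (E G : Set (EuclideanSpace ℝ (Fin d))) : Prop where
  one_le : 1 ≤ d
  norm_eq : ∀ ξ ∈ E, ‖ξ‖ = 1
  ncard_eq : E.ncard = d
  exists_inner : ∀ y : EuclideanSpace ℝ (Fin d), ∃ ξ ∈ E, ∃ σ : ℝ, (σ = 1 ∨ σ = -1) ∧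
    σ * inner ℝ ξ y ≤ -(ε * ‖y‖)
  delta_pos : 0 < δ
  delta_le : δ ≤ diam G

/-- A step of length `v` along `ξ`, taken in the orientation pointing against `y`, shortens `y`. -/
theorem norm_add_smul_sq_le {ε σ v : ℝ} {ξ y : EuclideanSpace ℝ (Fin d)} (hξ : ‖ξ‖ = 1)
    (hσ : σ = 1 ∨ σ = -1) (h : σ * inner ℝ ξ y ≤ -(ε * ‖y‖)) (hv0 : 0 ≤ v)
    (hv : v ≤ ε * ‖y‖) : ‖y + (σ * v) • ξ‖ ^ 2 ≤ ‖y‖ ^ 2 - v * (ε * ‖y‖) := by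
  have hσ2 : σ ^ 2 = 1 := by rcases hσ with rfl | rfl <;> norm_num
  have h1 : ‖(σ * v) • ξ‖ ^ 2 = v ^ 2 := by
    rw [norm_smul, hξ, mul_one, Real.norm_eq_abs, sq_abs, mul_pow, hσ2, one_mul]
  rw [norm_add_sq_real, h1, inner_smul_right, real_inner_comm]
  nlinarith

theorem norm_add_smul_le {ε σ v κ R : ℝ} {ξ y : EuclideanSpace ℝ (Fin d)} (hξ : ‖ξ‖ = 1)
    (hσ : σ = 1 ∨ σ = -1) (h : σ * inner ℝ ξ y ≤ -(ε * ‖y‖)) (hv0 : 0 ≤ v)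
    (hv : v ≤ ε * ‖y‖) (hR : ‖y‖ ≤ R) (hκ : κ ≤ 1) (hvκ : 2 * κ * R ^ 2 ≤ v * (ε * ‖y‖) ) :
    ‖y + (σ * v) • ξ‖ ≤ (1 - κ) * R := by
  have hR0 : 0 ≤ R := (norm_nonneg y).trans hR
  have h1 := norm_add_smul_sq_le hξ hσ h hv0 hv
  have h2 : ‖y‖ ^ 2 ≤ R ^ 2 := pow_le_pow_left₀ (norm_nonneg y) hR 2
  refine le_of_sq_le_sq ?_ (mul_nonneg (by linarith) hR0)
  nlinarith [mul_nonneg (sq_nonneg κ) (sq_nonneg R)]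

variable {r : ℕ} {p : ℝ≥0∞} {E G : Set (EuclideanSpace ℝ (Fin d))} {ε δ : ℝ}

/-- A ball controls a slightly larger concentric ball. -/
theorem controls_closedBall_of_sq_le (hs : IsSetting ε δ E G) (hp : p ≠ 0) (hr : 1 ≤ r)
    (hε : 0 < ε) (hε1 : ε ≤ 1) {c : EuclideanSpace ℝ (Fin d)} {ρ R : ℝ} (hρ : 0 < ρ)
    (hρR : ρ ≤ R) (hR : R ^ 2 ≤ ρ ^ 2 * (1 + ε ^ 2 / r)) (hRδ : R ≤ δ)
    (hG : closedBall c R ⊆ G) :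
    Controls r p E G (extConst d r p) (closedBall c ρ) (closedBall c R) := by
  have hr0 : (1 : ℝ) ≤ r := by exact_mod_cast hr
  have hu0 : 0 ≤ ε * ρ / r := by positivity
  have hu1 : ε * ρ / r ≤ ε * ρ := div_le_self (by positivity) hr0
  refine controls_of_step hp hs.ncard_eq hs.one_le measurableSet_closedBall
    ((closedBall_subset_closedBall hρR).trans hG) hG (u := ε * ρ / r) ?_ fun x hx => ?_
  · rw [abs_of_nonneg hu0]
    nlinarith [hs.delta_le]
  · by_cases hxρ : ‖x - c‖ ≤ ρ
    · exact Or.inl (mem_closedBall_iff_norm.2 hxρ)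
    · refine Or.inr ?_
      rw [not_le] at hxρ
      rw [mem_closedBall_iff_norm] at hx
      obtain ⟨ξ, hξ, σ, hσ, h⟩ := hs.exists_inner (x - c)
      refine ⟨ξ, hξ, σ, hσ, fun j hj => ?_⟩
      have hj1 : ((j + 1 : ℕ) : ℝ) ≤ r := by exact_mod_cast hj
      have hj0 : (1 : ℝ) ≤ ((j + 1 : ℕ) : ℝ) := by simp
      have hv1 : ((j + 1 : ℕ) : ℝ) * (ε * ρ / r) ≤ ε * ρ := by
        rw [mul_div_assoc', div_le_iff₀ (by linarith)]
        nlinarith [mul_pos hε hρ]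
      have hv2 : ε * ρ / r ≤ ((j + 1 : ℕ) : ℝ) * (ε * ρ / r) := le_mul_of_one_le_left hu0 hj0
      have key := norm_add_smul_sq_le (hs.norm_eq ξ hξ) hσ h
        (v := ((j + 1 : ℕ) : ℝ) * (ε * ρ / r)) (by positivity)
        (hv1.trans (by nlinarith))
      rw [mem_closedBall_iff_norm]
      have e : x + ((j + 1 : ℕ) : ℝ) • (σ * (ε * ρ / r)) • ξ - c =
          x - c + (σ * (((j + 1 : ℕ) : ℝ) * (ε * ρ / r))) • ξ := by
        rw [smul_smul, mul_left_comm]; abel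
      rw [e]
      refine le_of_sq_le_sq (key.trans ?_) hρ.le
      have h1 : ε * ρ / r * (ε * ρ) ≤
          ((j + 1 : ℕ) : ℝ) * (ε * ρ / r) * (ε * ‖x - c‖) := by
        gcongr
      have h2 : ε * ρ / r * (ε * ρ) = ρ ^ 2 * (ε ^ 2 / r) := by ring
      have h3 : ‖x - c‖ ^ 2 ≤ R ^ 2 := pow_le_pow_left₀ (norm_nonneg _) hx 2
      nlinarith

/-- A ball controls every concentric ball in `G` of comparable radius. -/
theorem exists_controls_closedBall_concentric (d : ℕ) {r : ℕ} {p : ℝ≥0∞} (hp : p ≠ 0)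
    (hr : 1 ≤ r) {ε τ : ℝ} (hε : 0 < ε) (hε1 : ε ≤ 1) (hτ : 0 < τ) :
    ∃ A : ℝ≥0, ∀ (E G : Set (EuclideanSpace ℝ (Fin d))) (δ : ℝ), IsSetting ε δ E G →
      ∀ (c : EuclideanSpace ℝ (Fin d)) (ρ R : ℝ), 0 < R → τ * R ≤ ρ → R ≤ δ →
        closedBall c R ⊆ G → Controls r p E G A (closedBall c ρ) (closedBall c R) := by
  have hr0 : (1 : ℝ) ≤ r := by exact_mod_cast hr
  set κ : ℝ := √(1 + ε ^ 2 / r) with hκ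
  have hκ2 : κ ^ 2 = 1 + ε ^ 2 / r := Real.sq_sqrt (by positivity)
  have hκ1 : 1 < κ := by
    rw [hκ, Real.lt_sqrt zero_le_one]
    have : 0 < ε ^ 2 / r := by positivity
    linarith
  have main : ∀ n : ℕ, ∃ A : ℝ≥0, ∀ (E G : Set (EuclideanSpace ℝ (Fin d))) (δ : ℝ),
      IsSetting ε δ E G → ∀ (c : EuclideanSpace ℝ (Fin d)) (ρ R : ℝ), 0 < R → R ≤ κ ^ n * ρ →
        R ≤ δ → closedBall c R ⊆ G →
        Controls r p E G A (closedBall c ρ) (closedBall c R) := by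
    intro n
    induction n with
    | zero =>
      refine ⟨1, fun E G δ _ c ρ R _ h _ _ => Controls.of_subset
        (closedBall_subset_closedBall ?_)⟩
      simpa using h
    | succ n ih =>
      obtain ⟨A, hA⟩ := ih
      refine ⟨extConst d r p * (1 + A), fun E G δ hs c ρ R hR h hRδ hG => ?_⟩
      have hκ0 : 0 < κ := by linarith
      have hle : R / κ ≤ R := div_le_self hR.le hκ1.le
      refine (hA E G δ hs c ρ (R / κ) (by positivity) ?_ (hle.trans hRδ)
        ((closedBall_subset_closedBall hle).trans hG)).trans
        (controls_closedBall_of_sq_le hs hp hr hε hε1 (by positivity) hle ?_ hRδ hG)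
      · rw [div_le_iff₀ hκ0]
        calc R ≤ κ ^ (n + 1) * ρ := h
          _ = _ := by ring
      · rw [← hκ2, div_pow, div_mul_cancel₀ _ (by positivity)]
  obtain ⟨n, hn⟩ := pow_unbounded_of_one_lt τ⁻¹ hκ1
  obtain ⟨A, hA⟩ := main n
  refine ⟨A, fun E G δ hs c ρ R hR h hRδ hG => hA E G δ hs c ρ R hR ?_ hRδ hG⟩
  have h1 : 1 ≤ κ ^ n * τ := by
    rw [← inv_mul_cancel₀ hτ.ne']
    exact mul_le_mul_of_nonneg_right hn.le hτ.le
  calc R = 1 * R := (one_mul R).symm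
    _ ≤ κ ^ n * τ * R := mul_le_mul_of_nonneg_right h1 hR.le
    _ = κ ^ n * (τ * R) := mul_assoc _ _ _
    _ ≤ κ ^ n * ρ := by gcongr

/-- Two balls of the same radius `τ δ` inside a ball of radius `δ` contained in `G` control each
other. -/
theorem exists_controls_closedBall_move (d : ℕ) {r : ℕ} {p : ℝ≥0∞} (hp : p ≠ 0)
    (hr : 1 ≤ r) {ε τ : ℝ} (hε : 0 < ε) (hε1 : ε ≤ 1) (hτ : 0 < τ) (hτ1 : τ ≤ 1) :
    ∃ A : ℝ≥0, ∀ (E G : Set (EuclideanSpace ℝ (Fin d))) (δ : ℝ), IsSetting ε δ E G →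
      ∀ a b c : EuclideanSpace ℝ (Fin d), closedBall c δ ⊆ G → dist a c ≤ (1 - τ) * δ →
        dist b c ≤ (1 - τ) * δ →
        Controls r p E G A (closedBall a (τ * δ)) (closedBall b (τ * δ)) := by
  obtain ⟨B, hB⟩ := exists_controls_closedBall_concentric d hp hr hε hε1
    (τ := 1 / 2) (by norm_num)
  obtain ⟨n, hn⟩ := exists_nat_gt (4 / τ)
  have hn0 : (0 : ℝ) < n := lt_trans (by positivity) hn
  have main : ∀ k : ℕ, ∃ A : ℝ≥0, ∀ (E G : Set (EuclideanSpace ℝ (Fin d))) (δ : ℝ),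
      IsSetting ε δ E G → ∀ a b c : EuclideanSpace ℝ (Fin d), closedBall c δ ⊆ G →
        dist a c ≤ (1 - τ) * δ → dist b c ≤ (1 - τ) * δ → dist a b ≤ k * (τ * δ / 2) →
        Controls r p E G A (closedBall a (τ * δ)) (closedBall b (τ * δ)) := by
    intro k
    induction k with
    | zero =>
      refine ⟨1, fun E G δ _ a b c _ _ _ h => Controls.of_subset ?_⟩
      have : a = b := dist_le_zero.1 (by simpa using h)
      rw [this]
    | succ k ih =>
      obtain ⟨A, hA⟩ := ih
      refine ⟨B * (1 + A), fun E G δ hs a b c hc ha hb h => ?_⟩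
      have hδ := hs.delta_pos
      -- the intermediate centre divides the segment from `a` to `b` in the ratio `k : 1`
      set t : ℝ := 1 / (k + 1) with ht
      have ht0 : 0 ≤ t := by positivity
      have ht1 : t ≤ 1 := by
        rw [ht, div_le_one (by positivity)]
        linarith [(Nat.cast_nonneg k : (0 : ℝ) ≤ k)]
      set b' := AffineMap.lineMap b a t with hb'
      have hb'c : dist b' c ≤ (1 - τ) * δ := by
        have := (convex_closedBall c ((1 - τ) * δ)).lineMap_mem (mem_closedBall.2 hb)
          (mem_closedBall.2 ha) ⟨ht0, ht1⟩
        exact mem_closedBall.1 this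
      have hk : (k : ℝ) + 1 ≠ 0 := by positivity
      have hb'b : dist b' b ≤ τ * δ / 2 := by
        rw [hb', dist_lineMap_left, Real.norm_of_nonneg ht0, ht, dist_comm, one_div,
          inv_mul_le_iff₀ (by positivity)]
        exact_mod_cast h
      have hab' : dist a b' ≤ k * (τ * δ / 2) := by
        rw [hb', dist_comm, dist_lineMap_right, Real.norm_of_nonneg (by linarith), dist_comm]
        have : 1 - t = t * k := by rw [ht]; field_simp; ring
        rw [this]
        calc t * k * dist a b ≤ t * k * ((k + 1 : ℕ) * (τ * δ / 2)) := by gcongr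
          _ = (t * (k + 1)) * (k * (τ * δ / 2)) := by push_cast; ring
          _ = _ := by rw [ht, one_div, inv_mul_cancel₀ hk, one_mul]
      have hsub : closedBall b (τ * δ) ⊆ G := by
        refine Set.Subset.trans (closedBall_subset_closedBall' ?_) hc
        linarith
      have hstep : Controls r p E G B (closedBall b' (τ * δ)) (closedBall b (τ * δ)) := by
        refine (hB E G δ hs b (τ * δ / 2) (τ * δ) (by positivity) (by linarith) (by nlinarith)
          hsub).mono_left (closedBall_subset_closedBall' ?_)
        rw [dist_comm]; linarith
      exact (hA E G δ hs a b' c hc ha hb'c hab').trans hstep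
  obtain ⟨A, hA⟩ := main n
  refine ⟨A, fun E G δ hs a b c hc ha hb => hA E G δ hs a b c hc ha hb ?_⟩
  have hδ := hs.delta_pos
  have h1 : dist a b ≤ 2 * δ := by
    have := dist_triangle_right a b c
    nlinarith
  have h2 : 4 ≤ n * τ := by
    rw [div_lt_iff₀ hτ] at hn
    exact hn.le
  nlinarith

/-- The relative distance between two balls across which a bound can still be propagated: small
enough for `4 η a² ≤ (u / 2) (ε a)` with the step `u = ε a / (2 r)`. -/
def gap (r : ℕ) (ε : ℝ) : ℝ := ε ^ 2 / (16 * r)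

theorem gap_pos (hr : 1 ≤ r) (hε : 0 < ε) : 0 < gap r ε := by
  have : (1 : ℝ) ≤ r := by exact_mod_cast hr
  unfold gap
  positivity

theorem gap_le (hr : 1 ≤ r) (hε : 0 < ε) (hε1 : ε ≤ 1) : gap r ε ≤ 1 / 16 := by
  have h1 : (1 : ℝ) ≤ r := by exact_mod_cast hr
  unfold gap
  rw [div_le_div_iff₀ (by positivity) (by norm_num)]
  nlinarith

/-- A ball of radius `δ` controls every other such ball that meets it, and even one at a small
distance from it: a line in a direction transversal to the segment between the centres passes from
one ball to the other near the midpoint. -/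
theorem exists_controls_closedBall_cross (d : ℕ) {r : ℕ} {p : ℝ≥0∞} (hp : p ≠ 0)
    (hr : 1 ≤ r) {ε : ℝ} (hε : 0 < ε) (hε1 : ε ≤ 1) :
    ∃ A : ℝ≥0, ∀ (E G : Set (EuclideanSpace ℝ (Fin d))) (δ : ℝ), IsSetting ε δ E G →
      ∀ c₁ c₂ : EuclideanSpace ℝ (Fin d), closedBall c₁ δ ⊆ G → closedBall c₂ δ ⊆ G →
        dist c₁ c₂ ≤ 2 * (1 + gap r ε) * δ →
        Controls r p E G A (closedBall c₁ δ) (closedBall c₂ δ) := by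
  have hr0 : (1 : ℝ) ≤ r := by exact_mod_cast hr
  set η := gap r ε with hη
  have hη0 : 0 < η := gap_pos hr hε
  have hη1 : η ≤ 1 / 16 := gap_le hr hε hε1
  obtain ⟨A₁, h₁⟩ := exists_controls_closedBall_move d hp hr hε hε1 hη0 (by linarith)
  obtain ⟨A₂, h₂⟩ := exists_controls_closedBall_concentric d hp hr hε hε1 hη0
  refine ⟨A₂ * (1 + A₁ * (1 + extConst d r p)), fun E G δ hs c₁ c₂ hc₁ hc₂ hd => ?_⟩
  have hδ := hs.delta_pos
  set y : EuclideanSpace ℝ (Fin d) := (1 / 2 : ℝ) • (c₂ - c₁) with hy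
  set a : ℝ := ‖y‖ with ha
  have ha0 : 0 ≤ a := norm_nonneg y
  have haδ : a ≤ (1 + η) * δ := by
    rw [ha, hy, norm_smul, ← dist_eq_norm, dist_comm]
    norm_num
    linarith
  obtain ⟨ξ, hξ, σ, hσ, hσξ⟩ := hs.exists_inner y
  have hξ1 := hs.norm_eq ξ hξ
  set u : ℝ := ε * a / (2 * r) with hu
  have hu0 : 0 ≤ u := by positivity
  have hur : r * u = ε * a / 2 := by rw [hu]; field_simp
  have huε : 4 * η * a ^ 2 = u / 2 * (ε * a) := by
    rw [hη, gap, hu]; field_simp; ring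
  have hua : u ≤ a / 2 := by
    have : u ≤ r * u := le_mul_of_one_le_left hu0 hr0
    nlinarith
  have hεa : 0 ≤ ε * a := by positivity
  have hηδ : (1 - 2 * η) * ((1 + η) * δ) ≤ (1 - η) * δ := by nlinarith [mul_pos hη0 hδ]
  have hshrink : (1 - 2 * η) * a ≤ (1 - η) * δ :=
    (mul_le_mul_of_nonneg_left haδ (by linarith)).trans hηδ
  -- the auxiliary centre near the midpoint of the two centres
  set b : EuclideanSpace ℝ (Fin d) := c₁ + y - (σ * (u / 2)) • ξ with hb
  have hc₂y : c₂ = c₁ + y + y := by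
    rw [hy, add_assoc, ← add_smul]; norm_num
  have hbc₂ : dist b c₂ ≤ (1 - η) * δ := by
    rw [dist_comm, dist_eq_norm]
    have e : c₂ - b = y + (σ * (u / 2)) • ξ := by rw [hb, hc₂y]; abel
    rw [e]
    refine (norm_add_smul_le hξ1 hσ hσξ (by positivity) ?_ le_rfl (κ := 2 * η) (by linarith)
      ?_).trans hshrink
    · have : u ≤ r * u := le_mul_of_one_le_left hu0 hr0
      rw [← ha]; linarith
    · rw [← ha]; linarith
  have hsub : closedBall b (η * δ) ⊆ G :=
    (closedBall_subset_closedBall' (by linarith)).trans hc₂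
  have hstep : Controls r p E G (extConst d r p) (closedBall c₁ δ) (closedBall b (η * δ)) := by
    refine controls_of_step hp hs.ncard_eq hs.one_le measurableSet_closedBall hc₁ hsub
      (u := u) ?_ fun x hx => Or.inr ⟨ξ, hξ, σ, hσ, fun j hj => ?_⟩
    · rw [abs_of_nonneg hu0]
      nlinarith [hs.delta_le]
    · rw [mem_closedBall_iff_norm] at hx ⊢
      have hj1 : ((j : ℝ) + 1) ≤ r := by exact_mod_cast hj
      have hj0 : (0 : ℝ) ≤ j := Nat.cast_nonneg j
      have e : x + ((j + 1 : ℕ) : ℝ) • (σ * u) • ξ - c₁ =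
          (x - b) + (y + (σ * ((j + 1 / 2) * u)) • ξ) := by
        rw [hb, smul_smul]
        push_cast
        module
      have h3 := norm_add_smul_le hξ1 hσ hσξ (v := (j + 1 / 2) * u) (by positivity)
        (by rw [← ha]; nlinarith) le_rfl (κ := 2 * η) (by linarith) (by
          have h4 : u / 2 * (ε * a) ≤ (j + 1 / 2) * u * (ε * a) :=
            mul_le_mul_of_nonneg_right (by nlinarith) hεa
          rw [← ha]; linarith)
      rw [e]
      refine (norm_add_le _ _).trans ?_
      linarith
  refine ((hstep.trans (h₁ E G δ hs b c₂ c₂ hc₂ hbc₂ ?_))).trans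
    (h₂ E G δ hs c₂ (η * δ) δ hδ le_rfl le_rfl hc₂)
  rw [dist_self]
  nlinarith

end Balls

/-! ### Propagation to a connected union of balls -/

section Net

variable {d : ℕ}

/-- A bounded set has a net whose cardinality depends only on the relative fineness. -/
theorem exists_net (d : ℕ) (L : ℝ) {η : ℝ} (hη : 0 < η) :
    ∃ N : ℕ, ∀ (δ : ℝ) (c₀ : EuclideanSpace ℝ (Fin d)) (D : Set (EuclideanSpace ℝ (Fin d))),
      0 < δ → D ⊆ closedBall c₀ (L * δ) →
      ∃ S : Finset (EuclideanSpace ℝ (Fin d)), ↑S ⊆ D ∧ S.card ≤ N ∧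
        ∀ c ∈ D, ∃ s ∈ S, dist c s ≤ η * δ := by
  classical
  obtain ⟨T, hT, hcov⟩ := (totallyBounded_iff.1
    (isCompact_closedBall (0 : EuclideanSpace ℝ (Fin d)) L).totallyBounded) (η / 2) (by positivity)
  refine ⟨hT.toFinset.card, fun δ c₀ D hδ hD => ?_⟩
  -- one point of `D` is chosen in each cell that meets `D`
  let cell : EuclideanSpace ℝ (Fin d) → Set (EuclideanSpace ℝ (Fin d)) := fun t =>
    {c ∈ D | dist (δ⁻¹ • (c - c₀)) t < η / 2}
  let pick : EuclideanSpace ℝ (Fin d) → EuclideanSpace ℝ (Fin d) := fun t =>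
    if h : (cell t).Nonempty then h.some else 0
  have hpick : ∀ t, (cell t).Nonempty → pick t ∈ cell t := fun t h => by
    simp only [pick, dif_pos h]; exact h.some_mem
  refine ⟨(hT.toFinset.filter fun t => (cell t).Nonempty).image pick, ?_,
    Finset.card_image_le.trans (Finset.card_filter_le _ _), fun c hc => ?_⟩
  · intro s hs
    obtain ⟨t, ht, rfl⟩ := Finset.mem_image.1 (Finset.mem_coe.1 hs)
    exact (hpick t (Finset.mem_filter.1 ht).2).1
  · have hmem : δ⁻¹ • (c - c₀) ∈ closedBall (0 : EuclideanSpace ℝ (Fin d)) L := by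
      have := mem_closedBall_iff_norm.1 (hD hc)
      rw [mem_closedBall_zero_iff, norm_smul, norm_inv, Real.norm_of_nonneg hδ.le,
        inv_mul_le_iff₀ hδ, mul_comm]
      exact this
    obtain ⟨t, ht, htc⟩ := Set.mem_iUnion₂.1 (hcov hmem)
    have hne : (cell t).Nonempty := ⟨c, hc, htc⟩
    refine ⟨pick t, Finset.mem_image_of_mem _
      (Finset.mem_filter.2 ⟨hT.mem_toFinset.2 ht, hne⟩), ?_⟩
    have h1 : dist (δ⁻¹ • (c - c₀)) (δ⁻¹ • (pick t - c₀)) < η := by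
      have := dist_triangle_right (δ⁻¹ • (c - c₀)) (δ⁻¹ • (pick t - c₀)) t
      have h2 := (hpick t hne).2
      rw [mem_ball] at htc
      linarith
    rw [dist_smul₀, dist_sub_right, norm_inv, Real.norm_of_nonneg hδ.le,
      inv_mul_lt_iff₀ hδ, mul_comm] at h1
    exact h1.le

variable {E G : Set (EuclideanSpace ℝ (Fin d))}

/-- In a connected union of balls of radius `δ`, every proper nonempty part of a fine net of
centres is close to its complement. -/
theorem exists_dist_le_of_isPreconnected {δ η : ℝ} (hη : 0 ≤ η) (hδ : 0 < δ)
    (hconn : IsPreconnected G)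
    (hball : ∀ x ∈ G, ∃ c, x ∈ closedBall c δ ∧ closedBall c δ ⊆ G)
    {S T : Finset (EuclideanSpace ℝ (Fin d))} (hSG : ↑S ⊆ {c | closedBall c δ ⊆ G})
    (hnet : ∀ c, closedBall c δ ⊆ G → ∃ s ∈ S, dist c s ≤ η * δ) (hTS : T ⊆ S)
    (hT : T.Nonempty) (hne : T ≠ S) :
    ∃ c ∈ T, ∃ c' ∈ S, c' ∉ T ∧ dist c c' ≤ 2 * (1 + η) * δ := by
  classical
  let H : Finset (EuclideanSpace ℝ (Fin d)) → Set (EuclideanSpace ℝ (Fin d)) := fun T =>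
    ⋃ c ∈ T, closedBall c ((1 + η) * δ)
  have hclosed : ∀ T, IsClosed (H T) := fun T =>
    T.finite_toSet.isClosed_biUnion fun c _ => isClosed_closedBall
  have hcov : G ⊆ H T ∪ H (S \ T) := by
    intro x hx
    obtain ⟨c, hxc, hc⟩ := hball x hx
    obtain ⟨s, hs, hcs⟩ := hnet c hc
    have hxs : x ∈ closedBall s ((1 + η) * δ) := by
      rw [mem_closedBall] at hxc ⊢
      linarith [dist_triangle x c s]
    by_cases hsT : s ∈ T
    · exact Or.inl (Set.mem_biUnion hsT hxs)
    · exact Or.inr (Set.mem_biUnion (Finset.mem_sdiff.2 ⟨hs, hsT⟩) hxs)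
  have hnonempty : ∀ T' ⊆ S, T'.Nonempty → (G ∩ H T').Nonempty := by
    rintro T' hT' ⟨c, hc⟩
    refine ⟨c, hSG (hT' hc) (mem_closedBall_self hδ.le), Set.mem_biUnion hc ?_⟩
    exact mem_closedBall_self (by positivity)
  obtain ⟨x, -, hx1, hx2⟩ := isPreconnected_closed_iff.1 hconn _ _ (hclosed T) (hclosed (S \ T))
    hcov (hnonempty T hTS hT) (hnonempty _ Finset.sdiff_subset
      (Finset.sdiff_nonempty.2 fun h => hne (hTS.antisymm h)))
  obtain ⟨c, hc, hxc⟩ := Set.mem_iUnion₂.1 hx1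
  obtain ⟨c', hc', hxc'⟩ := Set.mem_iUnion₂.1 hx2
  refine ⟨c, hc, c', (Finset.mem_sdiff.1 hc').1, (Finset.mem_sdiff.1 hc').2, ?_⟩
  rw [mem_closedBall] at hxc hxc'
  linarith [dist_triangle_left c c' x]

/-- In a connected union `G` of balls of radius `δ` of diameter at most `L δ`, each of these balls
controls all of `G`, with a constant independent of `G`. -/
theorem exists_controls_of_isConnected (d : ℕ) {r : ℕ} {p : ℝ≥0∞} (hp : p ≠ 0)
    (hr : 1 ≤ r) {ε : ℝ} (hε : 0 < ε) (hε1 : ε ≤ 1) (L : ℝ) :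
    ∃ A : ℝ≥0, ∀ (E G : Set (EuclideanSpace ℝ (Fin d))) (δ : ℝ), IsSetting ε δ E G →
      IsPreconnected G → Bornology.IsBounded G → diam G ≤ L * δ →
      (∀ x ∈ G, ∃ c, x ∈ closedBall c δ ∧ closedBall c δ ⊆ G) →
      ∀ c₀ : EuclideanSpace ℝ (Fin d), closedBall c₀ δ ⊆ G →
        Controls r p E G A (closedBall c₀ δ) G := by
  classical
  have hr0 : (1 : ℝ) ≤ r := by exact_mod_cast hr
  set η := gap r ε with hη
  have hη0 : 0 < η := gap_pos hr hε
  have hη1 : η ≤ 1 / 16 := gap_le hr hε hε1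
  obtain ⟨N, hN⟩ := exists_net d L hη0
  obtain ⟨B, hB⟩ := exists_controls_closedBall_cross d hp hr hε hε1
  have main : ∀ k : ℕ, ∃ A : ℝ≥0, ∀ (E G : Set (EuclideanSpace ℝ (Fin d))) (δ : ℝ),
      IsSetting ε δ E G → IsPreconnected G →
      (∀ x ∈ G, ∃ c, x ∈ closedBall c δ ∧ closedBall c δ ⊆ G) →
      ∀ (c₀ : EuclideanSpace ℝ (Fin d)) (S : Finset (EuclideanSpace ℝ (Fin d))), c₀ ∈ S →
        ↑S ⊆ {c | closedBall c δ ⊆ G} →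
        (∀ c, closedBall c δ ⊆ G → ∃ s ∈ S, dist c s ≤ η * δ) →
        ∃ T ⊆ S, c₀ ∈ T ∧ (k < T.card ∨ T = S) ∧
          Controls r p E G A (closedBall c₀ δ) (⋃ c ∈ T, closedBall c δ) := by
    intro k
    induction k with
    | zero =>
      refine ⟨1, fun E G δ _ _ _ c₀ S hc₀ _ _ => ⟨{c₀}, by simpa using hc₀, by simp, by simp,
        Controls.of_subset (by simp)⟩⟩
    | succ k ih =>
      obtain ⟨A, hA⟩ := ih
      refine ⟨max A (addConst p * (B * (1 + A) + A)),
        fun E G δ hs hconn hball c₀ S hc₀ hSG hnet => ?_⟩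
      obtain ⟨T, hTS, hcT, hT, hAT⟩ := hA E G δ hs hconn hball c₀ S hc₀ hSG hnet
      by_cases hne : T = S
      · exact ⟨T, hTS, hcT, Or.inr hne, hAT.mono_const (le_max_left _ _)⟩
      · obtain ⟨c, hc, c', hc', hc'T, hcc'⟩ := exists_dist_le_of_isPreconnected hη0.le
          hs.delta_pos hconn hball hSG hnet hTS ⟨c₀, hcT⟩ hne
        refine ⟨insert c' T, Finset.insert_subset hc' hTS, Finset.mem_insert_of_mem hcT,
          Or.inl ?_, ?_⟩
        · rw [Finset.card_insert_of_notMem hc'T]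
          have := hT.resolve_right hne
          omega
        · rw [Finset.set_biUnion_insert]
          refine Controls.mono_const ?_ (le_max_right _ _)
          refine Controls.union hp (hAT.trans ?_) hAT
          exact (hB E G δ hs c c' (hSG (hTS hc)) (hSG hc') hcc').mono_left
            (Set.subset_biUnion_of_mem (u := fun c => closedBall c δ) (Finset.mem_coe.2 hc))
  obtain ⟨A, hA⟩ := main (N + 1)
  refine ⟨extConst d r p * (1 + A), fun E G δ hs hconn hbdd hdiam hball c₀ hc₀ => ?_⟩
  have hδ := hs.delta_pos
  have hself : ∀ c : EuclideanSpace ℝ (Fin d), c ∈ closedBall c δ := fun c =>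
    mem_closedBall_self hδ.le
  obtain ⟨S, hSD, hScard, hSnet⟩ := hN δ c₀ {c | closedBall c δ ⊆ G} hδ fun c hc =>
    mem_closedBall.2 ((dist_le_diam_of_mem hbdd (hc (hself c)) (hc₀ (hself c₀))).trans hdiam)
  have hSG : ↑(insert c₀ S) ⊆ {c | closedBall c δ ⊆ G} := by
    rw [Finset.coe_insert]
    exact Set.insert_subset hc₀ hSD
  have hnet : ∀ c, closedBall c δ ⊆ G → ∃ s ∈ insert c₀ S, dist c s ≤ η * δ := fun c hc => by
    obtain ⟨s, hs, h⟩ := hSnet c hc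
    exact ⟨s, Finset.mem_insert_of_mem hs, h⟩
  obtain ⟨T, hTS, -, hT, hAT⟩ := hA E G δ hs hconn hball c₀ (insert c₀ S)
    (Finset.mem_insert_self _ _) hSG hnet
  have hTeq : T = insert c₀ S := by
    refine hT.resolve_left fun h => ?_
    have h1 := Finset.card_le_card hTS
    have h2 := Finset.card_insert_le c₀ S
    omega
  refine hAT.trans ?_
  have hmeas : MeasurableSet (⋃ c ∈ T, closedBall c δ) :=
    Finset.measurableSet_biUnion _ fun c _ => measurableSet_closedBall
  have hsub : (⋃ c ∈ T, closedBall c δ) ⊆ G :=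
    Set.iUnion₂_subset fun c hc => hSG (hTS hc)
  have hu0 : 0 ≤ ε * δ / (2 * r) := by positivity
  have hur : r * (ε * δ / (2 * r)) = ε * δ / 2 := by field_simp
  refine controls_of_step hp hs.ncard_eq hs.one_le hmeas hsub subset_rfl
    (u := ε * δ / (2 * r)) ?_ fun x hx => ?_
  · rw [abs_of_nonneg hu0]
    have : ε * δ / (2 * r) ≤ r * (ε * δ / (2 * r)) := le_mul_of_one_le_left hu0 hr0
    nlinarith [hs.delta_le]
  · by_cases hxT : x ∈ ⋃ c ∈ T, closedBall c δ
    · exact Or.inl hxT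
    · refine Or.inr ?_
      obtain ⟨c, hxc, hc⟩ := hball x hx
      obtain ⟨s, hsS, hcs⟩ := hnet c hc
      obtain ⟨ξ, hξ, σ, hσ, h⟩ := hs.exists_inner (x - c)
      refine ⟨ξ, hξ, σ, hσ, fun j hj => Set.mem_biUnion (hTeq ▸ hsS : s ∈ T) ?_⟩
      have hxs : δ < dist x s := by
        by_contra! hle
        exact hxT (Set.mem_biUnion (hTeq ▸ hsS : s ∈ T) (mem_closedBall.2 hle))
      rw [mem_closedBall, dist_eq_norm] at hxc
      -- `x` lies near the boundary of the ball around `c`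
      have hxc' : δ / 2 ≤ ‖x - c‖ := by
        rw [← dist_eq_norm]
        have := dist_triangle x c s
        nlinarith
      have hj1 : ((j + 1 : ℕ) : ℝ) ≤ r := by exact_mod_cast hj
      have hj0 : (1 : ℝ) ≤ ((j + 1 : ℕ) : ℝ) := by simp
      have hv : ε * δ / (2 * r) ≤ ((j + 1 : ℕ) : ℝ) * (ε * δ / (2 * r)) :=
        le_mul_of_one_le_left hu0 hj0
      have h3 := norm_add_smul_le (hs.norm_eq ξ hξ) hσ h
        (v := ((j + 1 : ℕ) : ℝ) * (ε * δ / (2 * r))) (by positivity)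
        (by
          calc _ ≤ r * (ε * δ / (2 * r)) := by gcongr
            _ = ε * (δ / 2) := by rw [hur]; ring
            _ ≤ _ := by gcongr)
        hxc (κ := 2 * η) (by linarith)
        (by
          calc 2 * (2 * η) * δ ^ 2 = ε * δ / (2 * r) * (ε * (δ / 2)) := by
                rw [hη, gap]; field_simp; ring
            _ ≤ _ := by gcongr)
      have e : x + ((j + 1 : ℕ) : ℝ) • (σ * (ε * δ / (2 * r))) • ξ - c =
          x - c + (σ * (((j + 1 : ℕ) : ℝ) * (ε * δ / (2 * r)))) • ξ := by
        rw [smul_smul, mul_left_comm]; abel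
      rw [← e, ← dist_eq_norm] at h3
      rw [mem_closedBall]
      refine (dist_triangle _ c s).trans ?_
      nlinarith [mul_pos hη0 hδ]

end Net

/-! ### Compact `C²` domains have inner balls of a fixed radius -/

section C2

variable {d : ℕ}

/-- Near a boundary point, every point `x` of the domain (not only boundary points) lies on the
sphere of radius `δ` around `x - δ ∇φ(x) / ‖∇φ(x)‖`, and the quadratic error in Taylor's formula for
`φ` is too small to push this ball out of the domain. -/
theorem IsC2Domain.exists_innerBall_frontier {G : Set (EuclideanSpace ℝ (Fin d))}
    (hG : IsC2Domain G) {x₀ : EuclideanSpace ℝ (Fin d)} (hx₀ : x₀ ∈ frontier G) :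
    ∃ ρ > 0, ∃ δ₀ > 0, ∀ δ, 0 < δ → δ ≤ δ₀ → ∀ x ∈ G, x ∈ ball x₀ ρ →
      ∃ c, x ∈ closedBall c δ ∧ closedBall c δ ⊆ G := by
  obtain ⟨U, hU, hxU, φ, hφ, hφ', hGU⟩ := hG.2 x₀ hx₀
  have hUn : U ∈ nhds x₀ := hU.mem_nhds hxU
  have hc1 : ContDiffAt ℝ 1 (fderiv ℝ φ) x₀ :=
    (hφ.contDiffAt hUn).fderiv_right (by norm_num)
  obtain ⟨K, s, hs, hLip⟩ := hc1.exists_lipschitzOnWith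
  set m : ℝ := ‖fderiv ℝ φ x₀‖ / 2 with hm
  have hm0 : 0 < m := half_pos (norm_pos_iff.2 hφ')
  have hlarge : ∀ᶠ x in nhds x₀, m < ‖fderiv ℝ φ x‖ :=
    hc1.continuousAt.norm.eventually_const_lt (half_lt_self (norm_pos_iff.2 hφ'))
  obtain ⟨R, hR, hRsub⟩ := Metric.mem_nhds_iff.1
    (Filter.inter_mem (Filter.inter_mem hUn hs) hlarge)
  refine ⟨R / 2, by positivity, min (R / 8) (m / (2 * (K + 1))), by positivity,
    fun δ hδ hδ0 x hx hxR => ?_⟩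
  have hδR : δ ≤ R / 8 := hδ0.trans (min_le_left _ _)
  have hδm : 2 * (K + 1) * δ ≤ m := by
    have := hδ0.trans (min_le_right _ _)
    rwa [le_div_iff₀ (by positivity), mul_comm] at this
  have hxR' : x ∈ ball x₀ R := ball_subset_ball (by linarith) hxR
  set g := (InnerProductSpace.toDual ℝ (EuclideanSpace ℝ (Fin d))).symm (fderiv ℝ φ x) with hg
  have hginner : ∀ v, inner ℝ g v = fderiv ℝ φ x v := fun v =>
    InnerProductSpace.toDual_symm_apply
  have hgm : m < ‖g‖ := by
    rw [hg, LinearIsometryEquiv.norm_map]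
    exact (hRsub hxR').2
  have hg0 : 0 < ‖g‖ := hm0.trans hgm
  refine ⟨x - (δ / ‖g‖) • g, ?_, fun y hy => ?_⟩
  · have e : x - (x - (δ / ‖g‖) • g) = (δ / ‖g‖) • g := by abel
    rw [mem_closedBall, dist_eq_norm, e, norm_smul, norm_div, norm_norm,
      div_mul_cancel₀ _ hg0.ne', Real.norm_of_nonneg hδ.le]
  · rw [mem_closedBall, dist_eq_norm] at hy
    have hnorm : ‖(δ / ‖g‖) • g‖ = δ := by
      rw [norm_smul, norm_div, norm_norm, div_mul_cancel₀ _ hg0.ne', Real.norm_of_nonneg hδ.le]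
    have e : y - (x - (δ / ‖g‖) • g) = (y - x) + (δ / ‖g‖) • g := by abel
    rw [e] at hy
    have hyx : ‖y - x‖ ≤ 2 * δ := by
      have := norm_sub_le ((y - x) + (δ / ‖g‖) • g) ((δ / ‖g‖) • g)
      rw [add_sub_cancel_right, hnorm] at this
      linarith
    have hyR : y ∈ ball x₀ R := by
      rw [mem_ball] at hxR ⊢
      have := dist_triangle y x x₀
      rw [dist_eq_norm y x] at this
      linarith
    have hinner : inner ℝ g (y - x) * (2 * δ) ≤ -(‖g‖ * ‖y - x‖ ^ 2) := by
      have h1 := pow_le_pow_left₀ (norm_nonneg _) hy 2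
      rw [norm_add_sq_real, hnorm, inner_smul_right, real_inner_comm] at h1
      have h2 : ‖g‖ * (2 * (δ / ‖g‖ * inner ℝ g (y - x))) =
          inner ℝ g (y - x) * (2 * δ) := by field_simp
      nlinarith
    -- Taylor's formula on the convex set of points at most as far from `x` as `y`
    have htaylor : ‖φ y - φ x - fderiv ℝ φ x (y - x)‖ ≤ K * ‖y - x‖ * ‖y - x‖ := by
      refine Convex.norm_image_sub_le_of_norm_hasFDerivWithin_le' (f' := fderiv ℝ φ)
        (s := ball x₀ R ∩ closedBall x ‖y - x‖) (fun z hz => ?_) (fun z hz => ?_)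
        ((convex_ball _ _).inter (convex_closedBall _ _)) ⟨hxR', by simp⟩
        ⟨hyR, by rw [mem_closedBall, dist_eq_norm]⟩
      · exact ((hφ.contDiffAt (hU.mem_nhds (hRsub hz.1).1.1)).differentiableAt
          (by norm_num)).hasFDerivAt.hasFDerivWithinAt
      · refine (hLip.norm_sub_le (hRsub hz.1).1.2 (hRsub hxR').1.2).trans ?_
        have := hz.2
        rw [mem_closedBall, dist_eq_norm] at this
        gcongr
    have hφx : φ x ≤ 0 := (hGU x (hRsub hxR').1.1).1 hx
    refine (hGU y (hRsub hyR).1.1).2 ?_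
    have h1 := le_of_abs_le htaylor
    rw [← hginner] at h1
    have h2 : (0 : ℝ) ≤ ‖y - x‖ ^ 2 := by positivity
    have h3 : φ y * (2 * δ) ≤ 0 := by
      have h4 : φ y ≤ inner ℝ g (y - x) + K * ‖y - x‖ ^ 2 := by nlinarith
      have h5 : 2 * δ * K ≤ ‖g‖ := by nlinarith
      nlinarith
    nlinarith

theorem IsC2Domain.exists_innerBall_local {G : Set (EuclideanSpace ℝ (Fin d))}
    (hG : IsC2Domain G) {x₀ : EuclideanSpace ℝ (Fin d)} (hx₀ : x₀ ∈ G) :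
    ∃ ρ > 0, ∃ δ₀ > 0, ∀ δ, 0 < δ → δ ≤ δ₀ → ∀ x ∈ G, x ∈ ball x₀ ρ →
      ∃ c, x ∈ closedBall c δ ∧ closedBall c δ ⊆ G := by
  by_cases h : x₀ ∈ frontier G
  · exact hG.exists_innerBall_frontier h
  · have hint : x₀ ∈ interior G := by
      by_contra hni
      exact h ⟨subset_closure hx₀, hni⟩
    obtain ⟨R, hR, hsub⟩ := Metric.mem_nhds_iff.1 (mem_interior_iff_mem_nhds.1 hint)
    refine ⟨R / 2, by positivity, R / 4, by positivity, fun δ hδ hδR x _ hx =>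
      ⟨x, mem_closedBall_self hδ.le, fun y hy => hsub ?_⟩⟩
    rw [mem_ball] at hx ⊢
    rw [mem_closedBall] at hy
    linarith [dist_triangle y x x₀]

theorem IsC2Domain.isLip2Domain {G : Set (EuclideanSpace ℝ (Fin d))} (hG : IsC2Domain G) :
    ∃ L : ℝ, IsLip2Domain L G := by
  choose! ρ hρ δ₀ hδ₀ h using fun x hx => hG.exists_innerBall_local (x₀ := x) hx
  obtain ⟨T, hcov⟩ := hG.1.elim_nhds_subcover' (fun x _ => ball x (ρ x))
    (fun x hx => ball_mem_nhds x (hρ x hx))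
  obtain ⟨δ, hδ, hδle⟩ : ∃ δ > 0, ∀ t ∈ T, δ ≤ δ₀ t := by
    rcases T.eq_empty_or_nonempty with rfl | hne
    · exact ⟨1, one_pos, by simp⟩
    · obtain ⟨t, ht, hmin⟩ := T.exists_min_image (fun t => δ₀ t) hne
      exact ⟨δ₀ t, hδ₀ t t.2, hmin⟩
  refine ⟨max 2 (diam G / δ), lt_max_of_lt_left one_lt_two, hG.1, δ, hδ, ?_, fun x hx => ?_⟩
  · rw [← div_le_iff₀ hδ]
    exact le_max_right _ _
  · obtain ⟨t, ht, hxt⟩ := Set.mem_iUnion₂.1 (hcov hx)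
    exact h t t.2 δ hδ (hδle t ht) x hx hxt

end C2

/-! ### Continuous functions with vanishing differences are polynomials -/

section Frechet

/-- On a uniform grid, a function with vanishing `r`-th differences is a polynomial. -/
theorem exists_polynomial_on_grid {r N : ℕ} {v : ℝ} (hv : v ≠ 0) {F : ℝ → ℝ}
    (h : ∀ k : ℕ, k + r ≤ N → fdiff r v F (k * v) = 0) :
    ∃ P ∈ Polynomial.degreeLT ℝ r, ∀ k ≤ N, F (k * v) = P.eval ((k : ℝ) * v) := by
  have hinj : Set.InjOn (fun k : ℕ => (k : ℝ) * v) (Finset.range r) := fun a _ b _ hab => by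
    exact_mod_cast mul_right_cancel₀ hv hab
  set P := Lagrange.interpolate (Finset.range r) (fun k : ℕ => (k : ℝ) * v)
    (fun k => F (k * v)) with hP
  have hdeg : P.degree < r :=
    (Lagrange.degree_interpolate_lt _ hinj).trans_eq (by rw [Finset.card_range])
  refine ⟨P, Polynomial.mem_degreeLT.2 hdeg, fun k => ?_⟩
  induction k using Nat.strong_induction_on with
  | _ k ih =>
    intro hk
    rcases lt_or_ge k r with hkr | hkr
    · exact (Lagrange.eval_interpolate_at_node (fun k : ℕ => F (k * v)) hinj
        (Finset.mem_range.2 hkr)).symm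
    · obtain ⟨l, rfl⟩ := Nat.exists_eq_add_of_le' hkr
      have h1 : fdiff r v (fun y => F y - P.eval y) (l * v) = 0 := by
        rw [fdiff_sub, h l hk, zero_sub, neg_eq_zero]
        rcases Nat.eq_zero_or_pos r with rfl | hr
        · have : P = 0 := by simpa using hdeg
          simp [this, fdiff]
        · refine fdiff_eq_zero_of_polynomial (P := P.comp (Polynomial.X + Polynomial.C (l * v)))
            (u := v) hr ?_ fun j _ => ?_
          · rcases eq_or_ne P 0 with h0 | h0
            · simp [h0]
            · rw [Polynomial.degree_eq_natDegree (Polynomial.comp_X_add_C_ne_zero_iff.2 h0),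
                Polynomial.natDegree_comp, Polynomial.natDegree_X_add_C, mul_one,
                ← Polynomial.degree_eq_natDegree h0]
              exact hdeg
          · simp [add_comm]
      rw [fdiff, Finset.sum_range_succ, Finset.sum_eq_zero] at h1
      · have h2 : (-1 : ℝ) ^ (r + r) = 1 := by rw [← two_mul, pow_mul]; simp
        rw [h2, Nat.choose_self] at h1
        have e : (l : ℝ) * v + (r : ℝ) • v = ((l + r : ℕ) : ℝ) * v := by
          push_cast; rw [smul_eq_mul]; ring
        rw [e] at h1
        simp only [Nat.cast_one, one_mul, zero_add] at h1
        linarith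
      · intro j hj
        have hj := Finset.mem_range.1 hj
        have e : (l : ℝ) * v + (j : ℝ) • v = ((l + j : ℕ) : ℝ) * v := by
          push_cast; rw [smul_eq_mul]; ring
        rw [e, ih (l + j) (by omega) (by omega), sub_self, mul_zero]

/-- A continuous function on `[0, 1]` with vanishing `r`-th differences is a polynomial. -/
theorem exists_polynomial_of_fdiff_eq_zero {r : ℕ} (hr : 1 ≤ r) {F : ℝ → ℝ}
    (hF : ContinuousOn F (Set.Icc 0 1))
    (h : ∀ x v : ℝ, 0 ≤ v → 0 ≤ x → x + r * v ≤ 1 → fdiff r v F x = 0) :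
    ∃ P ∈ Polynomial.degreeLT ℝ r, ∀ t ∈ Set.Icc (0 : ℝ) 1, F t = P.eval t := by
  have hr0 : (0 : ℝ) < r := by exact_mod_cast hr
  have hgrid : ∀ N : ℕ, 1 ≤ N → ∃ P ∈ Polynomial.degreeLT ℝ r, ∀ k ≤ r * N,
      F (k * (1 / (r * N : ℝ))) = P.eval ((k : ℝ) * (1 / (r * N : ℝ))) := by
    intro N hN
    have hN0 : (0 : ℝ) < N := by exact_mod_cast hN
    refine exists_polynomial_on_grid (by positivity) fun k hk =>
      h _ _ (by positivity) (by positivity) ?_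
    have : (k : ℝ) + r ≤ r * N := by exact_mod_cast hk
    rw [← add_mul, mul_one_div, div_le_one (by positivity)]
    exact this
  obtain ⟨P, hP, hPF⟩ := hgrid 1 le_rfl
  refine ⟨P, hP, ?_⟩
  -- the polynomials of all grids agree at the `r` coarsest grid points
  have hgrid' : ∀ N : ℕ, 1 ≤ N → ∀ k ≤ r * N,
      F (k * (1 / (r * N : ℝ))) = P.eval ((k : ℝ) * (1 / (r * N : ℝ))) := by
    intro N hN k hk
    have hN0 : (0 : ℝ) < N := by exact_mod_cast hN
    obtain ⟨P', hP', hPF'⟩ := hgrid N hN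
    have hinj : Set.InjOn (fun m : ℕ => (m : ℝ) * (1 / r : ℝ)) (Finset.range r) :=
      fun a _ b _ hab => by
        have h1 : (1 / r : ℝ) ≠ 0 := by positivity
        exact_mod_cast mul_right_cancel₀ h1 hab
    have heq : P' = P := by
      refine Polynomial.eq_of_degrees_lt_of_eval_index_eq (Finset.range r) hinj
        (by simpa using Polynomial.mem_degreeLT.1 hP')
        (by simpa using Polynomial.mem_degreeLT.1 hP) fun m hm => ?_
      have hm := Finset.mem_range.1 hm
      have h1 := hPF m (by omega)
      have h2 := hPF' (m * N) (Nat.mul_le_mul_right N hm.le)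
      have e1 : ((m * N : ℕ) : ℝ) * (1 / (r * N : ℝ)) = m * (1 / r) := by
        push_cast; field_simp
      rw [e1] at h2
      rw [Nat.cast_one, mul_one] at h1
      exact h2.symm.trans h1
    rw [hPF' k hk, heq]
  intro t ht
  -- approximate `t` by grid points from below
  have hlim : Filter.Tendsto (fun N : ℕ => (⌊t * (r * (N + 1 : ℕ) : ℝ)⌋₊ : ℝ) *
      (1 / (r * (N + 1 : ℕ) : ℝ))) Filter.atTop (nhds t) := by
    have h1 : Filter.Tendsto (fun N : ℕ => (r * (N + 1 : ℕ) : ℝ)) Filter.atTop Filter.atTop :=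
      (tendsto_natCast_atTop_atTop.comp (Filter.tendsto_add_atTop_nat 1)).const_mul_atTop hr0
    have h2 := (tendsto_nat_floor_mul_div_atTop ht.1).comp h1
    refine h2.congr fun N => ?_
    simp only [Function.comp_apply, mul_one_div]
  have hfloor : ∀ N : ℕ, ⌊t * (r * (N + 1 : ℕ) : ℝ)⌋₊ ≤ r * (N + 1) := fun N => by
    refine Nat.floor_le_of_le ?_
    push_cast
    have : (0 : ℝ) ≤ r * (N + 1) := by positivity
    nlinarith [ht.2]
  have hmem : ∀ N : ℕ, (⌊t * (r * (N + 1 : ℕ) : ℝ)⌋₊ : ℝ) *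
      (1 / (r * (N + 1 : ℕ) : ℝ)) ∈ Set.Icc (0 : ℝ) 1 := fun N => by
    refine ⟨by positivity, ?_⟩
    rw [mul_one_div, div_le_one (by positivity)]
    exact_mod_cast hfloor N
  have h1 := (hF t ht).tendsto.comp (tendsto_nhdsWithin_iff.2
    ⟨hlim, Filter.Eventually.of_forall hmem⟩)
  have h2 := (P.continuous.tendsto t).comp hlim
  refine tendsto_nhds_unique h1 (h2.congr fun N => ?_)
  exact (hgrid' (N + 1) (by omega) _ (hfloor N)).symm

end Frechet

/-! ### Coordinatewise polynomials -/

section CoordPoly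

variable {d : ℕ}

/-- The function `F` is a polynomial of degree `< r` in its `i`-th variable, as long as that
variable lies in `S`. -/
def IsPolyIn (r : ℕ) (F : (Fin d → ℝ) → ℝ) (i : Fin d) (S : Set ℝ) : Prop :=
  ∀ x, ∃ P ∈ Polynomial.degreeLT ℝ r, ∀ t ∈ S, F (Function.update x i t) = P.eval t

/-- The continuous functions that are polynomials of degree `< r` in each variable. -/
def coordPoly (d r : ℕ) : Set ((Fin d → ℝ) → ℝ) :=
  {Q | Continuous Q ∧ ∀ i, IsPolyIn r Q i Set.univ}

theorem const_mul_mem_coordPoly {r : ℕ} {Q : (Fin d → ℝ) → ℝ} (c : ℝ) (hQ : Q ∈ coordPoly d r) :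
    (fun x => c * Q x) ∈ coordPoly d r := by
  refine ⟨hQ.1.const_mul c, fun i x => ?_⟩
  obtain ⟨P, hP, h⟩ := hQ.2 i x
  exact ⟨c • P, Submodule.smul_mem _ _ hP, fun t ht => by simp [h t ht]⟩

theorem zero_mem_coordPoly (d r : ℕ) : (fun _ => 0) ∈ coordPoly d r :=
  ⟨continuous_const, fun _ _ => ⟨0, Submodule.zero_mem _, fun _ _ => by simp⟩⟩

/-- Lagrange interpolation in the `i`-th variable at the nodes `0, 1/r, …, (r-1)/r`. -/
def interpIn (r : ℕ) (i : Fin d) (F : (Fin d → ℝ) → ℝ) (x : Fin d → ℝ) : ℝ :=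
  ∑ m ∈ Finset.range r, F (Function.update x i (m * (1 / r : ℝ))) *
    (Lagrange.basis (Finset.range r) (fun m : ℕ => (m : ℝ) * (1 / r : ℝ)) m).eval (x i)

theorem continuous_interpIn (r : ℕ) (i : Fin d) {F : (Fin d → ℝ) → ℝ} (hF : Continuous F) :
    Continuous (interpIn r i F) := by
  refine continuous_finsetSum _ fun m _ => Continuous.mul ?_ ?_
  · exact hF.comp (continuous_id.update i continuous_const)
  · exact (Polynomial.continuous _).comp (continuous_apply i)

theorem interpIn_update {r : ℕ} (hr : 1 ≤ r) {i : Fin d} {F : (Fin d → ℝ) → ℝ} {x : Fin d → ℝ}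
    {P : Polynomial ℝ} (hP : P ∈ Polynomial.degreeLT ℝ r)
    (h : ∀ t ∈ Set.Icc (0 : ℝ) 1, F (Function.update x i t) = P.eval t) (t : ℝ) :
    interpIn r i F (Function.update x i t) = P.eval t := by
  have hr0 : (0 : ℝ) < r := by exact_mod_cast hr
  have hinj : Set.InjOn (fun m : ℕ => (m : ℝ) * (1 / r : ℝ)) (Finset.range r) :=
    fun a _ b _ hab => by
      have h1 : (1 / r : ℝ) ≠ 0 := by positivity
      exact_mod_cast mul_right_cancel₀ h1 hab
  have h1 := Lagrange.eq_interpolate (f := P) hinj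
    (by simpa using Polynomial.mem_degreeLT.1 hP)
  conv_rhs => rw [h1]
  rw [Lagrange.interpolate_apply, Polynomial.eval_finsetSum, interpIn]
  refine Finset.sum_congr rfl fun m hm => ?_
  have hm : (m : ℝ) ≤ r := by exact_mod_cast (Finset.mem_range.1 hm).le
  rw [Function.update_idem, Function.update_self, Polynomial.eval_mul, Polynomial.eval_C,
    h _ ⟨by positivity, by rwa [mul_one_div, div_le_one hr0]⟩]

theorem IsPolyIn.interpIn_self {r : ℕ} (hr : 1 ≤ r) {i : Fin d} {F : (Fin d → ℝ) → ℝ}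
    (h : IsPolyIn r F i (Set.Icc 0 1)) : IsPolyIn r (interpIn r i F) i Set.univ := fun x => by
  obtain ⟨P, hP, hPF⟩ := h x
  exact ⟨P, hP, fun t _ => interpIn_update hr hP hPF t⟩

theorem IsPolyIn.interpIn_of_ne {r : ℕ} {i k : Fin d} (hik : k ≠ i) {F : (Fin d → ℝ) → ℝ}
    {S : Set ℝ} (h : IsPolyIn r F k S) : IsPolyIn r (interpIn r i F) k S := fun x => by
  choose P hP hPF using h
  refine ⟨∑ m ∈ Finset.range r,
    (Lagrange.basis (Finset.range r) (fun m : ℕ => (m : ℝ) * (1 / r : ℝ)) m).eval (x i) •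
      P (Function.update x i (m * (1 / r : ℝ))),
    Submodule.sum_mem _ fun m _ => Submodule.smul_mem _ _ (hP _), fun t ht => ?_⟩
  rw [interpIn, Polynomial.eval_finsetSum]
  refine Finset.sum_congr rfl fun m _ => ?_
  rw [Function.update_of_ne hik.symm, Function.update_comm hik, hPF _ t ht,
    Polynomial.eval_smul, smul_eq_mul, mul_comm]

theorem IsPolyIn.interpIn_eq {r : ℕ} (hr : 1 ≤ r) {i : Fin d} {F : (Fin d → ℝ) → ℝ}
    (h : IsPolyIn r F i (Set.Icc 0 1)) {x : Fin d → ℝ} (hx : x i ∈ Set.Icc (0 : ℝ) 1) :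
    interpIn r i F x = F x := by
  obtain ⟨P, hP, hPF⟩ := h x
  have h1 := interpIn_update hr hP hPF (x i)
  rw [Function.update_eq_self] at h1
  rw [h1, ← hPF _ hx, Function.update_eq_self]

/-- The coordinatewise projection onto the unit cube. -/
def clampCube (x : Fin d → ℝ) : Fin d → ℝ := fun i => max 0 (min 1 (x i))

theorem continuous_clampCube : Continuous (clampCube (d := d)) :=
  continuous_pi fun i => continuous_const.max (continuous_const.min (continuous_apply i))

theorem clampCube_mem (x : Fin d → ℝ) : clampCube x ∈ Set.Icc (0 : Fin d → ℝ) 1 :=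
  ⟨fun _ => le_max_left _ _, fun _ => max_le zero_le_one (min_le_left _ _)⟩

theorem clampCube_of_mem {x : Fin d → ℝ} (hx : x ∈ Set.Icc (0 : Fin d → ℝ) 1) :
    clampCube x = x := funext fun i => by
  have h0 : 0 ≤ x i := hx.1 i
  have h1 : x i ≤ 1 := hx.2 i
  simp [clampCube, h0, h1]

theorem clampCube_update (x : Fin d → ℝ) (i : Fin d) {t : ℝ} (ht : t ∈ Set.Icc (0 : ℝ) 1) :
    clampCube (Function.update x i t) = Function.update (clampCube x) i t := funext fun k => by
  rcases eq_or_ne k i with rfl | hk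
  · simp [clampCube, ht.1, ht.2]
  · simp [clampCube, hk]

theorem update_mem_cube {x : Fin d → ℝ} (hx : x ∈ Set.Icc (0 : Fin d → ℝ) 1) (i : Fin d) {t : ℝ}
    (ht : t ∈ Set.Icc (0 : ℝ) 1) : Function.update x i t ∈ Set.Icc (0 : Fin d → ℝ) 1 :=
  ⟨le_update_iff.2 ⟨ht.1, fun k _ => hx.1 k⟩,
    update_le_iff.2 ⟨ht.2, fun k _ => hx.2 k⟩⟩

theorem fdiff_update {r : ℕ} (F : (Fin d → ℝ) → ℝ) (x : Fin d → ℝ) (i : Fin d) (t v : ℝ) :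
    fdiff r v (fun s => F (Function.update x i s)) t =
      fdiff r (Pi.single i v) F (Function.update x i t) := by
  refine Finset.sum_congr rfl fun j _ => ?_
  refine congrArg _ (congrArg F (funext fun k => ?_))
  rcases eq_or_ne k i with rfl | hk
  · simp
  · simp [hk]

/-- A continuous function on the unit cube with vanishing differences along the axes is a
polynomial of degree `< r` in each variable. -/
theorem exists_coordPoly_of_fdiff_eq_zero {r : ℕ} (hr : 1 ≤ r) {F : (Fin d → ℝ) → ℝ}
    (hF : ContinuousOn F (Set.Icc 0 1))
    (h : ∀ (i : Fin d) (x : Fin d → ℝ) (v : ℝ), 0 ≤ v → x ∈ Set.Icc (0 : Fin d → ℝ) 1 →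
      x i + r * v ≤ 1 → fdiff r (Pi.single i v) F x = 0) :
    ∃ Q ∈ coordPoly d r, ∀ x ∈ Set.Icc (0 : Fin d → ℝ) 1, F x = Q x := by
  have hstart : ∀ i, IsPolyIn r (F ∘ clampCube) i (Set.Icc 0 1) := fun i x => by
    have hupd : Continuous fun t : ℝ => Function.update (clampCube x) i t :=
      continuous_const.update i continuous_id
    obtain ⟨P, hP, hPF⟩ := exists_polynomial_of_fdiff_eq_zero hr
      (F := fun t => F (Function.update (clampCube x) i t))
      (hF.comp hupd.continuousOn fun t ht => update_mem_cube (clampCube_mem x) i ht)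
      fun t v hv ht htv => by
        rw [fdiff_update]
        refine h i _ v hv (update_mem_cube (clampCube_mem x) i ⟨ht, ?_⟩) (by simpa using htv)
        exact (le_add_of_nonneg_right (by positivity)).trans htv
    exact ⟨P, hP, fun t ht => by rw [Function.comp_apply, clampCube_update x i ht, hPF t ht]⟩
  have main : ∀ s : Finset (Fin d), ∃ Q : (Fin d → ℝ) → ℝ, Continuous Q ∧
      (∀ x ∈ Set.Icc (0 : Fin d → ℝ) 1, F x = Q x) ∧ (∀ i ∈ s, IsPolyIn r Q i Set.univ) ∧
      ∀ i ∉ s, IsPolyIn r Q i (Set.Icc 0 1) := by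
    intro s
    induction s using Finset.induction_on with
    | empty =>
      refine ⟨F ∘ clampCube, hF.comp_continuous continuous_clampCube clampCube_mem,
        fun x hx => by rw [Function.comp_apply, clampCube_of_mem hx], by simp,
        fun i _ => hstart i⟩
    | insert a s ha ih =>
      obtain ⟨Q, hQ, hFQ, hs, hns⟩ := ih
      refine ⟨interpIn r a Q, continuous_interpIn r a hQ, fun x hx => ?_, fun i hi => ?_,
        fun i hi => ?_⟩
      · rw [(hns a ha).interpIn_eq hr ⟨hx.1 a, hx.2 a⟩, hFQ x hx]
      · rcases Finset.mem_insert.1 hi with rfl | hi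
        · exact (hns i ha).interpIn_self hr
        · exact (hs i hi).interpIn_of_ne fun hia => ha (by rwa [← hia])
      · rw [Finset.mem_insert, not_or] at hi
        exact (hns i hi.2).interpIn_of_ne hi.1
  obtain ⟨Q, hQ, hFQ, hs, -⟩ := main Finset.univ
  exact ⟨Q, ⟨hQ, fun i => hs i (Finset.mem_univ i)⟩, hFQ⟩

end CoordPoly

/-! ### Compactness -/

section Compactness

variable {d : ℕ}

theorem add_smul_single_mem_cube {r : ℕ} {x : Fin d → ℝ} (hx : x ∈ Set.Icc (0 : Fin d → ℝ) 1)
    {i : Fin d} {v : ℝ} (hv : 0 ≤ v) (h : x i + r * v ≤ 1) {j : ℕ} (hj : j ≤ r) :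
    x + (j : ℝ) • (Pi.single i v : Fin d → ℝ) ∈ Set.Icc (0 : Fin d → ℝ) 1 := by
  have hjr : (j : ℝ) ≤ r := by exact_mod_cast hj
  have e : x + (j : ℝ) • (Pi.single i v : Fin d → ℝ) = Function.update x i (x i + j * v) := by
    ext k
    rcases eq_or_ne k i with rfl | hk
    · simp
    · simp [hk]
  rw [e]
  have h0 : 0 ≤ x i := hx.1 i
  exact update_mem_cube hx i ⟨by positivity, le_trans (by gcongr) h⟩

/-- A bounded Lipschitz function on the unit cube with uniformly small differences along the axes
is uniformly close to a polynomial of degree `< r` in each variable. By the Arzelà–Ascoli theorem,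
a sequence of counterexamples would converge to a function with vanishing differences. -/
theorem exists_coordPoly_near (d : ℕ) {r : ℕ} (hr : 1 ≤ r) (B : ℝ) (Λ : ℝ≥0) {θ : ℝ}
    (hθ : 0 < θ) :
    ∃ ε > 0, ∀ F : (Fin d → ℝ) → ℝ, (∀ x ∈ Set.Icc (0 : Fin d → ℝ) 1, |F x| ≤ B) →
      LipschitzOnWith Λ F (Set.Icc 0 1) →
      (∀ (i : Fin d) (x : Fin d → ℝ) (v : ℝ), 0 ≤ v → x ∈ Set.Icc (0 : Fin d → ℝ) 1 →
        x i + r * v ≤ 1 → |fdiff r (Pi.single i v) F x| ≤ ε) →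
      ∃ Q ∈ coordPoly d r, ∀ x ∈ Set.Icc (0 : Fin d → ℝ) 1, |F x - Q x| ≤ θ := by
  by_contra! hcon
  choose! F hFB hFL hFΔ hFQ using fun n : ℕ => hcon (1 / (n + 1 : ℝ)) (by positivity)
  let K : Set (Fin d → ℝ) := Set.Icc 0 1
  have hcont : ∀ n, Continuous (K.domRestrict (F n)) := fun n =>
    continuousOn_iff_continuous_domRestrict.1 (hFL n).continuousOn
  have : CompactSpace K := isCompact_iff_compactSpace.1 isCompact_Icc
  let f : ℕ → BoundedContinuousFunction K ℝ := fun n =>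
    BoundedContinuousFunction.mkOfCompact ⟨K.domRestrict (F n), hcont n⟩
  have hfF : ∀ n (x : K), f n x = F n x := fun n x => rfl
  have hcompact : IsCompact (closure (Set.range f)) := by
    refine BoundedContinuousFunction.arzela_ascoli (Set.Icc (-B) B) isCompact_Icc _ ?_ ?_
    · rintro _ x ⟨n, rfl⟩
      exact abs_le.1 (hFB n x x.2)
    · refine (LipschitzWith.uniformEquicontinuous _ Λ ?_).equicontinuous
      rintro ⟨_, n, rfl⟩
      exact (hFL n).to_restrict
  obtain ⟨f₀, -, φ, hφ, hlim⟩ := hcompact.tendsto_subseq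
    (x := f) fun n => subset_closure (Set.mem_range_self n)
  let F₀ : (Fin d → ℝ) → ℝ := fun x => f₀ ⟨clampCube x, clampCube_mem x⟩
  have hpt : ∀ x ∈ K, Filter.Tendsto (fun n => F (φ n) x) Filter.atTop (nhds (F₀ x)) := by
    intro x hx
    have h1 := ((continuous_eval_const (F := BoundedContinuousFunction K ℝ)
      (⟨x, hx⟩ : K)).tendsto f₀).comp hlim
    have e : F₀ x = f₀ ⟨x, hx⟩ := congrArg f₀ (Subtype.ext (clampCube_of_mem hx))
    rw [e]
    exact h1
  have hF₀ : Continuous F₀ := f₀.continuous.comp (continuous_clampCube.subtype_mk _)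
  obtain ⟨Q, hQ, hFQ₀⟩ := exists_coordPoly_of_fdiff_eq_zero hr hF₀.continuousOn
    fun i x v hv hx hxv => by
      have h1 : Filter.Tendsto (fun n => fdiff r (Pi.single i v) (F (φ n)) x) Filter.atTop
          (nhds (fdiff r (Pi.single i v) F₀ x)) :=
        tendsto_finsetSum _ fun j hj => (hpt _ (add_smul_single_mem_cube hx hv hxv
          (Finset.mem_range_succ_iff.1 hj))).const_mul _
      have h2 : Filter.Tendsto (fun n : ℕ => (1 / ((φ n : ℕ) + 1 : ℝ))) Filter.atTop (nhds 0) :=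
        tendsto_one_div_add_atTop_nhds_zero_nat.comp hφ.tendsto_atTop
      exact tendsto_nhds_unique h1
        (squeeze_zero_norm (fun n => hFΔ (φ n) i x v hv hx hxv) h2)
  obtain ⟨n, hn⟩ := ((Metric.tendsto_nhds.1 hlim) θ hθ).exists
  obtain ⟨x, hx, hxθ⟩ := hFQ (φ n) Q hQ
  have h1 := (BoundedContinuousFunction.dist_coe_le_dist (f := f (φ n)) (g := f₀)
    (⟨x, hx⟩ : K)).trans_lt hn
  have e : f₀ ⟨x, hx⟩ = Q x := by
    rw [← hFQ₀ x hx]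
    exact (congrArg f₀ (Subtype.ext (clampCube_of_mem hx))).symm
  rw [e, hfF, Real.dist_eq] at h1
  exact absurd h1 (not_lt.2 hxθ.le)

end Compactness

/-! ### Reproducing a function from multiples of a shift -/

section Representation

/-- A formula that expresses every function by its values at `x + (a₁u₁, …, a_du_d)`, with all
`a_i` between `1` and `r`, up to differences along the axes with steps `u_i`. The data do not depend
on the function, on `x` or on `u`. -/
structure Representation (d r : ℕ) where
  /-- The index type of the values. -/
  ι : Type
  /-- The index type of the differences. -/
  κ : Type
  [fintypeι : Fintype ι]
  [fintypeκ : Fintype κ]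
  /-- The coefficients of the values. -/
  c : ι → ℝ
  /-- The factors of the steps in the values. -/
  a : ι → Fin d → ℕ
  /-- The coefficients of the differences. -/
  b : κ → ℝ
  /-- The factors of the steps in the differences. -/
  s : κ → Fin d → ℕ
  /-- The axes of the differences. -/
  e : κ → Fin d
  one_le_a : ∀ k i, 1 ≤ a k i
  a_le : ∀ k i, a k i ≤ r
  s_le : ∀ k i, s k i ≤ r
  eq_add : ∀ (g : (Fin d → ℝ) → ℝ) (u x : Fin d → ℝ),
    g x = ∑ k, c k * g (x + fun i => a k i * u i) +
      ∑ k, b k * fdiff r (Pi.single (e k) (u (e k))) g (x + fun i => s k i * u i)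

attribute [instance] Representation.fintypeι Representation.fintypeκ

/-- Each axis in turn contributes the expression of `g x` by `g (x + h), …, g (x + r h)` and an
`r`-th difference. -/
theorem nonempty_representation (d r : ℕ) : Nonempty (Representation d r) := by
  classical
  suffices main : ∀ S : Finset (Fin d),
      ∃ (ι κ : Type) (_ : Fintype ι) (_ : Fintype κ) (c : ι → ℝ) (a : ι → Fin d → ℕ) (b : κ → ℝ)
      (s : κ → Fin d → ℕ) (e : κ → Fin d),
      (∀ k, ∀ i ∈ S, 1 ≤ a k i) ∧ (∀ k, ∀ i ∉ S, a k i = 0) ∧ (∀ k i, a k i ≤ r) ∧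
      (∀ k i, s k i ≤ r) ∧ ∀ (g : (Fin d → ℝ) → ℝ) (u x : Fin d → ℝ),
        g x = ∑ k, c k * g (x + fun i => a k i * u i) +
          ∑ k, b k * fdiff r (Pi.single (e k) (u (e k))) g (x + fun i => s k i * u i) by
    obtain ⟨ι, κ, h₁, h₂, c, a, b, s, e, ha, -, har, hs, h⟩ := main Finset.univ
    exact ⟨⟨ι, κ, c, a, b, s, e, fun k i => ha k i (Finset.mem_univ i), har, hs, h⟩⟩
  intro S
  induction S using Finset.induction_on with
  | empty =>
    refine ⟨Unit, Empty, inferInstance, inferInstance, fun _ => 1, fun _ _ => 0, Empty.elim,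
      fun k => k.elim, fun k => k.elim, by simp, by simp, by simp, fun k => k.elim,
      fun g u x => ?_⟩
    simp only [Finset.univ_unique, Finset.sum_singleton, Finset.univ_eq_empty, Finset.sum_empty,
      add_zero, one_mul, Nat.cast_zero, zero_mul]
    exact congrArg g (add_zero x).symm
  | insert m S hm ih =>
    obtain ⟨ι, κ, _, _, c, a, b, s, e, ha, ha0, har, hs, h⟩ := ih
    refine ⟨ι × Fin r, κ ⊕ ι, inferInstance, inferInstance,
      fun k => c k.1 * (-(-1 : ℝ) ^ (k.2.1 + 1) * (r.choose (k.2.1 + 1) : ℝ)),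
      fun k => Function.update (a k.1) m (k.2.1 + 1),
      Sum.elim b fun k => c k * (-1) ^ r, Sum.elim s a, Sum.elim e fun _ => m,
      fun k i hi => ?_, fun k i hi => ?_, fun k i => ?_, fun k i => ?_, fun g u x => ?_⟩
    · rcases eq_or_ne i m with rfl | him
      · simp
      · simpa [him] using ha k.1 i ((Finset.mem_insert.1 hi).resolve_left him)
    · rw [Finset.mem_insert, not_or] at hi
      simpa [hi.1] using ha0 k.1 i hi.2
    · rcases eq_or_ne i m with rfl | him
      · simp
      · simpa [him] using har k.1 i
    · rcases k with k | k
      · exact hs k i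
      · exact har k i
    · conv_lhs => rw [h g u x]
      rw [Fintype.sum_sum_type, Fintype.sum_prod_type]
      simp only [Sum.elim_inl, Sum.elim_inr]
      rw [add_comm (∑ k, b k * _) (∑ k, _), ← add_assoc, ← Finset.sum_add_distrib]
      congr 1
      refine Finset.sum_congr rfl fun k _ => ?_
      conv_lhs => rw [eq_fdiff_sub_sum r (Pi.single m (u m)) g (x + fun i => a k i * u i)]
      rw [mul_add, add_comm, Finset.mul_sum, Finset.sum_range, mul_assoc]
      congr 1
      refine Finset.sum_congr rfl fun j _ => ?_
      have hpt : (x + fun i => (a k i : ℝ) * u i) + ((j.1 + 1 : ℕ) : ℝ) •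
          (Pi.single m (u m) : Fin d → ℝ) =
          x + fun i => ((Function.update (a k) m (j.1 + 1) i : ℕ) : ℝ) * u i := by
        rw [add_assoc]
        refine congrArg _ (funext fun i => ?_)
        rcases eq_or_ne i m with rfl | him
        · simp [ha0 k i hm]
        · simp [him]
      rw [hpt]
      ring

end Representation

/-! ### Smoothing -/

section Kernel

variable {d : ℕ}

/-- The cube `[0, s]^d`. -/
def cube (d : ℕ) (s : ℝ) : Set (Fin d → ℝ) := Set.Icc 0 (fun _ => s)

theorem measurableSet_cube (s : ℝ) : MeasurableSet (cube d s) := measurableSet_Icc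

theorem volume_cube_one : volume (cube d 1) = 1 := by
  simp [cube, Real.volume_Icc_pi]

theorem volume_cube_ne_top (s : ℝ) : volume (cube d s) ≠ ⊤ :=
  isCompact_Icc.measure_lt_top.ne

theorem add_mem_cube {s t : ℝ} {x y : Fin d → ℝ} (hx : x ∈ cube d s) (hy : y ∈ cube d t) :
    x + y ∈ cube d (s + t) :=
  ⟨add_nonneg hx.1 hy.1, fun i => add_le_add (hx.2 i) (hy.2 i)⟩

theorem natCast_mul_mem_cube {r : ℕ} {a : Fin d → ℕ} (ha : ∀ i, a i ≤ r) {u : Fin d → ℝ}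
    (hu : u ∈ cube d 1) : (fun i => a i * u i) ∈ cube d r :=
  ⟨fun i => mul_nonneg (Nat.cast_nonneg _) (hu.1 i), fun i => by
    have h1 : (a i : ℝ) ≤ r := by exact_mod_cast ha i
    have h2 : 0 ≤ u i := hu.1 i
    have h3 : u i ≤ 1 := hu.2 i
    change (a i : ℝ) * u i ≤ r
    nlinarith⟩

theorem smul_single_mem_cube {r j : ℕ} (hj : j ≤ r) (i : Fin d) {v : ℝ} (hv0 : 0 ≤ v)
    (hv1 : v ≤ 1) : (j : ℝ) • (Pi.single i v : Fin d → ℝ) ∈ cube d r := by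
  have h1 : (j : ℝ) ≤ r := by exact_mod_cast hj
  constructor
  · exact smul_nonneg (Nat.cast_nonneg _) (Pi.single_nonneg.2 hv0)
  · intro k
    rcases eq_or_ne k i with rfl | hk
    · simp only [Pi.smul_apply, Pi.single_eq_same, smul_eq_mul]
      nlinarith [(Nat.cast_nonneg j : (0 : ℝ) ≤ j)]
    · simp [hk]

/-- A Lipschitz probability density supported in the unit cube. -/
structure IsKernel (Λ : ℝ≥0) (B : ℝ≥0) (φ : (Fin d → ℝ) → ℝ) : Prop where
  nonneg : ∀ u, 0 ≤ φ u
  le : ∀ u, φ u ≤ B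
  eq_zero : ∀ u ∉ cube d 1, φ u = 0
  lipschitz : LipschitzWith Λ φ
  integral_eq : ∫ u, φ u = 1

theorem exists_isKernel (d : ℕ) : ∃ (Λ B : ℝ≥0) (φ : (Fin d → ℝ) → ℝ), IsKernel Λ B φ := by
  let h : Fin d → ℝ := fun _ => 1 / 2
  let ψ : (Fin d → ℝ) → ℝ := fun u => max (1 - 2 * ‖u - h‖) 0
  have hψ0 : ∀ u, 0 ≤ ψ u := fun u => le_max_right _ _
  have hψ1 : ∀ u, ψ u ≤ 1 := fun u => max_le (by linarith [norm_nonneg (u - h)]) zero_le_one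
  have hsupp : ∀ u ∉ cube d 1, ψ u = 0 := fun u hu => by
    refine max_eq_right ?_
    by_contra! hlt
    refine hu ⟨fun i => ?_, fun i => ?_⟩ <;>
    · have h1 : |u i - 1 / 2| ≤ ‖u - h‖ := norm_le_pi_norm (u - h) i
      rw [abs_le] at h1
      simp only [Pi.zero_apply]
      linarith
  have hlip : LipschitzWith 2 ψ := by
    have h1 : LipschitzWith 2 fun u : Fin d → ℝ => 1 - 2 * ‖u - h‖ :=
      LipschitzWith.of_dist_le_mul fun u v => by
        rw [Real.dist_eq, dist_eq_norm]
        have h2 := abs_norm_sub_norm_le (u - h) (v - h)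
        rw [sub_sub_sub_cancel_right] at h2
        have e : 1 - 2 * ‖u - h‖ - (1 - 2 * ‖v - h‖) = -(2 * (‖u - h‖ - ‖v - h‖)) := by ring
        rw [e, abs_neg, abs_mul, abs_two]
        exact mul_le_mul_of_nonneg_left h2 zero_le_two
    exact h1.max_const 0
  have hcs : HasCompactSupport ψ := HasCompactSupport.intro isCompact_Icc hsupp
  have hpos : 0 < ∫ u, ψ u := hlip.continuous.integral_pos_of_hasCompactSupport_nonneg_nonzero hcs
    hψ0 (x := h) (by simp [ψ])
  set Z := ∫ u, ψ u with hZ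
  refine ⟨(Z⁻¹).toNNReal * 2, (Z⁻¹).toNNReal, fun u => Z⁻¹ * ψ u, ⟨fun u => ?_, fun u => ?_,
    fun u hu => ?_, ?_, ?_⟩⟩
  · exact mul_nonneg (inv_nonneg.2 hpos.le) (hψ0 u)
  · rw [Real.coe_toNNReal _ (inv_nonneg.2 hpos.le)]
    exact mul_le_of_le_one_right (inv_nonneg.2 hpos.le) (hψ1 u)
  · rw [hsupp u hu, mul_zero]
  · refine LipschitzWith.of_dist_le_mul fun u v => ?_
    have h1 := hlip.dist_le_mul u v
    rw [Real.dist_eq] at h1 ⊢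
    rw [← mul_sub, abs_mul, abs_of_nonneg (inv_nonneg.2 hpos.le), NNReal.coe_mul,
      Real.coe_toNNReal _ (inv_nonneg.2 hpos.le), mul_assoc]
    exact mul_le_mul_of_nonneg_left h1 (inv_nonneg.2 hpos.le)
  · rw [integral_const_mul, ← hZ, inv_mul_cancel₀ hpos.ne']

namespace IsKernel

variable {Λ B : ℝ≥0} {φ : (Fin d → ℝ) → ℝ}

theorem integrable (hφ : IsKernel Λ B φ) : Integrable φ :=
  hφ.lipschitz.continuous.integrable_of_hasCompactSupport
    (HasCompactSupport.intro isCompact_Icc hφ.eq_zero)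

theorem lintegral_eq (hφ : IsKernel Λ B φ) : ∫⁻ u, ‖φ u‖ₑ = 1 := by
  have h1 : ∀ u, ‖φ u‖ₑ = ENNReal.ofReal (φ u) := fun u => by
    rw [Real.enorm_eq_ofReal (hφ.nonneg u)]
  simp only [h1]
  rw [← ofReal_integral_eq_lintegral_ofReal hφ.integrable (.of_forall hφ.nonneg),
    hφ.integral_eq, ENNReal.ofReal_one]

theorem integrable_mul (hφ : IsKernel Λ B φ) {g : (Fin d → ℝ) → ℝ} (hg : Measurable g) {M : ℝ}
    (hM : ∀ x, |g x| ≤ M) : Integrable fun u => g u * φ u :=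
  hφ.integrable.bdd_mul hg.aestronglyMeasurable (.of_forall hM)

theorem abs_integral_mul_le (hφ : IsKernel Λ B φ) {g : (Fin d → ℝ) → ℝ}
    {M : ℝ} (hM : ∀ u ∈ cube d 1, |g u| ≤ M) : |∫ u, g u * φ u| ≤ M := by
  have h1 := norm_integral_le_of_norm_le (f := fun u => g u * φ u) (hφ.integrable.const_mul M)
    (.of_forall fun u => by
      by_cases hu : u ∈ cube d 1
      · rw [norm_mul, Real.norm_eq_abs, Real.norm_of_nonneg (hφ.nonneg u)]
        exact mul_le_mul_of_nonneg_right (hM u hu) (hφ.nonneg u)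
      · simp [hφ.eq_zero u hu])
  rwa [integral_const_mul, hφ.integral_eq, mul_one] at h1

/-- Translations of the kernel depend on the translation in a Lipschitz way in `L¹`. -/
theorem integral_abs_sub_le (hφ : IsKernel Λ B φ) (w : Fin d → ℝ) :
    ∫ u, |φ (u - w) - φ u| ≤ 2 * Λ * ‖w‖ := by
  set A : Set (Fin d → ℝ) := cube d 1 ∪ (· - w) ⁻¹' cube d 1 with hA
  have hAm : MeasurableSet A := (measurableSet_cube 1).union
    ((measurableSet_cube 1).preimage (measurable_sub_const w))
  have hvol : volume A ≤ 2 := by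
    refine (measure_union_le _ _).trans ?_
    rw [(measurePreserving_sub_right volume w).measure_preimage
      (measurableSet_cube 1).nullMeasurableSet, volume_cube_one]
    norm_num
  have h1 : ∫ u, |φ (u - w) - φ u| = ∫ u in A, |φ (u - w) - φ u| := by
    refine (setIntegral_eq_integral_of_forall_compl_eq_zero fun u hu => ?_).symm
    rw [hA, Set.mem_union, not_or] at hu
    rw [hφ.eq_zero u hu.1, hφ.eq_zero (u - w) hu.2, sub_zero, abs_zero]
  rw [h1]
  have h2 := norm_setIntegral_le_of_norm_le_const (μ := volume) (s := A)
    (f := fun u => |φ (u - w) - φ u|) (C := Λ * ‖w‖) (hvol.trans_lt (by simp)) fun u _ => by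
      rw [Real.norm_eq_abs, abs_abs, ← Real.dist_eq]
      refine (hφ.lipschitz.dist_le_mul _ _).trans_eq ?_
      rw [dist_eq_norm, sub_sub_cancel_left, norm_neg]
  refine (Real.le_norm_self _).trans (h2.trans ?_)
  have h3 : volume.real A ≤ 2 := ENNReal.toReal_le_of_le_ofReal (by norm_num) (by simpa using hvol)
  have : (0 : ℝ) ≤ Λ * ‖w‖ := by positivity
  nlinarith

end IsKernel

/-- Scaling the coordinates by factors at least `1` does not increase integrals. -/
theorem lintegral_comp_add_mul_le {r : ℕ} {a : Fin d → ℕ} (ha : ∀ i, 1 ≤ a i)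
    (har : ∀ i, a i ≤ r) {s : ℝ} {x : Fin d → ℝ} (hx : x ∈ cube d s)
    {h : (Fin d → ℝ) → ℝ≥0∞} (hh : Measurable h) :
    ∫⁻ u : Fin d → ℝ in cube d 1, h (x + fun i => a i * u i) ≤ ∫⁻ y in cube d (s + r), h y := by
  classical
  set D : Fin d → ℝ := fun i => a i with hD
  have hdet : 1 ≤ (Matrix.diagonal D).det := by
    rw [Matrix.det_diagonal]
    exact Finset.one_le_prod fun i => by simpa [hD] using ha i
  have hdet0 : (Matrix.diagonal D).det ≠ 0 := by linarith
  have hmap := Real.smul_map_diagonal_volume_pi hdet0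
  have hlin : ∀ u, Matrix.toLin' (Matrix.diagonal D) u = fun i => a i * u i := fun u => by
    ext i
    simp [hD, Matrix.mulVec_diagonal]
  have hmapm : Measurable (Matrix.toLin' (Matrix.diagonal D)) := by
    exact (LinearMap.continuous_of_finiteDimensional _).measurable
  set H : (Fin d → ℝ) → ℝ≥0∞ := (cube d (s + r)).indicator h with hH
  have hHm : Measurable H := hh.indicator (measurableSet_cube _)
  have hHx : Measurable fun y => H (x + y) := hHm.comp (measurable_const_add x)
  calc ∫⁻ u : Fin d → ℝ in cube d 1, h (x + fun i => a i * u i)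
      ≤ ∫⁻ u : Fin d → ℝ in cube d 1, H (x + fun i => a i * u i) := by
        refine setLIntegral_mono' (measurableSet_cube 1) fun u hu => ?_
        rw [hH, Set.indicator_of_mem (add_mem_cube hx (natCast_mul_mem_cube har hu))]
    _ ≤ ∫⁻ u : Fin d → ℝ, H (x + fun i => a i * u i) := setLIntegral_le_lintegral _ _
    _ = ∫⁻ y, H (x + y) ∂(Measure.map (Matrix.toLin' (Matrix.diagonal D)) volume) := by
        rw [lintegral_map hHx hmapm]
        simp only [hlin]
    _ ≤ ENNReal.ofReal |(Matrix.diagonal D).det| *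
          ∫⁻ y, H (x + y) ∂(Measure.map (Matrix.toLin' (Matrix.diagonal D)) volume) := by
        refine le_mul_of_one_le_left' ?_
        rw [ENNReal.one_le_ofReal]
        exact hdet.trans (le_abs_self _)
    _ = ∫⁻ y, H (x + y) := by
        rw [← smul_eq_mul, ← lintegral_smul_measure, hmap]
    _ = ∫⁻ y, H y := lintegral_add_left_eq_self H x
    _ = ∫⁻ y in cube d (s + r), h y := lintegral_indicator (measurableSet_cube _) h

/-- The average of `g` over the points `x + (a₁u₁, …, a_du_d)`, with density `φ` in `u`. -/
def avg (φ : (Fin d → ℝ) → ℝ) (a : Fin d → ℕ) (g : (Fin d → ℝ) → ℝ) (x : Fin d → ℝ) : ℝ :=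
  ∫ u : Fin d → ℝ, g (x + fun i => a i * u i) * φ u

section Avg

variable {Λ B : ℝ≥0} {φ : (Fin d → ℝ) → ℝ} {a : Fin d → ℕ} {g : (Fin d → ℝ) → ℝ} {M : ℝ}

theorem measurable_comp_add_mul (hg : Measurable g) (a : Fin d → ℕ) (x : Fin d → ℝ) :
    Measurable fun u : Fin d → ℝ => g (x + fun i => a i * u i) :=
  hg.comp (by fun_prop)

theorem fdiff_avg (hφ : IsKernel Λ B φ) (hg : Measurable g) (hM : ∀ x, |g x| ≤ M) (r : ℕ)
    (h x : Fin d → ℝ) : fdiff r h (avg φ a g) x = avg φ a (fdiff r h g) x := by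
  simp only [fdiff, avg, Finset.sum_mul]
  rw [integral_finsetSum _ fun j _ => ?_]
  · refine Finset.sum_congr rfl fun j _ => ?_
    rw [← integral_const_mul]
    refine integral_congr_ae (.of_forall fun u => ?_)
    simp only [mul_assoc, add_right_comm]
  · have h1 := (hφ.integrable_mul (measurable_comp_add_mul hg a (x + (j : ℝ) • h))
      fun u => hM _).const_mul ((-1 : ℝ) ^ (r + j) * (r.choose j : ℝ))
    refine h1.congr (.of_forall fun u => ?_)
    simp only [mul_assoc, add_right_comm]

/-- Averages of bounded functions are Lipschitz. -/
theorem abs_avg_sub_le (hφ : IsKernel Λ B φ) (hg : Measurable g) (hM : ∀ x, |g x| ≤ M)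
    (ha : ∀ i, 1 ≤ a i) (x y : Fin d → ℝ) :
    |avg φ a g x - avg φ a g y| ≤ M * (2 * Λ * ‖x - y‖) := by
  have hM0 : 0 ≤ M := (abs_nonneg _).trans (hM 0)
  set w : Fin d → ℝ := fun i => (x i - y i) / a i with hw
  have hwn : ‖w‖ ≤ ‖x - y‖ := by
    refine (pi_norm_le_iff_of_nonneg (norm_nonneg _)).2 fun i => ?_
    have h1 : (1 : ℝ) ≤ a i := by exact_mod_cast ha i
    rw [hw, norm_div, Real.norm_natCast]
    exact (div_le_self (norm_nonneg _) h1).trans (norm_le_pi_norm (x - y) i)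
  have hint := hφ.integrable_mul (measurable_comp_add_mul hg a y) fun u => hM _
  -- translating the integration variable moves the shift from `g` to the kernel
  have h1 : avg φ a g x = ∫ u : Fin d → ℝ, g (y + fun i => a i * u i) * φ (u - w) := by
    rw [avg, ← integral_sub_right_eq_self _ w]
    refine integral_congr_ae (.of_forall fun u => ?_)
    have e : (x + fun i => (a i : ℝ) * (u - w) i) = y + fun i => (a i : ℝ) * u i := by
      ext i
      have h1 : (a i : ℝ) ≠ 0 := by
        have := ha i
        positivity
      simp only [hw, Pi.add_apply, Pi.sub_apply]
      field_simp
      ring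
    simp only [e]
  have hint' : Integrable fun u : Fin d → ℝ => g (y + fun i => a i * u i) * φ (u - w) :=
    (hφ.integrable.comp_sub_right w).bdd_mul
      (measurable_comp_add_mul hg a y).aestronglyMeasurable (.of_forall fun u => hM _)
  have hsub : Integrable fun u : Fin d → ℝ => |φ (u - w) - φ u| :=
    ((hφ.integrable.comp_sub_right w).sub hφ.integrable).abs
  rw [h1, avg, ← integral_sub hint' hint, ← Real.norm_eq_abs]
  refine (norm_integral_le_of_norm_le (hsub.const_mul M) (.of_forall fun u => ?_)).trans ?_
  · rw [← mul_sub, norm_mul]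
    exact mul_le_mul_of_nonneg_right (hM _) (abs_nonneg _)
  · rw [integral_const_mul]
    refine mul_le_mul_of_nonneg_left ((hφ.integral_abs_sub_le w).trans ?_) hM0
    gcongr

/-- Averages turn smallness in `L¹` into uniform smallness. -/
theorem enorm_avg_le (hφ : IsKernel Λ B φ) (hg : Measurable g) {r : ℕ} (ha : ∀ i, 1 ≤ a i)
    (har : ∀ i, a i ≤ r) {s : ℝ} {x : Fin d → ℝ} (hx : x ∈ cube d s) :
    ‖avg φ a g x‖ₑ ≤ B * pNorm 1 g (cube d (s + r)) := by
  rw [pNorm_of_ne_top one_ne_top, eLpNorm_one_eq_lintegral_enorm]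
  calc ‖avg φ a g x‖ₑ ≤ ∫⁻ u : Fin d → ℝ, ‖g (x + fun i => a i * u i) * φ u‖ₑ :=
        enorm_integral_le_lintegral_enorm _
    _ = ∫⁻ u : Fin d → ℝ in cube d 1, ‖g (x + fun i => a i * u i) * φ u‖ₑ := by
        rw [← lintegral_indicator (measurableSet_cube 1)]
        refine lintegral_congr fun u => ?_
        by_cases hu : u ∈ cube d 1
        · rw [Set.indicator_of_mem hu]
        · rw [Set.indicator_of_notMem hu, hφ.eq_zero u hu, mul_zero, enorm_zero]
    _ ≤ ∫⁻ u : Fin d → ℝ in cube d 1, B * ‖g (x + fun i => a i * u i)‖ₑ := by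
        refine lintegral_mono fun u => ?_
        rw [enorm_mul, mul_comm]
        gcongr
        rw [Real.enorm_eq_ofReal (hφ.nonneg u)]
        exact ENNReal.ofReal_le_of_le_toReal (hφ.le u)
    _ = B * ∫⁻ u : Fin d → ℝ in cube d 1, ‖g (x + fun i => a i * u i)‖ₑ :=
        lintegral_const_mul _ (measurable_comp_add_mul hg a x).enorm
    _ ≤ _ := by
        exact mul_le_mul_right (lintegral_comp_add_mul_le ha har hx hg.enorm) _

end Avg

end Kernel

/-! ### Smoothing by an averaged representation -/

section Smooth

variable {d r : ℕ}

namespace Representation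

variable (R : Representation d r)

/-- The part of the representation that consists of differences. -/
def remainder (g : (Fin d → ℝ) → ℝ) (u x : Fin d → ℝ) : ℝ :=
  ∑ k, R.b k * fdiff r (Pi.single (R.e k) (u (R.e k))) g (x + fun i => R.s k i * u i)

theorem remainder_eq (g : (Fin d → ℝ) → ℝ) (u x : Fin d → ℝ) :
    R.remainder g u x = g x - ∑ k, R.c k * g (x + fun i => R.a k i * u i) := by
  have := R.eq_add g u x
  rw [remainder]
  linarith

/-- The values in the representation, averaged over the steps `u` with density `φ`. -/
def smooth (φ g : (Fin d → ℝ) → ℝ) (x : Fin d → ℝ) : ℝ := ∑ k, R.c k * avg φ (R.a k) g x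

/-- The sum of the absolute values of the coefficients. -/
def sumC : ℝ≥0 := ∑ k, ‖R.c k‖₊

theorem coe_sumC : (R.sumC : ℝ) = ∑ k, |R.c k| := by simp [sumC]

/-- The constant in the bound of the remainder by the differences. -/
def remConst (p : ℝ≥0∞) : ℝ≥0 := addConst p ^ (Finset.univ : Finset R.κ).card * ∑ k, ‖R.b k‖₊

theorem measurable_remainder {g : (Fin d → ℝ) → ℝ} (hg : Measurable g) :
    Measurable fun z : (Fin d → ℝ) × (Fin d → ℝ) => R.remainder g z.2 z.1 := by
  simp only [R.remainder_eq]
  refine (hg.comp measurable_fst).sub (Finset.measurable_fun_sum _ fun k _ =>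
    (hg.comp ?_).const_mul _)
  fun_prop

theorem pNorm_remainder_le (p : ℝ≥0∞) {g : (Fin d → ℝ) → ℝ} (hg : Measurable g) {t : ℝ}
    {ω : ℝ≥0∞} (hω : ∀ (i : Fin d) (v : ℝ), 0 ≤ v → v ≤ 1 →
      pNorm p (fdiff r (Pi.single i v) g) (cube d (t + r)) ≤ ω) {u : Fin d → ℝ}
    (hu : u ∈ cube d 1) : pNorm p (R.remainder g u) (cube d t) ≤ R.remConst p * ω := by
  refine pNorm_sum_le p Finset.univ R.b (f := fun k x =>
    fdiff r (Pi.single (R.e k) (u (R.e k))) g (x + fun i => R.s k i * u i))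
    (fun k => (measurable_fdiff r _ hg).comp (measurable_add_const _)) _ fun k _ => ?_
  refine (pNorm_comp_add_right_le p (measurable_fdiff r _ hg) (measurableSet_cube (t + r)) _
    fun x hx => add_mem_cube hx (natCast_mul_mem_cube (R.s_le k) hu)).trans ?_
  exact hω _ _ (hu.1 _) (hu.2 _)

variable {R} {Λ B : ℝ≥0} {φ : (Fin d → ℝ) → ℝ} {g : (Fin d → ℝ) → ℝ} {M : ℝ}

theorem abs_smooth_le (hφ : IsKernel Λ B φ) (hM : ∀ x, |g x| ≤ M) (x : Fin d → ℝ) :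
    |R.smooth φ g x| ≤ R.sumC * M := by
  rw [smooth, coe_sumC, Finset.sum_mul]
  refine (Finset.abs_sum_le_sum_abs _ _).trans (Finset.sum_le_sum fun k _ => ?_)
  rw [abs_mul]
  exact mul_le_mul_of_nonneg_left (hφ.abs_integral_mul_le fun u _ => hM _) (abs_nonneg _)

theorem abs_smooth_sub_le (hφ : IsKernel Λ B φ) (hg : Measurable g) (hM : ∀ x, |g x| ≤ M)
    (x y : Fin d → ℝ) :
    |R.smooth φ g x - R.smooth φ g y| ≤ R.sumC * (M * (2 * Λ * ‖x - y‖)) := by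
  rw [smooth, smooth, ← Finset.sum_sub_distrib, coe_sumC, Finset.sum_mul]
  refine (Finset.abs_sum_le_sum_abs _ _).trans (Finset.sum_le_sum fun k _ => ?_)
  rw [← mul_sub, abs_mul]
  exact mul_le_mul_of_nonneg_left (abs_avg_sub_le hφ hg hM (R.one_le_a k) x y) (abs_nonneg _)

theorem fdiff_smooth (hφ : IsKernel Λ B φ) (hg : Measurable g) (hM : ∀ x, |g x| ≤ M)
    (h x : Fin d → ℝ) :
    fdiff r h (R.smooth φ g) x = ∑ k, R.c k * avg φ (R.a k) (fdiff r h g) x := by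
  simp only [← fdiff_avg hφ hg hM]
  simp only [fdiff, smooth, Finset.mul_sum]
  rw [Finset.sum_comm]
  exact Finset.sum_congr rfl fun _ _ => Finset.sum_congr rfl fun _ _ => by ring

theorem enorm_fdiff_smooth_le (hφ : IsKernel Λ B φ) (hg : Measurable g) (hM : ∀ x, |g x| ≤ M)
    (h : Fin d → ℝ) {x : Fin d → ℝ} (hx : x ∈ cube d 1) :
    ‖fdiff r h (R.smooth φ g) x‖ₑ ≤
      (R.sumC * B : ℝ≥0) * pNorm 1 (fdiff r h g) (cube d (1 + r)) := by
  rw [fdiff_smooth hφ hg hM, sumC, ENNReal.coe_mul, ENNReal.ofNNReal_finsetSum, mul_assoc,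
    Finset.sum_mul]
  refine (enorm_sum_le _ _).trans (Finset.sum_le_sum fun k _ => ?_)
  rw [enorm_mul]
  exact mul_le_mul_right (enorm_avg_le hφ (measurable_fdiff r h hg) (R.one_le_a k) (R.a_le k) hx) _

theorem sub_smooth_eq (hφ : IsKernel Λ B φ) (hg : Measurable g) (hM : ∀ x, |g x| ≤ M)
    (x : Fin d → ℝ) :
    g x - R.smooth φ g x = ∫ u : Fin d → ℝ, R.remainder g u x * φ u := by
  have h1 : ∀ k, Integrable fun u : Fin d → ℝ =>
      R.c k * (g (x + fun i => R.a k i * u i) * φ u) := fun k =>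
    (hφ.integrable_mul (measurable_comp_add_mul hg (R.a k) x) fun u => hM _).const_mul _
  simp only [R.remainder_eq, sub_mul, Finset.sum_mul, mul_assoc]
  rw [integral_sub (hφ.integrable.const_mul _) (integrable_finsetSum _ fun k _ => h1 k),
    integral_const_mul, hφ.integral_eq, mul_one, integral_finsetSum _ fun k _ => h1 k]
  simp only [integral_const_mul]
  rfl

theorem pNorm_one_sub_smooth_le (hφ : IsKernel Λ B φ) (hg : Measurable g)
    (hM : ∀ x, |g x| ≤ M) {ω : ℝ≥0∞} (hω : ∀ (i : Fin d) (v : ℝ), 0 ≤ v → v ≤ 1 →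
      pNorm 1 (fdiff r (Pi.single i v) g) (cube d (1 + r)) ≤ ω) :
    pNorm 1 (fun x => g x - R.smooth φ g x) (cube d 1) ≤ R.remConst 1 * ω := by
  rw [pNorm_of_ne_top one_ne_top, eLpNorm_one_eq_lintegral_enorm]
  have hmeas : Measurable fun z : (Fin d → ℝ) × (Fin d → ℝ) =>
      ‖R.remainder g z.2 z.1‖ₑ * ‖φ z.2‖ₑ :=
    (R.measurable_remainder hg).enorm.mul
      (hφ.lipschitz.continuous.measurable.comp measurable_snd).enorm
  calc ∫⁻ x in cube d 1, ‖g x - R.smooth φ g x‖ₑ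
      ≤ ∫⁻ x in cube d 1, ∫⁻ u : Fin d → ℝ, ‖R.remainder g u x‖ₑ * ‖φ u‖ₑ := by
        refine lintegral_mono fun x => ?_
        rw [sub_smooth_eq hφ hg hM]
        refine (enorm_integral_le_lintegral_enorm _).trans_eq ?_
        simp only [enorm_mul]
    _ = ∫⁻ u : Fin d → ℝ, ∫⁻ x in cube d 1, ‖R.remainder g u x‖ₑ * ‖φ u‖ₑ :=
        lintegral_lintegral_swap hmeas.aemeasurable
    _ ≤ ∫⁻ u : Fin d → ℝ, R.remConst 1 * ω * ‖φ u‖ₑ := by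
        refine lintegral_mono fun u => ?_
        have hm : Measurable fun x => ‖R.remainder g u x‖ₑ :=
          ((R.measurable_remainder hg).comp (measurable_id.prodMk measurable_const)).enorm
        rw [lintegral_mul_const _ hm]
        by_cases hu : u ∈ cube d 1
        · have := R.pNorm_remainder_le 1 hg hω hu
          rw [pNorm_of_ne_top one_ne_top, eLpNorm_one_eq_lintegral_enorm] at this
          exact mul_le_mul_left this _
        · simp [hφ.eq_zero u hu]
    _ = R.remConst 1 * ω := by
        rw [lintegral_const_mul _ hφ.lipschitz.continuous.measurable.enorm, hφ.lintegral_eq,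
          mul_one]

theorem pNorm_top_sub_smooth_le (hφ : IsKernel Λ B φ) (hg : Measurable g)
    (hM : ∀ x, |g x| ≤ M) {ω : ℝ≥0} (hω : ∀ (i : Fin d) (v : ℝ), 0 ≤ v → v ≤ 1 →
      pNorm ⊤ (fdiff r (Pi.single i v) g) (cube d (1 + r)) ≤ ω) :
    pNorm ⊤ (fun x => g x - R.smooth φ g x) (cube d 1) ≤ (R.remConst ⊤ * ω : ℝ≥0) := by
  refine pNorm_top_le_iff.2 fun x hx => ?_
  rw [sub_smooth_eq hφ hg hM]
  refine hφ.abs_integral_mul_le fun u hu => ?_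
  have h1 := R.pNorm_remainder_le ⊤ hg hω hu
  rw [← ENNReal.coe_mul] at h1
  exact pNorm_top_le_iff.1 h1 x hx

variable (R) in
/-- The smoothing of a bounded function with differences small in `L¹` is uniformly close to a
polynomial of degree `< r` in each variable. -/
theorem exists_coordPoly_near_smooth (hr : 1 ≤ r) (hφ : IsKernel Λ B φ) (M : ℝ≥0) {θ : ℝ}
    (hθ : 0 < θ) :
    ∃ ε : ℝ≥0, 0 < ε ∧ ∀ g : (Fin d → ℝ) → ℝ, Measurable g → (∀ x, |g x| ≤ M) →
      (∀ (i : Fin d) (v : ℝ), 0 ≤ v → v ≤ 1 →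
        pNorm 1 (fdiff r (Pi.single i v) g) (cube d (1 + r)) ≤ ε) →
      ∃ Q ∈ coordPoly d r, ∀ x ∈ cube d 1, |R.smooth φ g x - Q x| ≤ θ := by
  obtain ⟨ε₀, hε₀, h⟩ := exists_coordPoly_near d hr (R.sumC * M) (R.sumC * (M * (2 * Λ))) hθ
  have hpos : 0 < (R.sumC * B + 1 : ℝ≥0) := by positivity
  refine ⟨ε₀.toNNReal / (R.sumC * B + 1), div_pos (Real.toNNReal_pos.2 hε₀) hpos,
    fun g hg hM hΔ => h _ (fun x _ => abs_smooth_le hφ hM x) ?_ fun i x v hv hx hxv => ?_⟩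
  · refine (LipschitzWith.of_dist_le_mul fun x y => ?_).lipschitzOnWith
    rw [Real.dist_eq, dist_eq_norm]
    refine (abs_smooth_sub_le hφ hg hM x y).trans_eq ?_
    push_cast
    ring
  · have hv1 : v ≤ 1 := by
      have h1 : (1 : ℝ) ≤ r := by exact_mod_cast hr
      have h2 : 0 ≤ x i := hx.1 i
      nlinarith
    have h1 := (enorm_fdiff_smooth_le (R := R) hφ hg hM (Pi.single i v) hx).trans
      (mul_le_mul_right (hΔ i v hv hv1) _)
    rw [enorm_eq_nnnorm, ← ENNReal.coe_mul, ENNReal.coe_le_coe, ← NNReal.coe_le_coe, coe_nnnorm]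
      at h1
    refine h1.trans ?_
    have h2 : R.sumC * B * (ε₀.toNNReal / (R.sumC * B + 1)) ≤ ε₀.toNNReal := by
      rw [mul_div_assoc', div_le_iff₀ hpos, mul_comm]
      gcongr
      exact le_self_add
    calc _ ≤ ((ε₀.toNNReal : ℝ≥0) : ℝ) := by exact_mod_cast h2
      _ = ε₀ := Real.coe_toNNReal _ hε₀.le

end Representation

end Smooth

/-! ### Bounded functions and truncation -/

section Truncation

section Compare

variable {α : Type*} [MeasureSpace α]

theorem pNorm_le_iff {p : ℝ≥0∞} (hp0 : p ≠ 0) (hp : p ≠ ⊤) (f : α → ℝ) (K : Set α) (W : ℝ≥0∞) :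
    pNorm p f K ≤ W ↔ ∫⁻ x in K, ‖f x‖ₑ ^ p.toReal ≤ W ^ p.toReal := by
  rw [pNorm_of_ne_top hp, eLpNorm_eq_lintegral_rpow_enorm_toReal hp0 hp, one_div]
  exact ENNReal.rpow_inv_le_iff (ENNReal.toReal_pos hp0 hp)

theorem pNorm_le_of_bound {p : ℝ≥0∞} {f : α → ℝ} {K : Set α} (hK : MeasurableSet K)
    {C : ℝ≥0} (h : ∀ x ∈ K, |f x| ≤ C) (hp : p ≠ ⊤) :
    pNorm p f K ≤ volume K ^ p.toReal⁻¹ * C := by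
  rw [pNorm_of_ne_top hp]
  refine (eLpNorm_le_of_ae_bound (C := C)
    ((ae_restrict_iff' hK).2 (Filter.Eventually.of_forall h))).trans_eq ?_
  rw [Measure.restrict_apply_univ, ENNReal.ofReal_coe_nnreal]

/-- For functions with a common bound on a set of finite measure, smallness in one `L^p` implies
smallness in every other `L^q`. -/
theorem exists_pNorm_le_of_bounded {p q : ℝ≥0∞} (hp0 : p ≠ 0) (hp : p ≠ ⊤) (hq0 : q ≠ 0)
    (hq : q ≠ ⊤) {K : Set α} (hK : MeasurableSet K) (hvol : volume K ≠ ⊤) (M : ℝ≥0) {η : ℝ≥0}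
    (hη : 0 < η) :
    ∃ ε : ℝ≥0, 0 < ε ∧ ∀ h : α → ℝ, Measurable h → (∀ x ∈ K, |h x| ≤ M) →
      pNorm p h K ≤ ε → pNorm q h K ≤ η := by
  set a := p.toReal with ha
  set b := q.toReal with hb
  have ha0 : 0 < a := ENNReal.toReal_pos hp0 hp
  have hb0 : 0 < b := ENNReal.toReal_pos hq0 hq
  set V := (volume K).toNNReal with hV
  have hVK : (V : ℝ≥0∞) = volume K := ENNReal.coe_toNNReal hvol
  have hηb : 0 < η ^ b := NNReal.rpow_pos hη
  set τ : ℝ≥0 := (η ^ b / (2 * (V + 1))) ^ b⁻¹ with hτ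
  have hτ0 : 0 < τ := NNReal.rpow_pos (by positivity)
  have hτb : τ ^ b * V ≤ η ^ b / 2 := by
    rw [hτ, NNReal.rpow_inv_rpow hb0.ne', div_mul_eq_mul_div, div_le_div_iff₀ (by positivity)
      two_pos, mul_assoc, mul_comm (V : ℝ≥0)]
    gcongr
    exact le_self_add
  set c : ℝ≥0 := M ^ b / τ ^ a with hc
  set ε : ℝ≥0 := (η ^ b / (2 * (c + 1))) ^ a⁻¹ with hε
  have hεa : c * ε ^ a ≤ η ^ b / 2 := by
    rw [hε, NNReal.rpow_inv_rpow ha0.ne', mul_div_assoc', div_le_div_iff₀ (by positivity)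
      two_pos, mul_comm c, mul_assoc, mul_comm c]
    gcongr
    exact le_self_add
  -- small values contribute at most `τ ^ b`, and large values are controlled by the other power
  have hpt : ∀ y : ℝ≥0, y ≤ M → y ^ b ≤ τ ^ b + c * y ^ a := by
    intro y hy
    rcases le_total y τ with h | h
    · exact (NNReal.rpow_le_rpow h hb0.le).trans le_self_add
    · refine le_trans ?_ le_add_self
      have h1 : y ^ b ≤ M ^ b := NNReal.rpow_le_rpow hy hb0.le
      have h2 : τ ^ a ≤ y ^ a := NNReal.rpow_le_rpow h ha0.le
      have h3 : 0 < τ ^ a := NNReal.rpow_pos hτ0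
      rw [hc, div_mul_eq_mul_div, le_div_iff₀ h3]
      exact mul_le_mul' h1 h2
  refine ⟨ε, NNReal.rpow_pos (by positivity), fun h hm hM hpn => ?_⟩
  rw [pNorm_le_iff hp0 hp, ← ha] at hpn
  rw [pNorm_le_iff hq0 hq, ← hb]
  calc ∫⁻ x in K, ‖h x‖ₑ ^ b ≤ ∫⁻ x in K, ((τ ^ b : ℝ≥0) + c * ‖h x‖ₑ ^ a) := by
        refine setLIntegral_mono' hK fun x hx => ?_
        rw [enorm_eq_nnnorm, ← ENNReal.coe_rpow_of_nonneg _ hb0.le,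
          ← ENNReal.coe_rpow_of_nonneg _ ha0.le]
        exact_mod_cast hpt ‖h x‖₊ (by exact_mod_cast hM x hx)
    _ = (τ ^ b : ℝ≥0) * volume K + c * ∫⁻ x in K, ‖h x‖ₑ ^ a := by
        rw [lintegral_add_left measurable_const, lintegral_const, Measure.restrict_apply_univ,
          lintegral_const_mul _ (hm.enorm.pow_const _)]
    _ ≤ (τ ^ b : ℝ≥0) * V + c * (ε : ℝ≥0∞) ^ a := by rw [hVK]; gcongr
    _ = ((τ ^ b * V + c * ε ^ a : ℝ≥0) : ℝ≥0∞) := by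
        rw [← ENNReal.coe_rpow_of_nonneg _ ha0.le]; push_cast; rfl
    _ ≤ ((η ^ b : ℝ≥0) : ℝ≥0∞) := by
        rw [ENNReal.coe_le_coe]
        exact (add_le_add hτb hεa).trans_eq (add_halves _)
    _ = (η : ℝ≥0∞) ^ b := ENNReal.coe_rpow_of_nonneg _ hb0.le

end Compare

/-- The truncation of a real number to `[-M, M]`. -/
def clamp (M : ℝ≥0) (y : ℝ) : ℝ := max (-M) (min M y)

theorem abs_clamp_le (M : ℝ≥0) (y : ℝ) : |clamp M y| ≤ M :=
  abs_le.2 ⟨le_max_left _ _, max_le (neg_le_self M.2) (min_le_left _ _)⟩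

theorem measurable_clamp (M : ℝ≥0) : Measurable (clamp M) := by
  unfold clamp
  fun_prop

theorem clamp_of_abs_le {M : ℝ≥0} {y : ℝ} (h : |y| ≤ M) : clamp M y = y := by
  rw [abs_le] at h
  rw [clamp, min_eq_right h.2, max_eq_right h.1]

theorem abs_sub_clamp_le (M : ℝ≥0) (y : ℝ) : |y - clamp M y| ≤ |y| := by
  have hM : (0 : ℝ) ≤ M := M.2
  unfold clamp
  rcases le_total y M with h1 | h1
  · rw [min_eq_right h1]
    rcases le_total (-M : ℝ) y with h2 | h2
    · rw [max_eq_right h2, sub_self, abs_zero]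
      exact abs_nonneg _
    · rw [max_eq_left h2, abs_of_nonpos (by linarith), abs_of_nonpos (by linarith)]
      linarith
  · rw [min_eq_left h1, max_eq_right (by linarith), abs_of_nonneg (by linarith),
      abs_of_nonneg (by linarith)]
    linarith

variable {d r : ℕ}

/-- If `f x` exceeds the level of truncation and the values in its representation do not exceed
`M₀`, then the remainder is at least half of `f x`. -/
theorem Representation.enorm_sub_clamp_rpow_le (R : Representation d r) {a : ℝ} (ha0 : 0 < a)
    (f : (Fin d → ℝ) → ℝ) {M₀ : ℝ≥0} (hM₀ : 0 < M₀ ^ a) (x u : Fin d → ℝ) :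
    ‖f x - clamp (2 * (R.sumC * M₀)) (f x)‖ₑ ^ a ≤
      (2 : ℝ≥0∞) ^ a * ‖R.remainder f u x‖ₑ ^ a +
      ‖f x - clamp (2 * (R.sumC * M₀)) (f x)‖ₑ ^ a *
        ∑ k, ((M₀ ^ a)⁻¹ : ℝ≥0) * ‖f (x + fun i => R.a k i * u i)‖ₑ ^ a := by
  set M : ℝ≥0 := 2 * (R.sumC * M₀) with hM
  by_cases hx : |f x| ≤ M
  · rw [clamp_of_abs_le hx, sub_self, enorm_zero, ENNReal.zero_rpow_of_pos ha0]
    exact zero_le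
  · by_cases hk : ∃ k, (M₀ : ℝ) < |f (x + fun i => R.a k i * u i)|
    · obtain ⟨k, hk⟩ := hk
      refine le_add_of_le_right (le_mul_of_one_le_right' ?_)
      refine le_trans ?_ (Finset.single_le_sum (fun _ _ => zero_le) (Finset.mem_univ k))
      have h1 : M₀ ≤ ‖f (x + fun i => R.a k i * u i)‖₊ := by exact_mod_cast hk.le
      have h2 : M₀ ^ a ≤ ‖f (x + fun i => R.a k i * u i)‖₊ ^ a := NNReal.rpow_le_rpow h1 ha0.le
      rw [enorm_eq_nnnorm, ← ENNReal.coe_rpow_of_nonneg _ ha0.le, ← ENNReal.coe_mul,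
        ENNReal.one_le_coe_iff, ← div_eq_inv_mul, one_le_div hM₀]
      exact h2
    · push Not at hk hx
      refine le_add_of_le_left ?_
      rw [← ENNReal.mul_rpow_of_nonneg _ _ ha0.le]
      refine ENNReal.rpow_le_rpow ?_ ha0.le
      have h1 : |∑ k, R.c k * f (x + fun i => R.a k i * u i)| ≤ R.sumC * M₀ := by
        rw [R.coe_sumC, Finset.sum_mul]
        refine (Finset.abs_sum_le_sum_abs _ _).trans (Finset.sum_le_sum fun k _ => ?_)
        rw [abs_mul]
        exact mul_le_mul_of_nonneg_left (hk k) (abs_nonneg _)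
      have h2 : |f x - clamp M (f x)| ≤ 2 * |R.remainder f u x| := by
        have h3 := abs_sub_clamp_le M (f x)
        rw [R.remainder_eq]
        have h4 := abs_sub_abs_le_abs_sub (f x) (∑ k, R.c k * f (x + fun i => R.a k i * u i))
        have h5 : (M : ℝ) = 2 * (R.sumC * M₀) := by rw [hM]; push_cast; rfl
        linarith
      rw [enorm_eq_nnnorm, enorm_eq_nnnorm]
      exact_mod_cast h2

/-- A function with small differences differs little from its truncation at a level that depends
only on its norm: at every point, most choices of the steps express its value by values below a
fixed level, up to a difference. -/
theorem Representation.exists_pNorm_sub_clamp_le (R : Representation d r) {p : ℝ≥0∞}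
    (hp0 : p ≠ 0) (hp : p ≠ ⊤) :
    ∃ M C : ℝ≥0, ∀ (f : (Fin d → ℝ) → ℝ) (t : ℝ) (ω : ℝ≥0∞), Measurable f →
      pNorm p f (cube d (t + r)) ≤ 1 →
      (∀ (i : Fin d) (v : ℝ), 0 ≤ v → v ≤ 1 →
        pNorm p (fdiff r (Pi.single i v) f) (cube d (t + r)) ≤ ω) →
      pNorm p (fun x => f x - clamp M (f x)) (cube d t) ≤ C * ω := by
  set a := p.toReal with ha
  have ha0 : 0 < a := ENNReal.toReal_pos hp0 hp
  set n : ℝ≥0 := ((Fintype.card R.ι : ℕ) : ℝ≥0) with hn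
  -- the level exceeded by the values with probability at most `1 / 2`
  set M₀ : ℝ≥0 := (2 * (n + 1)) ^ a⁻¹ with hM₀
  have hM₀a : M₀ ^ a = 2 * (n + 1) := NNReal.rpow_inv_rpow ha0.ne' _
  set M : ℝ≥0 := 2 * (R.sumC * M₀) with hM
  refine ⟨M, (2 * 2 ^ a) ^ a⁻¹ * R.remConst p, fun f t ω hf hf1 hω => ?_⟩
  set h : (Fin d → ℝ) → ℝ := fun x => f x - clamp M (f x) with hh
  have hhm : Measurable h := hf.sub ((measurable_clamp M).comp hf)
  have hDm : Measurable fun z : (Fin d → ℝ) × (Fin d → ℝ) => ‖R.remainder f z.2 z.1‖ₑ ^ a :=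
    (R.measurable_remainder hf).enorm.pow_const a
  have hpt := R.enorm_sub_clamp_rpow_le ha0 f (M₀ := M₀) (by rw [hM₀a]; positivity)
  have hint : ∀ x ∈ cube d t, ‖h x‖ₑ ^ a ≤
      2 * (2 ^ a * ∫⁻ u in cube d 1, ‖R.remainder f u x‖ₑ ^ a) := by
    intro x hx
    have hDx : Measurable fun u : Fin d → ℝ => ‖R.remainder f u x‖ₑ ^ a :=
      Measurable.pow_const (Measurable.enorm
        ((R.measurable_remainder hf).comp measurable_prodMk_left)) a
    have hfk : ∀ k, Measurable fun u : Fin d → ℝ => ‖f (x + fun i => R.a k i * u i)‖ₑ ^ a :=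
      fun k => (measurable_comp_add_mul hf (R.a k) x).enorm.pow_const a
    have h1 : ‖h x‖ₑ ^ a ≤ 2 ^ a * (∫⁻ u in cube d 1, ‖R.remainder f u x‖ₑ ^ a) +
        ‖h x‖ₑ ^ a * ∑ k, ((M₀ ^ a)⁻¹ : ℝ≥0) *
          ∫⁻ u in cube d 1, ‖f (x + fun i => R.a k i * u i)‖ₑ ^ a := by
      calc ‖h x‖ₑ ^ a = ∫⁻ _u in cube d 1, ‖h x‖ₑ ^ a := by
            rw [lintegral_const, Measure.restrict_apply_univ, volume_cube_one, mul_one]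
        _ ≤ ∫⁻ u in cube d 1, ((2 : ℝ≥0∞) ^ a * ‖R.remainder f u x‖ₑ ^ a +
              ‖h x‖ₑ ^ a * ∑ k, ((M₀ ^ a)⁻¹ : ℝ≥0) *
                ‖f (x + fun i => R.a k i * u i)‖ₑ ^ a) := lintegral_mono fun u => hpt x u
        _ = _ := by
            rw [lintegral_add_left (hDx.const_mul _), lintegral_const_mul _ hDx,
              lintegral_const_mul _ (Finset.measurable_fun_sum _ fun k _ =>
                (hfk k).const_mul _), lintegral_finsetSum _ fun k _ => (hfk k).const_mul _]
            simp only [lintegral_const_mul _ (hfk _)]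
    have h2 : ∑ k, ((M₀ ^ a)⁻¹ : ℝ≥0) *
        ∫⁻ u in cube d 1, ‖f (x + fun i => R.a k i * u i)‖ₑ ^ a ≤ 2⁻¹ := by
      have h3 : ∀ k ∈ (Finset.univ : Finset R.ι), ((M₀ ^ a)⁻¹ : ℝ≥0) *
          ∫⁻ u in cube d 1, ‖f (x + fun i => R.a k i * u i)‖ₑ ^ a ≤ ((M₀ ^ a)⁻¹ : ℝ≥0) := by
        intro k _
        refine mul_le_of_le_one_right' ?_
        refine (lintegral_comp_add_mul_le (R.one_le_a k) (R.a_le k) hx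
          (h := fun y => ‖f y‖ₑ ^ a) (hf.enorm.pow_const a)).trans ?_
        simpa using (pNorm_le_iff hp0 hp f _ 1).1 hf1
      refine (Finset.sum_le_card_nsmul _ _ _ h3).trans ?_
      rw [nsmul_eq_mul, Finset.card_univ, hM₀a]
      have h4 : (Fintype.card R.ι : ℝ≥0∞) = (n : ℝ≥0) := by simp [hn]
      have h5 : (2⁻¹ : ℝ≥0∞) = ((2⁻¹ : ℝ≥0) : ℝ≥0∞) := by simp
      rw [h4, ← ENNReal.coe_mul, h5, ENNReal.coe_le_coe, mul_inv, mul_left_comm]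
      refine mul_le_of_le_one_right' ?_
      rw [← div_eq_mul_inv]
      exact div_le_one_of_le₀ le_self_add zero_le
    have hfin : ‖h x‖ₑ ^ a ≠ ⊤ := ENNReal.rpow_ne_top_of_nonneg ha0.le enorm_ne_top
    have h6 : ‖h x‖ₑ ^ a * 2⁻¹ + ‖h x‖ₑ ^ a * 2⁻¹ ≤
        2 ^ a * (∫⁻ u in cube d 1, ‖R.remainder f u x‖ₑ ^ a) + ‖h x‖ₑ ^ a * 2⁻¹ := by
      rw [← mul_add, ENNReal.inv_two_add_inv_two, mul_one]
      exact h1.trans (add_le_add_right (mul_le_mul_right h2 _) _)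
    have h7 := (ENNReal.add_le_add_iff_right (ENNReal.mul_ne_top hfin (by simp))).1 h6
    rw [← div_eq_mul_inv, ENNReal.div_le_iff (by simp) (by simp)] at h7
    rwa [mul_comm]
  rw [pNorm_le_iff hp0 hp, ← ha]
  calc ∫⁻ x in cube d t, ‖h x‖ₑ ^ a
      ≤ ∫⁻ x in cube d t, 2 * (2 ^ a * ∫⁻ u in cube d 1, ‖R.remainder f u x‖ₑ ^ a) :=
        setLIntegral_mono' (measurableSet_cube t) hint
    _ = 2 * (2 ^ a * ∫⁻ x in cube d t, ∫⁻ u in cube d 1, ‖R.remainder f u x‖ₑ ^ a) := by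
        have hm : Measurable fun x => ∫⁻ u in cube d 1, ‖R.remainder f u x‖ₑ ^ a :=
          Measurable.lintegral_prod_right' hDm
        rw [lintegral_const_mul _ (hm.const_mul _), lintegral_const_mul _ hm]
    _ = 2 * (2 ^ a * ∫⁻ u in cube d 1, ∫⁻ x in cube d t, ‖R.remainder f u x‖ₑ ^ a) := by
        rw [lintegral_lintegral_swap hDm.aemeasurable]
    _ ≤ 2 * (2 ^ a * ∫⁻ _u in cube d 1, (R.remConst p * ω) ^ a) := by
        gcongr 2 * (2 ^ a * ?_)
        refine setLIntegral_mono' (measurableSet_cube 1) fun u hu => ?_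
        exact (pNorm_le_iff hp0 hp _ _ _).1 (R.pNorm_remainder_le p hf hω hu)
    _ = (((2 * 2 ^ a) ^ a⁻¹ * R.remConst p : ℝ≥0) * ω) ^ a := by
        rw [lintegral_const, Measure.restrict_apply_univ, volume_cube_one, mul_one,
          ENNReal.coe_mul, ENNReal.coe_rpow_of_nonneg _ (inv_nonneg.2 ha0.le),
          mul_assoc ((2 * 2 ^ a : ℝ≥0) ^ a⁻¹ : ℝ≥0∞), ENNReal.mul_rpow_of_nonneg (_ ^ a⁻¹) _ ha0.le,
          ENNReal.rpow_inv_rpow ha0.ne', ENNReal.coe_mul, ENNReal.coe_rpow_of_nonneg _ ha0.le,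
          mul_assoc, ENNReal.coe_ofNat]

end Truncation

/-! ### The local estimate -/

section Local

variable {d r : ℕ}

theorem pNorm_fdiff_le (p : ℝ≥0∞) {g : (Fin d → ℝ) → ℝ} (hg : Measurable g) (r : ℕ) (s : ℝ)
    (i : Fin d) {v : ℝ} (hv0 : 0 ≤ v) (hv1 : v ≤ 1) :
    pNorm p (fdiff r (Pi.single i v) g) (cube d s) ≤
      (addConst p ^ (r + 1) * ∑ j ∈ Finset.range (r + 1),
        ‖(-1 : ℝ) ^ (r + j) * (r.choose j : ℝ)‖₊ : ℝ≥0) * pNorm p g (cube d (s + r)) := by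
  have h := pNorm_sum_le p (Finset.range (r + 1)) (fun j => (-1 : ℝ) ^ (r + j) * (r.choose j : ℝ))
    (f := fun j x => g (x + (j : ℝ) • (Pi.single i v : Fin d → ℝ)))
    (fun j => hg.comp (measurable_add_const _)) (cube d s) (W := pNorm p g (cube d (s + r)))
    fun j hj => pNorm_comp_add_right_le p hg (measurableSet_cube _) _ fun x hx =>
      add_mem_cube hx (smul_single_mem_cube (Finset.mem_range_succ_iff.1 hj) i hv0 hv1)
  rwa [Finset.card_range] at h

theorem cube_subset_cube {s t : ℝ} (h : s ≤ t) : cube d s ⊆ cube d t :=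
  Set.Icc_subset_Icc_right fun _ => h

theorem pNorm_add_three_le (p : ℝ≥0∞) {α : Type*} [MeasureSpace α] {f₁ f₂ f₃ : α → ℝ}
    (h₁ : Measurable f₁) (h₂ : Measurable f₂) (h₃ : Measurable f₃) {K : Set α} {τ : ℝ≥0}
    (hτ₁ : pNorm p f₁ K ≤ τ) (hτ₂ : pNorm p f₂ K ≤ τ) (hτ₃ : pNorm p f₃ K ≤ τ) :
    pNorm p (fun x => f₁ x + (f₂ x + f₃ x)) K ≤ (3 * addConst p ^ 2 * τ : ℝ≥0) := by
  have hc := one_le_addConst p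
  calc _ ≤ (addConst p : ℝ≥0∞) * (pNorm p f₁ K + pNorm p (fun x => f₂ x + f₃ x) K) :=
        pNorm_add_le p h₁ (h₂.add h₃) K
    _ ≤ (addConst p : ℝ≥0∞) * (τ + addConst p * (τ + τ)) := by
        gcongr
        exact (pNorm_add_le p h₂ h₃ K).trans (by gcongr)
    _ = ((addConst p * (τ + addConst p * (τ + τ)) : ℝ≥0) : ℝ≥0∞) := by push_cast; rfl
    _ ≤ _ := by
        rw [ENNReal.coe_le_coe]
        calc addConst p * (τ + addConst p * (τ + τ))
            = addConst p * τ + 2 * addConst p ^ 2 * τ := by ring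
          _ ≤ addConst p ^ 2 * τ + 2 * addConst p ^ 2 * τ := by
              gcongr
              exact le_self_pow₀ hc two_ne_zero
          _ = _ := by ring

theorem measurable_smooth {Λ B : ℝ≥0} {φ g : (Fin d → ℝ) → ℝ} {M : ℝ} (R : Representation d r)
    (hφ : IsKernel Λ B φ) (hg : Measurable g) (hM : ∀ x, |g x| ≤ M) :
    Measurable (R.smooth φ g) := by
  have hM0 : 0 ≤ M := (abs_nonneg _).trans (hM 0)
  refine (LipschitzWith.of_dist_le_mul (K := R.sumC * (M.toNNReal * (2 * Λ)))
    fun x y => ?_).continuous.measurable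
  rw [Real.dist_eq, dist_eq_norm]
  refine (Representation.abs_smooth_sub_le hφ hg hM x y).trans_eq ?_
  push_cast
  rw [Real.coe_toNNReal _ hM0]
  ring

/-- A function of norm at most `1` with sufficiently small differences is close to a polynomial of
degree `< r` in each variable: the case `p < ∞`. -/
theorem exists_coordPoly_of_norm_le_one_of_ne_top (d : ℕ) {r : ℕ} (hr : 1 ≤ r) {p : ℝ≥0∞}
    (hp0 : p ≠ 0) (hp : p ≠ ⊤) {θ : ℝ≥0} (hθ : 0 < θ) :
    ∃ ε : ℝ≥0, 0 < ε ∧ ∀ f : (Fin d → ℝ) → ℝ, Measurable f →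
      pNorm p f (cube d (1 + 2 * r + r)) ≤ 1 →
      (∀ (i : Fin d) (v : ℝ), 0 ≤ v → v ≤ 1 →
        pNorm p (fdiff r (Pi.single i v) f) (cube d (1 + 2 * r + r)) ≤ ε) →
      ∃ Q ∈ coordPoly d r, pNorm p (fun x => f x - Q x) (cube d 1) ≤ θ := by
  obtain ⟨R⟩ := nonempty_representation d r
  obtain ⟨Λ, B, φ, hφ⟩ := exists_isKernel d
  have hc : 0 < addConst p := one_pos.trans_le (one_le_addConst p)
  set τ : ℝ≥0 := θ / (3 * addConst p ^ 2) with hτ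
  have hτ0 : 0 < τ := by positivity
  have hτθ : 3 * addConst p ^ 2 * τ = θ := mul_div_cancel₀ _ (by positivity)
  obtain ⟨M, C, hMC⟩ := R.exists_pNorm_sub_clamp_le hp0 hp
  obtain ⟨ε₁, hε₁, hcore⟩ := R.exists_coordPoly_near_smooth hr hφ M (θ := τ) (by exact_mod_cast hτ0)
  obtain ⟨ε₂, hε₂, hsm⟩ := exists_pNorm_le_of_bounded one_ne_zero one_ne_top hp0 hp
    (measurableSet_cube (d := d) 1) (volume_cube_ne_top 1) (M + R.sumC * M) hτ0
  -- the required bound for the differences of the truncation in `L¹`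
  set ω₁ : ℝ≥0 := min ε₁ (ε₂ / (R.remConst 1 + 1)) with hω₁
  have hω₁0 : 0 < ω₁ := lt_min hε₁ (by positivity)
  have hω₁ε₂ : R.remConst 1 * ω₁ ≤ ε₂ := by
    calc R.remConst 1 * ω₁ ≤ (R.remConst 1 + 1) * (ε₂ / (R.remConst 1 + 1)) := by
          gcongr
          · exact le_self_add
          · exact min_le_right _ _
      _ = ε₂ := mul_div_cancel₀ _ (by positivity)
  obtain ⟨ε₃, hε₃, hdf⟩ := exists_pNorm_le_of_bounded hp0 hp one_ne_zero one_ne_top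
    (measurableSet_cube (d := d) (1 + r)) (volume_cube_ne_top _) (2 ^ r * M) hω₁0
  set K : ℝ≥0 := addConst p ^ (r + 1) * ∑ j ∈ Finset.range (r + 1),
        ‖(-1 : ℝ) ^ (r + j) * (r.choose j : ℝ)‖₊ with hK
  set ε : ℝ≥0 := min (ε₃ / (addConst p * (1 + K * C))) (τ / (C + 1)) with hε
  have hε0 : 0 < ε := lt_min (by positivity) (by positivity)
  have hεε₃ : addConst p * (ε + K * (C * ε)) ≤ ε₃ := by
    calc addConst p * (ε + K * (C * ε)) = (addConst p * (1 + K * C)) * ε := by ring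
      _ ≤ (addConst p * (1 + K * C)) * (ε₃ / (addConst p * (1 + K * C))) := by
          gcongr
          exact min_le_left _ _
      _ = ε₃ := mul_div_cancel₀ _ (by positivity)
  have hεC : C * ε ≤ τ := by
    calc C * ε ≤ (C + 1) * (τ / (C + 1)) := by
          gcongr
          · exact le_self_add
          · exact min_le_right _ _
      _ = τ := mul_div_cancel₀ _ (by positivity)
  refine ⟨ε, hε0, fun f hf hf1 hfω => ?_⟩
  have htr := hMC f (1 + 2 * r) ε hf hf1 hfω
  set g : (Fin d → ℝ) → ℝ := fun x => clamp M (f x) with hg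
  have hgm : Measurable g := (measurable_clamp M).comp hf
  have hgM : ∀ x, |g x| ≤ M := fun x => abs_clamp_le M _
  have hfgm : Measurable fun x => f x - g x := hf.sub hgm
  have hr0 : (0 : ℝ) ≤ r := Nat.cast_nonneg r
  have hgΔ : ∀ (i : Fin d) (v : ℝ), 0 ≤ v → v ≤ 1 →
      pNorm 1 (fdiff r (Pi.single i v) g) (cube d (1 + r)) ≤ ω₁ := by
    intro i v hv0 hv1
    refine hdf _ (measurable_fdiff r _ hgm) (fun x _ => ?_) ?_
    · have := abs_fdiff_le r (Pi.single i v) (f := g) (x := x) (M := M) fun j _ => hgM _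
      exact_mod_cast this
    · have e : fdiff r (Pi.single i v) g = fun x => fdiff r (Pi.single i v) f x +
          (-1) * fdiff r (Pi.single i v) (fun y => f y - g y) x := by
        ext x
        rw [fdiff_sub]
        ring
      rw [e]
      refine (pNorm_add_le p (measurable_fdiff r _ hf)
        ((measurable_fdiff r _ hfgm).const_mul _) _).trans ?_
      rw [pNorm_const_mul, enorm_neg, enorm_one, one_mul]
      refine le_trans ?_ (ENNReal.coe_le_coe.2 hεε₃)
      push_cast
      gcongr
      · exact (pNorm_mono_set _ (cube_subset_cube (by linarith))).trans (hfω i v hv0 hv1)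
      · refine (pNorm_fdiff_le p hfgm r (1 + r) i hv0 hv1).trans ?_
        rw [← hK]
        gcongr
        have e2 : (1 : ℝ) + r + r = 1 + 2 * r := by ring
        rw [e2]
        exact htr
  obtain ⟨Q, hQ, hQS⟩ := hcore g hgm hgM fun i v hv0 hv1 =>
    (hgΔ i v hv0 hv1).trans (ENNReal.coe_le_coe.2 (min_le_left _ _))
  have hSm := measurable_smooth R hφ hgm hgM
  refine ⟨Q, hQ, ?_⟩
  have e : (fun x => f x - Q x) = fun x => (f x - g x) +
      ((g x - R.smooth φ g x) + (R.smooth φ g x - Q x)) := by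
    ext x; ring
  rw [e, ← hτθ]
  refine pNorm_add_three_le p hfgm (hgm.sub hSm) (hSm.sub hQ.1.measurable) ?_ ?_ ?_
  · refine (pNorm_mono_set _ (cube_subset_cube (by linarith))).trans (htr.trans ?_)
    exact_mod_cast hεC
  · refine hsm _ (hgm.sub hSm) (fun x _ => ?_) ?_
    · refine (abs_sub _ _).trans ?_
      exact_mod_cast add_le_add (hgM x) (Representation.abs_smooth_le hφ hgM x)
    · refine (Representation.pNorm_one_sub_smooth_le hφ hgm hgM hgΔ).trans ?_
      exact_mod_cast hω₁ε₂
  · refine (pNorm_le_of_bound (measurableSet_cube 1) hQS hp).trans ?_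
    rw [volume_cube_one, ENNReal.one_rpow, one_mul]

/-- A function of norm at most `1` with sufficiently small differences is close to a polynomial of
degree `< r` in each variable: the case `p = ∞`. -/
theorem exists_coordPoly_of_norm_le_one_top (d : ℕ) {r : ℕ} (hr : 1 ≤ r) {θ : ℝ≥0}
    (hθ : 0 < θ) :
    ∃ ε : ℝ≥0, 0 < ε ∧ ∀ f : (Fin d → ℝ) → ℝ, Measurable f →
      pNorm ⊤ f (cube d (1 + 2 * r + r)) ≤ 1 →
      (∀ (i : Fin d) (v : ℝ), 0 ≤ v → v ≤ 1 →
        pNorm ⊤ (fdiff r (Pi.single i v) f) (cube d (1 + 2 * r + r)) ≤ ε) →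
      ∃ Q ∈ coordPoly d r, pNorm ⊤ (fun x => f x - Q x) (cube d 1) ≤ θ := by
  obtain ⟨R⟩ := nonempty_representation d r
  obtain ⟨Λ, B, φ, hφ⟩ := exists_isKernel d
  obtain ⟨ε₁, hε₁, hcore⟩ := R.exists_coordPoly_near_smooth hr hφ 1 (θ := (θ / 2 : ℝ≥0))
    (by exact_mod_cast half_pos hθ)
  set V : ℝ≥0 := (volume (cube d (1 + r))).toNNReal with hV
  have hVK : (V : ℝ≥0∞) = volume (cube d (1 + r)) :=
    ENNReal.coe_toNNReal (volume_cube_ne_top _)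
  set ε : ℝ≥0 := min (ε₁ / (V + 1)) (θ / 2 / (R.remConst ⊤ + 1)) with hε
  have hεV : V * ε ≤ ε₁ := by
    calc V * ε ≤ (V + 1) * (ε₁ / (V + 1)) := by
          gcongr
          · exact le_self_add
          · exact min_le_left _ _
      _ = ε₁ := mul_div_cancel₀ _ (by positivity)
  have hεR : R.remConst ⊤ * ε ≤ θ / 2 := by
    calc R.remConst ⊤ * ε ≤ (R.remConst ⊤ + 1) * (θ / 2 / (R.remConst ⊤ + 1)) := by
          gcongr
          · exact le_self_add
          · exact min_le_right _ _
      _ = θ / 2 := mul_div_cancel₀ _ (by positivity)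
  refine ⟨ε, lt_min (by positivity) (by positivity), fun f hf hf1 hfω => ?_⟩
  have hr0 : (0 : ℝ) ≤ r := Nat.cast_nonneg r
  set N : Set (Fin d → ℝ) := cube d (1 + 2 * r + r) with hN
  set g : (Fin d → ℝ) → ℝ := N.indicator f with hg
  have hgm : Measurable g := hf.indicator (measurableSet_cube _)
  have hgM : ∀ x, |g x| ≤ (1 : ℝ≥0) := fun x => by
    by_cases hx : x ∈ N
    · rw [hg, Set.indicator_of_mem hx]
      exact pNorm_top_le_iff.1 hf1 x hx
    · rw [hg, Set.indicator_of_notMem hx]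
      simp
  have hgΔ : ∀ (i : Fin d) (v : ℝ), 0 ≤ v → v ≤ 1 →
      pNorm ⊤ (fdiff r (Pi.single i v) g) (cube d (1 + r)) ≤ ε := by
    intro i v hv0 hv1
    refine le_trans (le_of_eq ?_) ((pNorm_mono_set _
      (cube_subset_cube (by linarith : (1 + r : ℝ) ≤ 1 + 2 * r + r))).trans (hfω i v hv0 hv1))
    refine pNorm_congr (measurableSet_cube _) fun x hx => Finset.sum_congr rfl fun j hj => ?_
    have hmem : x + (j : ℝ) • (Pi.single i v : Fin d → ℝ) ∈ N :=
      cube_subset_cube (by linarith) (add_mem_cube hx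
        (smul_single_mem_cube (Finset.mem_range_succ_iff.1 hj) i hv0 hv1))
    rw [hg, Set.indicator_of_mem hmem]
  have hgΔ₁ : ∀ (i : Fin d) (v : ℝ), 0 ≤ v → v ≤ 1 →
      pNorm 1 (fdiff r (Pi.single i v) g) (cube d (1 + r)) ≤ ε₁ := by
    intro i v hv0 hv1
    refine (pNorm_le_of_bound (measurableSet_cube _) (pNorm_top_le_iff.1 (hgΔ i v hv0 hv1))
      one_ne_top).trans ?_
    rw [ENNReal.toReal_one, inv_one, ENNReal.rpow_one, ← hVK, ← ENNReal.coe_mul]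
    exact ENNReal.coe_le_coe.2 hεV
  obtain ⟨Q, hQ, hQS⟩ := hcore g hgm hgM hgΔ₁
  refine ⟨Q, hQ, pNorm_top_le_iff.2 fun x hx => ?_⟩
  have h1 := pNorm_top_le_iff.1 ((Representation.pNorm_top_sub_smooth_le (R := R) hφ hgm hgM
    hgΔ).trans (ENNReal.coe_le_coe.2 hεR)) x hx
  have hgx : g x = f x := Set.indicator_of_mem (cube_subset_cube (by linarith) hx) f
  have e : f x - Q x = (g x - R.smooth φ g x) + (R.smooth φ g x - Q x) := by rw [hgx]; ring
  rw [e]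
  refine (abs_add_le _ _).trans ((add_le_add h1 (hQS x hx)).trans_eq ?_)
  rw [← NNReal.coe_add, add_halves]

/-- A function on a cube is close to a polynomial of degree `< r` in each variable on a smaller
cube, up to an arbitrarily small multiple of its norm and a multiple of its differences. -/
theorem exists_coordPoly_local (d : ℕ) {r : ℕ} (hr : 1 ≤ r) {p : ℝ≥0∞} (hp0 : p ≠ 0)
    {θ : ℝ≥0} (hθ : 0 < θ) :
    ∃ C : ℝ≥0, ∀ (f : (Fin d → ℝ) → ℝ) (ω : ℝ≥0∞), Measurable f →
      (∀ (i : Fin d) (v : ℝ), 0 ≤ v → v ≤ 1 →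
        pNorm p (fdiff r (Pi.single i v) f) (cube d (1 + 2 * r + r)) ≤ ω) →
      ∃ Q ∈ coordPoly d r, pNorm p (fun x => f x - Q x) (cube d 1) ≤
        θ * pNorm p f (cube d (1 + 2 * r + r)) + C * ω := by
  obtain ⟨ε, hε, h⟩ : ∃ ε : ℝ≥0, 0 < ε ∧ ∀ f : (Fin d → ℝ) → ℝ, Measurable f →
      pNorm p f (cube d (1 + 2 * r + r)) ≤ 1 →
      (∀ (i : Fin d) (v : ℝ), 0 ≤ v → v ≤ 1 →
        pNorm p (fdiff r (Pi.single i v) f) (cube d (1 + 2 * r + r)) ≤ ε) →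
      ∃ Q ∈ coordPoly d r, pNorm p (fun x => f x - Q x) (cube d 1) ≤ θ := by
    rcases eq_or_ne p ⊤ with rfl | hp
    · exact exists_coordPoly_of_norm_le_one_top d hr hθ
    · exact exists_coordPoly_of_norm_le_one_of_ne_top d hr hp0 hp hθ
  refine ⟨ε⁻¹, fun f ω hf hω => ?_⟩
  set W := pNorm p f (cube d (1 + 2 * r + r)) with hW
  have hr0 : (0 : ℝ) ≤ r := Nat.cast_nonneg r
  have hsub : pNorm p f (cube d 1) ≤ W := pNorm_mono_set f (cube_subset_cube (by linarith))
  have hzero : (fun x => f x - (fun _ => (0 : ℝ)) x) = f := by ext x; simp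
  by_cases hsmall : W ≤ (ε⁻¹ : ℝ≥0) * ω
  · refine ⟨fun _ => 0, zero_mem_coordPoly d r, ?_⟩
    rw [hzero]
    exact (hsub.trans hsmall).trans le_add_self
  rw [not_le] at hsmall
  have hW0 : W ≠ 0 := (zero_le.trans_lt hsmall).ne'
  rcases eq_or_ne W ⊤ with hWt | hWt
  · refine ⟨fun _ => 0, zero_mem_coordPoly d r, ?_⟩
    rw [hWt, ENNReal.mul_top (by exact_mod_cast hθ.ne'), top_add]
    exact le_top
  set w : ℝ := W.toReal with hw
  have hw0 : 0 < w := ENNReal.toReal_pos hW0 hWt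
  have hwe : ‖w‖ₑ = W := by
    rw [Real.enorm_eq_ofReal hw0.le, hw, ENNReal.ofReal_toReal hWt]
  have hwe' : ‖w⁻¹‖ₑ = W⁻¹ := by rw [enorm_inv hw0.ne', hwe]
  obtain ⟨Q, hQ, hQθ⟩ := h (fun x => w⁻¹ * f x) (hf.const_mul _) (by
      rw [pNorm_const_mul, hwe', ← hW, ENNReal.inv_mul_cancel hW0 hWt]) fun i v hv0 hv1 => by
      have e : fdiff r (Pi.single i v) (fun x => w⁻¹ * f x) =
          fun x => w⁻¹ * fdiff r (Pi.single i v) f x := funext fun x => fdiff_const_mul _ _ _ _ _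
      rw [e, pNorm_const_mul, hwe', mul_comm, ← div_eq_mul_inv, ENNReal.div_le_iff hW0 hWt]
      refine (hω i v hv0 hv1).trans ?_
      have h1 := hsmall.le
      rw [ENNReal.coe_inv hε.ne', mul_comm, ← div_eq_mul_inv,
        ENNReal.div_le_iff (by exact_mod_cast hε.ne') ENNReal.coe_ne_top] at h1
      rwa [mul_comm]
  refine ⟨fun x => w * Q x, const_mul_mem_coordPoly w hQ, ?_⟩
  have e : (fun x => f x - w * Q x) = fun x => w * (w⁻¹ * f x - Q x) := by
    ext x
    rw [mul_sub, mul_inv_cancel_left₀ hw0.ne']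
  rw [e, pNorm_const_mul, hwe, mul_comm]
  exact (mul_le_mul_left hQθ _).trans le_self_add

end Local

/-! ### From the cube to a ball -/

section Transfer

variable {d : ℕ}

/-- An affine change of variables multiplies all `L^p` norms by the same positive constant. -/
theorem exists_pNorm_comp_eq {V : Type*} [NormedAddCommGroup V] [InnerProductSpace ℝ V]
    [FiniteDimensional ℝ V] [MeasurableSpace V] [BorelSpace V]
    (L : (Fin d → ℝ) ≃L[ℝ] V) (c : V) (p : ℝ≥0∞) :
    ∃ κ : ℝ≥0∞, κ ≠ 0 ∧ κ ≠ ⊤ ∧ ∀ (f : V → ℝ) (K : Set V), Measurable f → MeasurableSet K →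
      pNorm p (fun t => f (c + L t)) {t | c + L t ∈ K} = κ * pNorm p f K := by
  rcases eq_or_ne p ⊤ with rfl | hp
  · refine ⟨1, one_ne_zero, one_ne_top, fun f K _ _ => ?_⟩
    rw [one_mul, pNorm_top, pNorm_top]
    refine le_antisymm (iSup₂_le fun t ht => ?_) (iSup₂_le fun x hx => ?_)
    · exact le_iSup₂ (f := fun x (_ : x ∈ K) => ‖f x‖ₑ) (c + L t) ht
    · have e : c + L (L.symm (x - c)) = x := by simp
      have := le_iSup₂ (f := fun t (_ : t ∈ {t | c + L t ∈ K}) => ‖f (c + L t)‖ₑ)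
        (L.symm (x - c)) (by rw [Set.mem_ofPred_eq, e]; exact hx)
      rwa [e] at this
  · have hL : (Measure.map L (volume : Measure (Fin d → ℝ))).IsAddHaarMeasure :=
      L.isAddHaarMeasure_map volume
    obtain ⟨κ₀, hκ0, hκt, hκ⟩ : ∃ κ₀ : ℝ≥0∞, κ₀ ≠ 0 ∧ κ₀ ≠ ⊤ ∧
        Measure.map L (volume : Measure (Fin d → ℝ)) = κ₀ • (volume : Measure V) :=
      ⟨_, ENNReal.coe_ne_zero.2 (Measure.addHaarScalarFactor_pos_of_isAddHaarMeasure _ _).ne',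
        ENNReal.coe_ne_top, Measure.isAddLeftInvariant_eq_smul _ _⟩
    have hTm : Measurable fun t : Fin d → ℝ => c + L t :=
      (L.continuous.measurable).const_add c
    have hmap : Measure.map (fun t : Fin d → ℝ => c + L t) volume = κ₀ • (volume : Measure V) := by
      rw [← hκ]
      exact (Measure.map_map (measurable_const_add c) L.continuous.measurable).symm.trans
        (map_add_left_eq_self _ c)
    refine ⟨κ₀ ^ (1 / p).toReal, ?_, ?_, fun f K hf hK => ?_⟩
    · exact (ENNReal.rpow_pos (pos_iff_ne_zero.2 hκ0) hκt).ne'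
    · exact ENNReal.rpow_ne_top_of_nonneg ENNReal.toReal_nonneg hκt
    · rw [pNorm_of_ne_top hp, pNorm_of_ne_top hp]
      have h1 : Measure.map (fun t : Fin d → ℝ => c + L t)
          (volume.restrict ((fun t : Fin d → ℝ => c + L t) ⁻¹' K)) =
          κ₀ • (volume : Measure V).restrict K := by
        rw [← Measure.restrict_map hTm hK, hmap, Measure.restrict_smul]
      have h2 := eLpNorm_map_measure (p := p) (μ := volume.restrict
        ((fun t : Fin d → ℝ => c + L t) ⁻¹' K)) hf.aestronglyMeasurable hTm.aemeasurable
      rw [h1, eLpNorm_smul_measure_of_ne_zero hκ0, smul_eq_mul] at h2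
      exact h2.symm

theorem comp_linear_mem_degreeLT {r : ℕ} {P : Polynomial ℝ} (hP : P ∈ Polynomial.degreeLT ℝ r)
    (a b : ℝ) : P.comp (Polynomial.C a * Polynomial.X + Polynomial.C b) ∈
      Polynomial.degreeLT ℝ r := by
  rcases eq_or_ne P 0 with rfl | h0
  · simp
  rw [Polynomial.mem_degreeLT] at hP ⊢
  have h1 := (Polynomial.natDegree_lt_iff_degree_lt h0).2 hP
  refine (Polynomial.degree_le_natDegree).trans_lt ?_
  rw [Nat.cast_lt]
  refine Polynomial.natDegree_comp_le.trans_lt ?_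
  have h2 : (Polynomial.C a * Polynomial.X + Polynomial.C b).natDegree ≤ 1 :=
    Polynomial.natDegree_linear_le
  nlinarith

variable {ε δ : ℝ} {E G : Set (EuclideanSpace ℝ (Fin d))}

theorem IsSetting.exists_basis (hs : IsSetting ε δ E G) (hE : LinearIndepOn ℝ id E) :
    ∃ b : Module.Basis (Fin d) ℝ (EuclideanSpace ℝ (Fin d)), Set.range b = E := by
  have hfin : E.Finite := Set.finite_of_ncard_pos (by rw [hs.ncard_eq]; exact hs.one_le)
  have hcard : Nat.card E = d := hs.ncard_eq
  have : Finite E := hfin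
  let e : Fin d ≃ E := ((Finite.equivFin E).trans (finCongr hcard)).symm
  have hli : LinearIndependent ℝ fun i => (e i : EuclideanSpace ℝ (Fin d)) :=
    LinearIndependent.comp hE e e.injective
  have : Nonempty (Fin d) := ⟨⟨0, hs.one_le⟩⟩
  refine ⟨basisOfLinearIndependentOfCardEqFinrank hli (by simp), ?_⟩
  rw [coe_basisOfLinearIndependentOfCardEqFinrank]
  ext x
  constructor
  · rintro ⟨i, rfl⟩
    exact (e i).2
  · intro hx
    exact ⟨e.symm ⟨x, hx⟩, by simp⟩

/-- The coordinates with respect to the directions are bounded: a vector dual to one of them is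
orthogonal to the others, and has a large inner product with one of the directions. -/
theorem IsSetting.abs_repr_le (hs : IsSetting ε δ E G) (hε : 0 < ε)
    {b : Module.Basis (Fin d) ℝ (EuclideanSpace ℝ (Fin d))} (hb : Set.range b = E)
    (z : EuclideanSpace ℝ (Fin d)) (i : Fin d) : |b.repr z i| ≤ ‖z‖ / ε := by
  let ℓ : EuclideanSpace ℝ (Fin d) →L[ℝ] ℝ := LinearMap.toContinuousLinearMap (b.coord i)
  set w := (InnerProductSpace.toDual ℝ (EuclideanSpace ℝ (Fin d))).symm ℓ with hw
  have hwz : ∀ z, inner ℝ w z = b.repr z i := fun z => InnerProductSpace.toDual_symm_apply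
  obtain ⟨ξ, hξ, σ, hσ, h⟩ := hs.exists_inner w
  obtain ⟨j, rfl⟩ := hb.symm ▸ hξ
  have hle : |(inner ℝ (b j) w : ℝ)| ≤ 1 := by
    rw [real_inner_comm, hwz, Module.Basis.repr_self, Finsupp.single_apply]
    split_ifs <;> simp
  have hεw : ε * ‖w‖ ≤ 1 := by
    rw [abs_le] at hle
    rcases hσ with rfl | rfl <;> linarith
  rw [← hwz, le_div_iff₀ hε]
  have h1 := abs_real_inner_le_norm w z
  nlinarith [norm_nonneg z, norm_nonneg w]

theorem fdiff_comp_affine {V W : Type*} [AddCommGroup V] [Module ℝ V] [AddCommGroup W]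
    [Module ℝ W] (r : ℕ) (L : V →ₗ[ℝ] W) (c : W) (f : W → ℝ) (h x : V) :
    fdiff r h (fun t => f (c + L t)) x = fdiff r (L h) f (c + L x) := by
  refine Finset.sum_congr rfl fun j _ => ?_
  simp only [map_add, map_smul, add_assoc]

/-- In every ball of radius `δ` contained in `G` there is a ball of comparable radius on which every
function is close to an element of the polynomial space, up to an arbitrarily small multiple of its
norm. -/
theorem exists_polySpace_local (hd : 1 ≤ d) {r : ℕ} (hr : 1 ≤ r) {p : ℝ≥0∞} (hp0 : p ≠ 0)
    {ε : ℝ} (hε : 0 < ε) (hε1 : ε ≤ 1) {θ : ℝ≥0} (hθ : 0 < θ) :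
    ∃ C : ℝ≥0, ∀ (E G : Set (EuclideanSpace ℝ (Fin d))) (δ : ℝ), IsSetting ε δ E G →
      LinearIndepOn ℝ id E → ∀ c₀, closedBall c₀ δ ⊆ G →
      ∃ c₁, dist c₁ c₀ ≤ (1 - ε / (2 * (d * (1 + 4 * r)))) * δ ∧
        ∀ f : EuclideanSpace ℝ (Fin d) → ℝ, Measurable f → ∃ Q ∈ polySpace r E,
          normL p (fun x => f x - Q x) (closedBall c₁ (ε / (2 * (d * (1 + 4 * r))) * δ)) ≤
            θ * normL p f G + C * modulus r p f G E := by
  obtain ⟨C, hC⟩ := exists_coordPoly_local d hr hp0 hθ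
  refine ⟨C, fun E G δ hs hE c₀ hc₀ => ?_⟩
  obtain ⟨b, hb⟩ := hs.exists_basis hE
  have hδ := hs.delta_pos
  have hd0 : (1 : ℝ) ≤ d := by exact_mod_cast hd
  have hr0 : (1 : ℝ) ≤ r := by exact_mod_cast hr
  have hbE : ∀ i, b i ∈ E := fun i => hb ▸ Set.mem_range_self i
  set N : ℝ := 1 + 4 * r with hN
  have hN5 : 5 ≤ N := by rw [hN]; linarith
  -- the side length for which the parallelepiped of all differences fits into the ball
  set η : ℝ := δ / (d * N) with hη
  have hη0 : 0 < η := by positivity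
  have hηδ : η * (d * N) = δ := div_mul_cancel₀ _ (by positivity)
  let L : (Fin d → ℝ) ≃L[ℝ] EuclideanSpace ℝ (Fin d) :=
    (b.equivFun.symm.trans (LinearEquiv.smulOfNeZero ℝ _ η hη0.ne')).toContinuousLinearEquiv
  have hL : ∀ t, L t = η • ∑ i, t i • b i := fun t => by
    simp [L, Module.Basis.equivFun_symm_apply, Finset.smul_sum, smul_comm η]
  have hLsymm : ∀ y i, L.symm y i = η⁻¹ * b.repr y i := fun y i => by
    obtain ⟨t, rfl⟩ := L.surjective y
    rw [ContinuousLinearEquiv.symm_apply_apply, hL, map_smul, Finsupp.smul_apply, smul_eq_mul,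
      Module.Basis.repr_sum_self, inv_mul_cancel_left₀ hη0.ne']
  have hLsingle : ∀ i v, L (Pi.single i v) = (v * η) • b i := fun i v => by
    rw [hL, Finset.sum_eq_single i (fun j _ hj => by simp [hj]) (by simp), Pi.single_eq_same,
      smul_smul, mul_comm]
  have hLnorm : ∀ s : ℝ, ∀ t ∈ cube d s, ‖L t‖ ≤ η * (d * s) := fun s t ht => by
    rw [hL, norm_smul, Real.norm_of_nonneg hη0.le]
    refine mul_le_mul_of_nonneg_left ((norm_sum_le _ _).trans ?_) hη0.le
    refine (Finset.sum_le_card_nsmul _ _ s fun i _ => ?_).trans_eq (by simp)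
    rw [norm_smul, hs.norm_eq _ (hbE i), mul_one, Real.norm_of_nonneg (ht.1 i)]
    exact ht.2 i
  have hcubeG : ∀ t ∈ cube d N, c₀ + L t ∈ G := fun t ht => hc₀ (by
    rw [mem_closedBall_iff_norm, add_sub_cancel_left, ← hηδ]
    exact hLnorm N t ht)
  have hLsc : ∀ t, L.symm (c₀ + L t - c₀) = t := fun t => by
    rw [add_sub_cancel_left, ContinuousLinearEquiv.symm_apply_apply]
  let Pset : ℝ → Set (EuclideanSpace ℝ (Fin d)) := fun s => {y | L.symm (y - c₀) ∈ cube d s}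
  have hPpre : ∀ s, {t | c₀ + L t ∈ Pset s} = cube d s := fun s => by
    ext t
    simp only [Pset, Set.mem_ofPred_eq, hLsc]
  have hPm : ∀ s, MeasurableSet (Pset s) := fun s => (measurableSet_cube s).preimage
    (L.symm.continuous.comp (continuous_id.sub continuous_const)).measurable
  have hPL : ∀ s, ∀ y ∈ Pset s, ∃ t ∈ cube d s, y = c₀ + L t := fun s y hy =>
    ⟨L.symm (y - c₀), hy, by rw [ContinuousLinearEquiv.apply_symm_apply, add_sub_cancel]⟩
  have hPG : Pset (1 + 2 * r + r) ⊆ G := fun y hy => by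
    obtain ⟨t, ht, rfl⟩ := hPL _ y hy
    exact hcubeG t (cube_subset_cube (by linarith) ht)
  obtain ⟨κ, hκ0, hκt, hκ⟩ := exists_pNorm_comp_eq L c₀ p
  have hκ' : ∀ (f : EuclideanSpace ℝ (Fin d) → ℝ) (s : ℝ), Measurable f →
      pNorm p (fun t => f (c₀ + L t)) (cube d s) = κ * pNorm p f (Pset s) := fun f s hf => by
    rw [← hκ f (Pset s) hf (hPm s), hPpre]
  set τ : ℝ := ε / (2 * (d * N)) with hτ
  have hτδ : τ * δ = η * ε / 2 := by
    rw [hτ, hη]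
    field_simp
  set half : Fin d → ℝ := fun _ => 1 / 2 with hhalf
  refine ⟨c₀ + L half, ?_, fun f hf => ?_⟩
  · rw [dist_eq_norm, add_sub_cancel_left]
    have h1 : half ∈ cube d (1 / 2) := ⟨fun _ => by norm_num [hhalf], fun _ => le_rfl⟩
    refine (hLnorm _ _ h1).trans ?_
    have h2 : 1 * 5 ≤ d * N := mul_le_mul hd0 hN5 (by norm_num) (by linarith)
    have h3 : η * (5 / 2) ≤ δ / 2 := by nlinarith
    have h4 : η * (d * (1 / 2)) ≤ δ / 2 - η := by
      have : (d : ℝ) * 5 ≤ d * N := by gcongr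
      nlinarith
    have h5 : η * ε / 2 ≤ η := by nlinarith
    rw [sub_mul, one_mul, hτδ]
    linarith
  · have hω : ∀ (i : Fin d) (v : ℝ), 0 ≤ v → v ≤ 1 →
        pNorm p (fdiff r (Pi.single i v) fun t => f (c₀ + L t)) (cube d (1 + 2 * r + r)) ≤
          κ * modulus r p f G E := by
      intro i v hv0 hv1
      have e : (fdiff r (Pi.single i v) fun t => f (c₀ + L t)) =
          fun t => finDiff r ((v * η) • b i) f (c₀ + L t) := by
        ext t
        rw [finDiff_eq_fdiff, ← hLsingle]
        exact fdiff_comp_affine r L.toLinearEquiv.toLinearMap c₀ f _ t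
      rw [e, hκ' (finDiff r ((v * η) • b i) f) _ (measurable_fdiff r _ hf)]
      refine mul_le_mul_right (le_trans (pNorm_mono_set _ fun y hy j hj => ?_)
        (normL_finDiff_le_modulus r p f (hbE i) (u := v * η) ?_)) _
      · obtain ⟨t, ht, rfl⟩ := hPL _ y hy
        rw [← hLsingle, add_assoc, ← map_smul, ← map_add]
        have e2 : N = 1 + 2 * r + r + r := by rw [hN]; ring
        refine hcubeG _ ?_
        rw [e2]
        exact add_mem_cube ht (smul_single_mem_cube hj i hv0 hv1)
      · rw [abs_of_nonneg (by positivity)]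
        refine le_trans ?_ hs.delta_le
        have : 1 ≤ d * N := by nlinarith
        calc v * η ≤ 1 * η := by gcongr
          _ ≤ η * (d * N) := by nlinarith
          _ = δ := hηδ
    obtain ⟨Q, hQ, hQf⟩ := hC (fun t => f (c₀ + L t)) (κ * modulus r p f G E)
      (hf.comp (L.continuous.measurable.const_add c₀)) hω
    have hQc : Continuous fun y => Q (L.symm (y - c₀)) :=
      hQ.1.comp (L.symm.continuous.comp (continuous_id.sub continuous_const))
    refine ⟨fun y => Q (L.symm (y - c₀)), ⟨hQc, fun x ξ hξ => ?_⟩, ?_⟩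
    · obtain ⟨i, rfl⟩ := hb.symm ▸ hξ
      obtain ⟨P, hP, hPQ⟩ := hQ.2 i (L.symm (x - c₀))
      refine ⟨_, Polynomial.mem_degreeLT.1 (comp_linear_mem_degreeLT hP η⁻¹
        (L.symm (x - c₀) i)), fun t => ?_⟩
      rw [Polynomial.eval_comp, ← hPQ _ (Set.mem_univ _)]
      refine congrArg Q (funext fun k => ?_)
      rw [add_sub_right_comm, map_add, Pi.add_apply, hLsymm (t • b i), map_smul,
        Finsupp.smul_apply, Module.Basis.repr_self, smul_eq_mul]
      rcases eq_or_ne k i with rfl | hk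
      · simpa using add_comm _ _
      · simp [hk]
    · have e1 : (fun t => f (c₀ + L t) - Q t) =
          fun t => (fun y => f y - Q (L.symm (y - c₀))) (c₀ + L t) := by
        ext t
        simp only [hLsc]
      rw [e1, hκ' (fun y => f y - Q (L.symm (y - c₀))) _ (hf.sub hQc.measurable), hκ' f _ hf] at hQf
      have h1 : κ * pNorm p (fun y => f y - Q (L.symm (y - c₀))) (Pset 1) ≤
          κ * (θ * pNorm p f (Pset (1 + 2 * r + r)) + C * modulus r p f G E) := by
        refine hQf.trans_eq ?_
        ring
      have h2 := (ENNReal.mul_le_mul_iff_right hκ0 hκt).1 h1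
      refine (pNorm_mono_set _ fun y hy => ?_).trans (h2.trans ?_)
      · rw [mem_closedBall_iff_norm, hτδ] at hy
        have e2 : ∀ i, L.symm (y - c₀) i = 1 / 2 + L.symm (y - (c₀ + L half)) i := fun i => by
          have : y - c₀ = L half + (y - (c₀ + L half)) := by abel
          rw [this, map_add, ContinuousLinearEquiv.symm_apply_apply, Pi.add_apply]
        have h3 : ∀ i, |L.symm (y - (c₀ + L half)) i| ≤ 1 / 2 := fun i => by
          rw [hLsymm, abs_mul, abs_of_pos (inv_pos.2 hη0), inv_mul_le_iff₀ hη0]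
          refine (hs.abs_repr_le hε hb _ i).trans ?_
          rw [div_le_iff₀ hε]
          linarith
        refine ⟨fun i => ?_, fun i => ?_⟩
        · rw [e2, Pi.zero_apply]
          linarith [(abs_le.1 (h3 i)).1]
        · rw [e2]
          linarith [(abs_le.1 (h3 i)).2]
      · gcongr
        exact pNorm_mono_set f hPG

end Transfer

/-! ### The Whitney constant -/

section Whitney

variable {d r : ℕ} {p : ℝ≥0∞} {E G : Set (EuclideanSpace ℝ (Fin d))}

theorem zero_mem_polySpace (r : ℕ) (E : Set (EuclideanSpace ℝ (Fin d))) :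
    (fun _ => 0) ∈ polySpace r E :=
  ⟨continuous_const, fun _ _ _ => ⟨0, by simp, by simp⟩⟩

theorem add_mem_polySpace {Q R : EuclideanSpace ℝ (Fin d) → ℝ} (hQ : Q ∈ polySpace r E)
    (hR : R ∈ polySpace r E) : (fun x => Q x + R x) ∈ polySpace r E := by
  refine ⟨hQ.1.add hR.1, fun x ξ hξ => ?_⟩
  obtain ⟨P, hP, hPQ⟩ := hQ.2 x ξ hξ
  obtain ⟨S, hS, hSR⟩ := hR.2 x ξ hξ
  exact ⟨P + S, (Polynomial.degree_add_le _ _).trans_lt (max_lt hP hS), fun t => by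
    rw [Polynomial.eval_add, ← hPQ, ← hSR]⟩

/-- The differences that enter the modulus annihilate the polynomial space. -/
theorem finDiff_eq_zero_of_mem_polySpace (hr : 1 ≤ r) {Q : EuclideanSpace ℝ (Fin d) → ℝ}
    (hQ : Q ∈ polySpace r E) {ξ : EuclideanSpace ℝ (Fin d)} (hξ : ξ ∈ E) (u : ℝ)
    (x : EuclideanSpace ℝ (Fin d)) : finDiff r (u • ξ) Q x = 0 := by
  obtain ⟨P, hP, hPQ⟩ := hQ.2 x ξ hξ
  exact fdiff_eq_zero_of_polynomial (u := u) hr hP fun j _ => by rw [smul_smul, hPQ]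

theorem modulus_sub_of_mem_polySpace (hr : 1 ≤ r) {Q : EuclideanSpace ℝ (Fin d) → ℝ}
    (hQ : Q ∈ polySpace r E) (f : EuclideanSpace ℝ (Fin d) → ℝ) :
    modulus r p (fun x => f x - Q x) G E = modulus r p f G E := by
  refine iSup_congr fun ξ => iSup_congr fun hξ => iSup_congr fun u => iSup_congr fun _ => ?_
  refine congrArg (fun g => normL p g _) (funext fun x => ?_)
  have h := fdiff_sub r (u • ξ) f Q x
  rw [← finDiff_eq_fdiff r (u • ξ) Q, finDiff_eq_zero_of_mem_polySpace hr hQ hξ, sub_zero] at h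
  exact h

theorem measurableSet_diffSet (hG : MeasurableSet G) (r : ℕ) (h : EuclideanSpace ℝ (Fin d)) :
    MeasurableSet (diffSet G r h) := by
  have : diffSet G r h = ⋂ j : ℕ, ⋂ _ : j ≤ r, (fun x => x + (j : ℝ) • h) ⁻¹' G := by
    ext x
    simp [diffSet]
  rw [this]
  exact MeasurableSet.iInter fun j => MeasurableSet.iInter fun _ => measurable_add_const _ hG

/-- An element of `L^p(G)` agrees on `G`, up to a null set if `p < ∞`, with a measurable function,
and this changes neither the modulus nor the distance to another function. -/
theorem exists_measurable_of_memL (hG : IsCompact G) {f : EuclideanSpace ℝ (Fin d) → ℝ}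
    (hf : MemL p f G) :
    ∃ g : EuclideanSpace ℝ (Fin d) → ℝ, Measurable g ∧ normL p g G < ⊤ ∧
      (∀ r (E : Set (EuclideanSpace ℝ (Fin d))), modulus r p g G E = modulus r p f G E) ∧
      ∀ Q : EuclideanSpace ℝ (Fin d) → ℝ,
        normL p (fun x => g x - Q x) G = normL p (fun x => f x - Q x) G := by
  rcases eq_or_ne p ⊤ with rfl | hp
  · have hfc : ContinuousOn f G := by
      have h : ContinuousOn f (closure G) := by simpa [MemL] using hf
      exact h.mono subset_closure
    have heq : ∀ x ∈ G, G.indicator f x = f x := fun x hx => Set.indicator_of_mem hx f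
    refine ⟨G.indicator f, ?_, ?_, fun r E => ?_, fun Q => ?_⟩
    · classical
      rw [← Set.piecewise_eq_indicator]
      exact hfc.measurable_piecewise continuousOn_const hG.measurableSet
    · obtain ⟨C, hC⟩ := hG.exists_bound_of_continuousOn hfc
      refine lt_of_le_of_lt (pNorm_top_le_iff.2 fun x hx => ?_)
        (ENNReal.coe_lt_top (r := C.toNNReal))
      rw [heq x hx]
      exact (hC x hx).trans (Real.le_coe_toNNReal C)
    · refine iSup_congr fun ξ => iSup_congr fun _ => iSup_congr fun u => iSup_congr fun _ => ?_
      refine pNorm_congr (measurableSet_diffSet hG.measurableSet r _) fun x hx => ?_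
      refine Finset.sum_congr rfl fun j hj => ?_
      rw [heq _ (hx j (Finset.mem_range_succ_iff.1 hj))]
    · exact pNorm_congr hG.measurableSet fun x hx => by rw [heq x hx]
  · have hf' : MemLp f p (volume.restrict G) := by simpa [MemL, hp] using hf
    set g := hf'.1.mk f with hg
    have heq : g =ᵐ[volume.restrict G] f := hf'.1.ae_eq_mk.symm
    have hnull : ∀ᵐ x, x ∈ G → g x = f x := (ae_restrict_iff' hG.measurableSet).1 heq
    refine ⟨g, hf'.1.stronglyMeasurable_mk.measurable, ?_, fun r E => ?_, fun Q => ?_⟩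
    · rw [normL_eq_pNorm, pNorm_of_ne_top hp, eLpNorm_congr_ae heq]
      exact hf'.2
    · refine iSup_congr fun ξ => iSup_congr fun _ => iSup_congr fun u => iSup_congr fun _ => ?_
      rw [normL_eq_pNorm, normL_eq_pNorm, pNorm_of_ne_top hp, pNorm_of_ne_top hp]
      refine eLpNorm_congr_ae ((ae_restrict_iff' (measurableSet_diffSet hG.measurableSet r _)).2 ?_)
      have hall : ∀ᵐ x, ∀ j : ℕ, x + (j : ℝ) • u • ξ ∈ G →
          g (x + (j : ℝ) • u • ξ) = f (x + (j : ℝ) • u • ξ) :=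
        ae_all_iff.2 fun j =>
          (measurePreserving_add_right volume ((j : ℝ) • u • ξ)).quasiMeasurePreserving.ae hnull
      filter_upwards [hall] with x hx hxG
      refine Finset.sum_congr rfl fun j hj => ?_
      rw [hx j (hxG j (Finset.mem_range_succ_iff.1 hj))]
    · rw [normL_eq_pNorm, normL_eq_pNorm, pNorm_of_ne_top hp, pNorm_of_ne_top hp]
      refine eLpNorm_congr_ae ?_
      filter_upwards [heq] with x hx
      rw [hx]

theorem isSetting_of_closedBall_subset (hd : 1 ≤ d) {ε₀ δ : ℝ} (hE : E ⊆ sphere 0 1)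
    (hcard : E.ncard = d)
    (hinner : ∀ x ∈ sphere (0 : EuclideanSpace ℝ (Fin d)) 1, ∃ ξ ∈ E, ε₀ ≤ |inner ℝ ξ x|)
    (hδ : 0 < δ) (hG : Bornology.IsBounded G) {c : EuclideanSpace ℝ (Fin d)}
    (hc : closedBall c δ ⊆ G) : IsSetting (min ε₀ 1) δ E G := by
  have hnorm : ∀ ξ ∈ E, ‖ξ‖ = 1 := fun ξ hξ => mem_sphere_zero_iff_norm.1 (hE hξ)
  obtain ⟨ξ₀, hξ₀⟩ : E.Nonempty := Set.nonempty_of_ncard_ne_zero (by omega)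
  refine ⟨hd, hnorm, hcard, fun y => ?_, hδ, ?_⟩
  · rcases eq_or_ne y 0 with rfl | hy
    · exact ⟨ξ₀, hξ₀, 1, Or.inl rfl, by simp⟩
    have hy0 : 0 < ‖y‖ := norm_pos_iff.2 hy
    obtain ⟨ξ, hξ, h⟩ := hinner (‖y‖⁻¹ • y) (by simp [norm_smul, hy0.ne'])
    rw [real_inner_smul_right, abs_mul, abs_of_pos (inv_pos.2 hy0), le_inv_mul_iff₀ hy0] at h
    have h' : min ε₀ 1 * ‖y‖ ≤ |inner ℝ ξ y| :=
      (mul_le_mul_of_nonneg_right (min_le_left _ _) hy0.le).trans (by rwa [mul_comm])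
    rcases abs_cases (inner ℝ ξ y : ℝ) with h1 | h1
    · exact ⟨ξ, hξ, -1, Or.inr rfl, by linarith [h1.1]⟩
    · exact ⟨ξ, hξ, 1, Or.inl rfl, by linarith [h1.1]⟩
  · have h1 : c ∈ G := hc (mem_closedBall_self hδ.le)
    have h2 : c + δ • ξ₀ ∈ G := hc (by
      rw [mem_closedBall_iff_norm, add_sub_cancel_left, norm_smul, hnorm _ hξ₀, mul_one,
        Real.norm_of_nonneg hδ.le])
    have h3 := dist_le_diam_of_mem hG h2 h1
    rwa [dist_eq_norm, add_sub_cancel_left, norm_smul, hnorm _ hξ₀, mul_one,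
      Real.norm_of_nonneg hδ.le] at h3

theorem le_two_mul_of_le_add_half {b K : ℝ≥0∞} (hb : b ≠ ⊤) (h : b ≤ K + b / 2) : b ≤ 2 * K := by
  have h1 : b / 2 + b / 2 ≤ K + b / 2 := by rwa [ENNReal.add_halves]
  have h2 : b / 2 ≤ K := (ENNReal.add_le_add_iff_right (ENNReal.div_ne_top hb (by simp))).1 h1
  rwa [ENNReal.div_le_iff (by simp) (by simp), mul_comm] at h2

/-- The self-improving argument: if the error of one correction step is at most `K` plus half of the
norm of the function which is corrected, then the best approximation is at most `2 K`. -/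
theorem bestApprox_le_of_correction {f : EuclideanSpace ℝ (Fin d) → ℝ} (hf : normL p f G < ⊤)
    {K : ℝ≥0∞}
    (h : ∀ Q ∈ polySpace r E, ∃ R ∈ polySpace r E,
      normL p (fun x => f x - Q x - R x) G ≤ K + normL p (fun x => f x - Q x) G / 2) :
    bestApprox r p f G E ≤ 2 * K := by
  have htop : bestApprox r p f G E ≠ ⊤ := by
    refine ((iInf₂_le _ (zero_mem_polySpace r E)).trans_lt ?_).ne
    simpa using hf
  refine le_two_mul_of_le_add_half htop ?_
  have h1 : ∀ Q ∈ polySpace r E,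
      bestApprox r p f G E ≤ K + normL p (fun x => f x - Q x) G / 2 := fun Q hQ => by
    obtain ⟨R, hR, hRQ⟩ := h Q hQ
    refine (iInf₂_le _ (add_mem_polySpace hQ hR)).trans ?_
    simpa only [sub_sub] using hRQ
  have h2 : (bestApprox r p f G E - K) * 2 ≤ bestApprox r p f G E := le_iInf₂ fun Q hQ => by
    rw [← ENNReal.le_div_iff_mul_le (by simp) (by simp)]
    exact tsub_le_iff_left.2 (h1 Q hQ)
  rw [← ENNReal.le_div_iff_mul_le (by simp) (by simp)] at h2
  exact tsub_le_iff_left.1 h2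

theorem exists_whitneyConst_le (hd : 1 ≤ d) (hp : p ≠ 0) (hr : 1 ≤ r) (L : ℝ) {ε₀ : ℝ}
    (hε₀ : 0 < ε₀) :
    ∃ C : ℝ≥0, ∀ E G : Set (EuclideanSpace ℝ (Fin d)),
      E ⊆ sphere 0 1 → E.ncard = d → LinearIndepOn ℝ id E →
      (∀ x ∈ sphere (0 : EuclideanSpace ℝ (Fin d)) 1, ∃ ξ ∈ E, ε₀ ≤ |inner ℝ ξ x|) →
      IsConnected G → IsLip2Domain L G → whitneyConst r p G E ≤ (C : ℝ≥0∞) := by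
  have hd0 : (1 : ℝ) ≤ d := by exact_mod_cast hd
  have hr0 : (1 : ℝ) ≤ r := by exact_mod_cast hr
  set ε : ℝ := min ε₀ 1 with hε
  have hε0 : 0 < ε := lt_min hε₀ one_pos
  have hε1 : ε ≤ 1 := min_le_right _ _
  set τ : ℝ := ε / (2 * (d * (1 + 4 * r))) with hτ
  have hτ0 : 0 < τ := by positivity
  have hτ1 : τ ≤ 1 := by
    rw [hτ, div_le_one (by positivity)]
    nlinarith
  obtain ⟨A₁, hA₁⟩ := exists_controls_closedBall_move d hp hr hε0 hε1 hτ0 hτ1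
  obtain ⟨A₂, hA₂⟩ := exists_controls_closedBall_concentric d hp hr hε0 hε1 hτ0
  obtain ⟨A₃, hA₃⟩ := exists_controls_of_isConnected d hp hr hε0 hε1 L
  set A : ℝ≥0 := A₃ * (1 + A₂ * (1 + A₁)) with hA
  -- with this choice the norm of the corrected function enters with a factor below `1 / 2`
  set θ : ℝ≥0 := (2 * (A + 1))⁻¹ with hθ
  have hθ0 : 0 < θ := by positivity
  have hAθ : A * θ ≤ 2⁻¹ := by
    rw [hθ, mul_inv, mul_left_comm]
    refine mul_le_of_le_one_right' ?_
    rw [← div_eq_mul_inv]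
    exact div_le_one_of_le₀ (by simp) (by positivity)
  obtain ⟨C, hC⟩ := exists_polySpace_local hd hr hp hε0 hε1 hθ0
  refine ⟨2 * (A * (1 + C)), fun E G hE hcard hli hinner hconn hlip => ?_⟩
  obtain ⟨-, hcomp, δ, hδ, hdiam, hball⟩ := hlip
  obtain ⟨x₀, hx₀⟩ := hconn.nonempty
  obtain ⟨c₀, -, hc₀⟩ := hball x₀ hx₀
  have hs : IsSetting ε δ E G :=
    isSetting_of_closedBall_subset hd hE hcard hinner hδ hcomp.isBounded hc₀
  obtain ⟨c₁, hc₁, hloc⟩ := hC E G δ hs hli c₀ hc₀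
  have hctrl : Controls r p E G A (closedBall c₁ (τ * δ)) G :=
    ((hA₁ E G δ hs c₁ c₀ c₀ hc₀ hc₁ (by
      rw [dist_self]
      exact mul_nonneg (by linarith) hδ.le)).trans
      (hA₂ E G δ hs c₀ (τ * δ) δ hδ le_rfl le_rfl hc₀)).trans
      (hA₃ E G δ hs hconn.isPreconnected hcomp.isBounded hdiam hball c₀ hc₀)
  refine iSup_le fun f => iSup_le fun hf => iSup_le fun hω => ?_
  obtain ⟨g, hg, hgfin, hgmod, hgdist⟩ := exists_measurable_of_memL hcomp hf
  have hfg : bestApprox r p f G E = bestApprox r p g G E :=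
    iInf_congr fun Q => iInf_congr fun _ => (hgdist Q).symm
  rw [hfg, ENNReal.coe_mul, ENNReal.coe_ofNat]
  refine bestApprox_le_of_correction hgfin fun Q hQ => ?_
  have hgQ : Measurable fun x => g x - Q x := hg.sub hQ.1.measurable
  have hωQ : modulus r p (fun x => g x - Q x) G E ≤ 1 := by
    rwa [modulus_sub_of_mem_polySpace hr hQ, hgmod]
  obtain ⟨R, hR, hRQ⟩ := hloc _ hgQ
  refine ⟨R, hR, (hctrl (fun x => g x - Q x - R x) (hgQ.sub hR.1.measurable)).trans ?_⟩
  have hωR : modulus r p (fun x => g x - Q x - R x) G E ≤ 1 := by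
    rwa [modulus_sub_of_mem_polySpace hr hR fun x => g x - Q x]
  set X := normL p (fun x => g x - Q x) G with hX
  calc _ ≤ (A : ℝ≥0∞) * (1 + (θ * X + C * 1)) := by
        gcongr
        refine hRQ.trans ?_
        gcongr
    _ = ((A * (1 + C) : ℝ≥0) : ℝ≥0∞) + ((A * θ : ℝ≥0) : ℝ≥0∞) * X := by push_cast; ring
    _ ≤ ((A * (1 + C) : ℝ≥0) : ℝ≥0∞) + ((2⁻¹ : ℝ≥0) : ℝ≥0∞) * X := by
        gcongr
    _ = _ := by
        rw [ENNReal.coe_inv two_ne_zero, ENNReal.coe_ofNat, ENNReal.div_eq_inv_mul]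

end Whitney

end DirWhitney

end

theorem mainTheorem2 (d : ℕ) (hd : 1 ≤ d) :
    -- the directional Whitney inequality on connected compact Lip-2 domains
    (∀ (p : ℝ≥0∞) (r : ℕ) (L ε₀ : ℝ), 0 < p → 1 ≤ r → 1 < L → 0 < ε₀ →
      ∃ C : ℝ≥0, ∀ E G : Set (EuclideanSpace ℝ (Fin d)),
        E ⊆ Metric.sphere 0 1 → E.ncard = d → LinearIndepOn ℝ id E →
        (∀ x ∈ Metric.sphere (0 : EuclideanSpace ℝ (Fin d)) 1,
          ∃ ξ ∈ E, ε₀ ≤ |inner ℝ ξ x|) →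
        IsConnected G → DirWhitney.IsLip2Domain L G →
        DirWhitney.whitneyConst r p G E ≤ (C : ℝ≥0∞)) ∧
    -- connected compact C^2 domains are Lip-2 domains
    (∀ G : Set (EuclideanSpace ℝ (Fin d)), IsConnected G → DirWhitney.IsC2Domain G →
      ∃ L : ℝ, DirWhitney.IsLip2Domain L G) :=
  ⟨fun _ _ L _ hp hr _ hε₀ => DirWhitney.exists_whitneyConst_le hd hp.ne' hr L hε₀,
    fun _ _ hG => hG.isLip2Domain⟩
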